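/- Let $d\ge 1$ and let $A\subset\mathbb{R}\times\mathbb{R}^d$ be open (for instance an open subset of $\mathbb{R}\times\mathbb{R}^d$ contained in $\mathbb{R}_+\times\mathbb{R}^d$). Write points as $(t,x)$, $t\in\mathbb{R}$, $x\in\mathbb{R}^d$. A function $h$ on $A$ is of class $\mathcal{C}^{1,2}$ if $h$, $\partial_t h$ and all space derivatives of $h$ of order one and two exist and are continuous on $A$; it is a *temperature* in $A$ if it is of class $\mathcal{C}^{1,2}$ and $\partial_t h-\Delta_x h=0$ in $A$. Let $\mathbb{S}^d=\{y\in\mathbb{R}^d:\|y\|=1\}$, let $\sigma$ be the surface (Lebesgue) measure on $\mathbb{S}^d$, and let $\psi_d(s)=\sqrt{s\log(s^{-d/2})}$ for $s\in\,]0,1[$. Call $\alpha>0$ admissible at $(t,x)\in A$ if $[t-\alpha,t]\times\overline{B(x,2\sqrt{\alpha d/(2e)})}\subset A$. The function $h$ has the *mean value property* in $A$ if for every $(t,x)\in A$ and every $\alpha$ admissible at $(t,x)$ the integral below exists (that is, its integrand is integrable) and $$h(t,x)=\frac{1}{2\pi^{d/2}}\iint_{(s,y)\in\,]0,1[\times\mathbb{S}^d}\frac1s\,h\bigl(t-\alpha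 s,\,x+2\sqrt{\alpha}\,\psi_d(s)\,y\bigr)\,\psi_d(s)^d\,d\sigma(y)\,ds .$$ 1. If $h$ is a temperature in $A$, then $h$ has the mean value property in $A$. 2. If $h$ is of class $\mathcal{C}^{1,2}$ on $A$ and has the mean value property in $A$, then $h$ is a temperature in $A$. 3. If $d>4$ and $h$ is a bounded, Lebesgue measurable function on $A$, then $h$ is a temperature in $A$ if and only if $h$ has the mean value property in $A$. -/

import Mathlib

open MeasureTheory

noncomputable section

namespace HeatMeanValue

/-- The Euclidean space `ℝ^d`. -/
abbrev Space (d : ℕ) : Type := EuclideanSpace ℝ (Fin d)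

/-- The time derivative `∂_t h (t, x)` at `p = (t, x)`. -/
def timeDeriv {d : ℕ} (h : ℝ × Space d → ℝ) (p : ℝ × Space d) : ℝ :=
  deriv (fun t : ℝ => h (t, p.2)) p.1

/-- The Laplacian in the space variable, `Δ_x h (t, x)`, at `p = (t, x)`. -/
def spaceLaplacian {d : ℕ} (h : ℝ × Space d → ℝ) (p : ℝ × Space d) : ℝ :=
  Laplacian.laplacian (fun x : Space d => h (p.1, x)) p.2

/-- `h` is of class `C^{1,2}` on the open set `A`: it is once differentiable in time and twice
continuously differentiable in space, and `h`, its time derivative and its first and second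
space derivatives are jointly continuous on `A`. -/
structure IsC12On {d : ℕ} (h : ℝ × Space d → ℝ) (A : Set (ℝ × Space d)) : Prop where
  continuousOn : ContinuousOn h A
  differentiableAt_time : ∀ p ∈ A, DifferentiableAt ℝ (fun t : ℝ => h (t, p.2)) p.1
  continuousOn_timeDeriv : ContinuousOn (timeDeriv h) A
  contDiffAt_space : ∀ p ∈ A, ContDiffAt ℝ 2 (fun x : Space d => h (p.1, x)) p.2
  continuousOn_fderiv_space :
    ContinuousOn (fun p : ℝ × Space d => fderiv ℝ (fun x : Space d => h (p.1, x)) p.2) A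
  continuousOn_fderiv_fderiv_space :
    ContinuousOn (fun p : ℝ × Space d =>
      fderiv ℝ (fderiv ℝ (fun x : Space d => h (p.1, x))) p.2) A

/-- `h` is a temperature in `A`: a `C^{1,2}` solution of the heat equation
`∂_t h - Δ_x h = 0` in `A`. -/
def IsTemperature {d : ℕ} (h : ℝ × Space d → ℝ) (A : Set (ℝ × Space d)) : Prop :=
  IsC12On h A ∧ ∀ p ∈ A, timeDeriv h p - spaceLaplacian h p = 0

/-- `ψ_d(s) = √(s log (s^{-d/2}))`. -/
def psi (d : ℕ) (s : ℝ) : ℝ := Real.sqrt (s * Real.log (s ^ (-(d : ℝ) / 2)))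

/-- The integrand `(1/s) h(t - α s, x + 2 √α ψ_d(s) y) ψ_d(s)^d` of the mean value formula, as a
function of `(s, y)`, with `y` in the unit sphere of `ℝ^d`. -/
def meanIntegrand {d : ℕ} (h : ℝ × Space d → ℝ) (t : ℝ) (x : Space d) (α : ℝ)
    (q : ℝ × Metric.sphere (0 : Space d) 1) : ℝ :=
  1 / q.1 * h (t - α * q.1, x + (2 * Real.sqrt α * psi d q.1) • (q.2 : Space d)) * psi d q.1 ^ d

/-- The measure `ds dσ(y)` on `]0,1[ × S`, where `σ` is the surface measure on the unit sphere `S`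
of `ℝ^d`. -/
def meanMeasure (d : ℕ) : Measure (ℝ × Metric.sphere (0 : Space d) 1) :=
  (volume.restrict (Set.Ioo (0 : ℝ) 1)).prod (volume : Measure (Space d)).toSphere

/-- `α` is admissible for `A` at `(t, x)`: `α > 0` and
`[t - α, t] × closedBall(x, 2 √(α d / (2 e))) ⊆ A`. -/
def Admissible {d : ℕ} (A : Set (ℝ × Space d)) (t : ℝ) (x : Space d) (α : ℝ) : Prop :=
  0 < α ∧
    Set.Icc (t - α) t ×ˢ Metric.closedBall x (2 * Real.sqrt (α * d / (2 * Real.exp 1))) ⊆ A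

/-- The mean value property in `A`: at every point of `A` and for every admissible `α`, the
integral exists and the mean value formula holds. -/
def MeanValueProperty {d : ℕ} (h : ℝ × Space d → ℝ) (A : Set (ℝ × Space d)) : Prop :=
  ∀ (t : ℝ) (x : Space d) (α : ℝ), (t, x) ∈ A → Admissible A t x α →
    Integrable (meanIntegrand h t x α) (meanMeasure d) ∧
      h (t, x) =
        1 / (2 * Real.pi ^ ((d : ℝ) / 2)) * ∫ q, meanIntegrand h t x α q ∂(meanMeasure d)

end HeatMeanValue

end

/-! Put L(τ,z) = τ exp(‖z‖²/(2dτ)). The heat kernel is a constant times L^(-d/2), so its level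
surfaces are the heat spheres {L = α}, parametrised by (αs, 2√α ψ_d(s) y), and the formula averages
h over {L = α} translated to (t,x), backwards in time. Let Φ(α) be the unnormalised mean integral at
level α. The change of variables (τ,z) ↦ (α,s,y) in `integral_heatSphere` turns the integral of
(‖z‖²/τ²) w(L) h(t-τ,x+z) into ∫ ρ(α) w(α) Φ(α) dα, with ρ = `levelDensity`. Surface integrals are
thus only met through volume integrals, averaged over the level.

Smooth functions. Let Ψ' = g, with g and Ψ zero on [T,∞). Then (∂_τ - Δ)(Ψ∘L) is -(‖z‖²/τ²) times a
function of L alone. Integration by parts against h(t-τ,x+z) has no boundary term, because L → ∞ as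
τ → 0 when z ≠ 0. It gives `integral_heatBall`: a weighted average of Φ equals -∫ Ψ(L)(∂_t h - Δh).
For g(a) = q(a) a^(-(d/2+1)) the total weight in α is a constant times q'. If h is a temperature,
then ∫ q'Φ = 0 for every q compactly supported in (0,T), and the lemma of du Bois-Reymond makes Φ
constant. Its value at α = 0, where the sphere is a single point, is 2π^(d/2) h(t,x). Conversely,
the mean value property makes ∫ Ψ(L)(∂_t h - Δh) vanish, and a positive Ψ on a small heat ball
excludes a nonzero value of ∂_t h - Δh.

Bounded measurable functions. Averaging the formula over α with a smooth w that vanishes outside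
(0,T) writes h locally as a convolution of the zero extension of h with K = w(L)‖z‖²/τ², up to a
constant. In a heat ball τ^(-b)‖z‖^a is integrable when its order b - a/2 is below d/2 + 1
(`integrable_of_heatLevel_le`). K has order 1, a space derivative costs 1/2 and a time derivative
costs 1, so the joint first derivatives of K and of its space gradient have order at most 5/2, which
is admissible for d > 4. Hence h is of class C^{1,2}, and the smooth case applies. -/

namespace HeatMeanValue
open Set Filter Topology

/-! ### Heat balls and the integrability of kernels supported in them -/

/-- The level function `τ exp(‖z‖² / (2 d τ))`, whose sublevel sets are the heat balls. -/
noncomputable def heatLevel (d : ℕ) (q : ℝ × Space d) : ℝ :=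
  q.1 * Real.exp (‖q.2‖ ^ 2 / (2 * d * q.1))

lemma measurable_heatLevel (d : ℕ) : Measurable (heatLevel d) := by
  unfold heatLevel; fun_prop

lemma le_heatLevel {d : ℕ} {q : ℝ × Space d} (hq : 0 ≤ q.1) : q.1 ≤ heatLevel d q := by
  unfold heatLevel
  have : 1 ≤ Real.exp (‖q.2‖ ^ 2 / (2 * d * q.1)) := Real.one_le_exp (by positivity)
  nlinarith

lemma heatLevel_pos {d : ℕ} {q : ℝ × Space d} (hq : 0 < q.1) : 0 < heatLevel d q :=
  hq.trans_le (le_heatLevel hq.le)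

lemma heatLevel_le_iff {d : ℕ} (hd : 1 ≤ d) {q : ℝ × Space d} (hq : 0 < q.1) {T : ℝ} (hT : 0 < T) :
    heatLevel d q ≤ T ↔ ‖q.2‖ ^ 2 ≤ 2 * d * (q.1 * Real.log (T / q.1)) := by
  have hd' : (0 : ℝ) < d := by exact_mod_cast hd
  have h1 : heatLevel d q ≤ T ↔ Real.exp (‖q.2‖ ^ 2 / (2 * d * q.1)) ≤ T / q.1 := by
    rw [le_div_iff₀ hq, heatLevel, mul_comm]
  rw [h1, ← Real.le_log_iff_exp_le (by positivity), div_le_iff₀ (by positivity)]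
  constructor <;> intro h <;> linarith

/-- Since log u ≤ u/e, the quantity τ log(T/τ) never exceeds T/e. The resulting bound 2dT/e =
4·Td/(2e) on ‖z‖² is the square of the radius in `Admissible`. -/
lemma norm_le_of_heatLevel_le {d : ℕ} (hd : 1 ≤ d) {q : ℝ × Space d} (hq : 0 < q.1) {T : ℝ}
    (h : heatLevel d q ≤ T) : ‖q.2‖ ≤ 2 * Real.sqrt (T * d / (2 * Real.exp 1)) := by
  have hT : 0 < T := (heatLevel_pos hq).trans_le h
  have hd' : (0 : ℝ) < d := by exact_mod_cast hd
  rw [heatLevel_le_iff hd hq hT] at h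
  have h2 : Real.log (T / q.1) ≤ T / q.1 / Real.exp 1 := by
    have := Real.log_le_sub_one_of_pos (x := T / q.1 / Real.exp 1) (by positivity)
    rw [Real.log_div (by positivity) (by positivity), Real.log_exp] at this
    linarith
  have h3 : q.1 * Real.log (T / q.1) ≤ T / Real.exp 1 := by
    calc q.1 * Real.log (T / q.1) ≤ q.1 * (T / q.1 / Real.exp 1) := by gcongr
      _ = T / Real.exp 1 := by field_simp
  have h4 : ‖q.2‖ ^ 2 ≤ 4 * (T * d / (2 * Real.exp 1)) := by
    calc ‖q.2‖ ^ 2 ≤ _ := h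
      _ ≤ 2 * d * (T / Real.exp 1) := by gcongr
      _ = _ := by ring
  rw [show (2 : ℝ) = Real.sqrt 4 by rw [show (4 : ℝ) = 2 ^ 2 by norm_num]; simp,
    ← Real.sqrt_mul (by norm_num)]
  apply Real.le_sqrt_of_sq_le
  convert h4 using 3
  rw [show (4 : ℝ) = 2 ^ 2 by norm_num]; simp

/-- The set of increments `(τ, z)` swept out by the heat balls of level at most `T`. -/
def heatCylinder (d : ℕ) (T : ℝ) : Set (ℝ × Space d) :=
  Icc 0 T ×ˢ Metric.closedBall 0 (2 * Real.sqrt (T * d / (2 * Real.exp 1)))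

lemma mem_heatCylinder {d : ℕ} (hd : 1 ≤ d) {q : ℝ × Space d} (hq : 0 < q.1) {T : ℝ}
    (h : heatLevel d q ≤ T) : q ∈ heatCylinder d T :=
  ⟨⟨hq.le, (le_heatLevel hq.le).trans h⟩, by simpa using norm_le_of_heatLevel_le hd hq h⟩

lemma isCompact_heatCylinder (d : ℕ) (T : ℝ) : IsCompact (heatCylinder d T) :=
  isCompact_Icc.prod (isCompact_closedBall _ _)

lemma integrable_rexp_neg_mul_sq_norm {d : ℕ} {b : ℝ} (hb : 0 < b) :
    Integrable (fun z : Space d => Real.exp (-b * ‖z‖ ^ 2)) := by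
  apply Integrable.of_integral_ne_zero
  rw [GaussianFourier.integral_rexp_neg_mul_sq_norm hb]
  positivity

/-- Integrating the Gaussian in z leaves a constant times τ^(d/2 - m), whose exponent exceeds -1. -/
lemma integrable_indicator_gaussian {d : ℕ} {m c T : ℝ} (hc : 0 < c) (hT : 0 < T)
    (hm : m < d / 2 + 1) :
    Integrable (fun q : ℝ × Space d =>
      (Ioc 0 T).indicator (fun τ => τ ^ (-m) * Real.exp (-c * ‖q.2‖ ^ 2 / τ)) q.1) := by
  have hmeas : Measurable (fun q : ℝ × Space d => q.1 ^ (-m) * Real.exp (-c * ‖q.2‖ ^ 2 / q.1)) := by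
    fun_prop
  have hmeas2 : Measurable (fun q : ℝ × Space d =>
      (Ioc 0 T).indicator (fun τ => τ ^ (-m) * Real.exp (-c * ‖q.2‖ ^ 2 / τ)) q.1) := by
    exact hmeas.indicator (measurableSet_Ioc.preimage (measurable_fst (α := ℝ) (β := Space d)) :
      MeasurableSet (Prod.fst ⁻¹' Ioc 0 T))
  have hexp : ∀ τ : ℝ, ∀ z : Space d, -c * ‖z‖ ^ 2 / τ = -(c / τ) * ‖z‖ ^ 2 := by
    intros; ring
  rw [Measure.volume_eq_prod, integrable_prod_iff hmeas2.aestronglyMeasurable]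
  constructor
  · refine Eventually.of_forall fun τ => ?_
    by_cases hτ : τ ∈ Ioc 0 T
    · simp only [indicator_of_mem hτ, hexp]
      exact (integrable_rexp_neg_mul_sq_norm (div_pos hc hτ.1)).const_mul _
    · simp only [indicator_of_notMem hτ]
      exact integrable_zero _ _ _
  · have : (fun τ : ℝ => ∫ z : Space d,
        ‖(Ioc 0 T).indicator (fun τ => τ ^ (-m) * Real.exp (-c * ‖z‖ ^ 2 / τ)) τ‖) =
        (Ioc 0 T).indicator (fun τ => (Real.pi / c) ^ ((d : ℝ) / 2) * τ ^ ((d : ℝ) / 2 - m)) := by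
      ext τ
      by_cases hτ : τ ∈ Ioc 0 T
      · have hτ0 := hτ.1
        simp only [indicator_of_mem hτ, hexp]
        have : ∀ z : Space d, ‖τ ^ (-m) * Real.exp (-(c / τ) * ‖z‖ ^ 2)‖ =
            τ ^ (-m) * Real.exp (-(c / τ) * ‖z‖ ^ 2) := fun z =>
          Real.norm_of_nonneg (by positivity)
        simp only [this]
        rw [integral_const_mul, GaussianFourier.integral_rexp_neg_mul_sq_norm (div_pos hc hτ0)]
        simp only [finrank_euclideanSpace, Fintype.card_fin]
        rw [show Real.pi / (c / τ) = (Real.pi / c) * τ by field_simp,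
          Real.mul_rpow (by positivity) hτ0.le, sub_eq_add_neg, Real.rpow_add hτ0]
        ring
      · simp [indicator_of_notMem hτ]
    rw [this, integrable_indicator_iff measurableSet_Ioc]
    apply Integrable.const_mul
    have := (intervalIntegral.intervalIntegrable_rpow' (a := 0) (b := T)
      (r := (d : ℝ) / 2 - m) (by linarith))
    rwa [intervalIntegrable_iff_integrableOn_Ioc_of_le hT.le] at this

/-- One term of the exponential series controls (y^a)², and y^a is at most 1 + (y^a)². -/
lemma pow_le_mul_exp {c : ℝ} (hc : 0 < c) (a : ℕ) : ∃ K, 0 ≤ K ∧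
    ∀ y : ℝ, 0 ≤ y → y ^ a ≤ K * Real.exp (c * y ^ 2) := by
  refine ⟨1 + a.factorial / c ^ a, by positivity, fun y hy => ?_⟩
  have h1 : (c * y ^ 2) ^ a / a.factorial ≤ Real.exp (c * y ^ 2) :=
    Real.pow_div_factorial_le_exp _ (by positivity) a
  have h2 : (y ^ a) ^ 2 ≤ a.factorial / c ^ a * Real.exp (c * y ^ 2) := by
    rw [div_mul_eq_mul_div, le_div_iff₀ (by positivity)]
    rw [div_le_iff₀ (by positivity)] at h1
    calc (y ^ a) ^ 2 * c ^ a = (c * y ^ 2) ^ a := by rw [mul_pow, ← pow_mul, ← pow_mul]; ring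
      _ ≤ _ := by linarith
  have h3 : 1 ≤ Real.exp (c * y ^ 2) := Real.one_le_exp (by positivity)
  nlinarith [sq_nonneg (y ^ a - 1), pow_nonneg hy a]

/-- Kernels supported in a heat ball are integrable when their parabolic order is less than
`d / 2 + 1`. -/
lemma integrable_of_heatLevel_le {d : ℕ} (hd : 1 ≤ d) {F : Type*} [NormedAddCommGroup F]
    {k : ℝ × Space d → F} {a b : ℕ} {C T : ℝ} (hk : AEStronglyMeasurable k)
    (hsupp : ∀ q, k q ≠ 0 → 0 < q.1 ∧ heatLevel d q ≤ T)
    (hbd : ∀ q, 0 < q.1 → heatLevel d q ≤ T → ‖k q‖ ≤ C * (q.1⁻¹) ^ b * ‖q.2‖ ^ a)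
    (hab : (b : ℝ) - a / 2 < d / 2 + 1) : Integrable k := by
  have hd' : (0 : ℝ) < d := by exact_mod_cast hd
  by_cases hT : 0 < T
  swap
  · have : k = 0 := by
      ext q
      by_contra h
      have := hsupp q h
      exact hT ((heatLevel_pos this.1).trans_le this.2)
    rw [this]; exact integrable_zero _ _ _
  -- κ is half of the gap between the order b - a/2 and the critical order d/2 + 1, so the order b -
  -- a/2 + κ is still subcritical.
  set κ : ℝ := (d / 2 + 1 - (b - a / 2)) / 2 with hκ
  have hκ0 : 0 < κ := by rw [hκ]; linarith
  set c : ℝ := κ / (4 * d) with hc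
  have hc0 : 0 < c := by positivity
  obtain ⟨K, hK0, hK⟩ := pow_le_mul_exp hc0 a
  have hint := (integrable_indicator_gaussian (d := d) (m := (b : ℝ) - a / 2 + κ) hc0 hT
    (by linarith)).const_mul (|C| * K * T ^ κ)
  refine hint.mono' hk (Eventually.of_forall fun q => ?_)
  by_cases hq : k q = 0
  · rw [hq, norm_zero]
    apply mul_nonneg (by positivity)
    apply indicator_nonneg
    intro τ hτ
    have := hτ.1
    positivity
  obtain ⟨hq0, hqT⟩ := hsupp q hq
  rw [indicator_of_mem (show q.1 ∈ Ioc 0 T from ⟨hq0, (le_heatLevel hq0.le).trans hqT⟩)]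
  set τ := q.1
  set r := ‖q.2‖
  have hr : 0 ≤ r := norm_nonneg _
  set y := r / Real.sqrt τ with hy
  have hsτ : 0 < Real.sqrt τ := Real.sqrt_pos.2 hq0
  have hy2 : y ^ 2 = r ^ 2 / τ := by rw [hy, div_pow, Real.sq_sqrt hq0.le]
  -- Raising L ≤ T to the power κ buys Gaussian decay at the price of a factor τ^(-κ). Half of this
  -- decay then absorbs the polynomial factor y^a; the other half remains in the majorant.
  have h1 : (1 : ℝ) ≤ T ^ κ * τ ^ (-κ) * Real.exp (-(2 * c) * y ^ 2) := by
    have e1 : Real.exp (y ^ 2 / (2 * d)) ≤ T / τ := by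
      rw [le_div_iff₀ hq0, mul_comm, hy2,
        show r ^ 2 / τ / (2 * d) = r ^ 2 / (2 * d * τ) by rw [div_div, mul_comm]]
      exact hqT
    have e2 := Real.rpow_le_rpow (Real.exp_pos _).le e1 hκ0.le
    rw [← Real.exp_mul, Real.div_rpow hT.le hq0.le] at e2
    rw [neg_mul, Real.exp_neg, Real.rpow_neg hq0.le, ← div_eq_mul_inv, ← div_eq_mul_inv,
      le_div_iff₀ (Real.exp_pos _), one_mul,
      show 2 * c * y ^ 2 = y ^ 2 / (2 * d) * κ by rw [hc]; field_simp; ring]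
    exact e2
  have h2 : r ^ a ≤ τ ^ ((a : ℝ) / 2) * (K * Real.exp (c * y ^ 2)) := by
    have : r ^ a = τ ^ ((a : ℝ) / 2) * y ^ a := by
      rw [hy, div_pow, Real.sqrt_eq_rpow, ← Real.rpow_natCast (τ ^ _), ← Real.rpow_mul hq0.le]
      rw [show (1 / 2 * (a : ℝ)) = a / 2 by ring]
      field_simp
    rw [this]
    gcongr
    exact hK y (by positivity)
  calc ‖k q‖ ≤ C * (τ⁻¹) ^ b * r ^ a := hbd q hq0 hqT
    _ ≤ |C| * (τ⁻¹) ^ b * r ^ a := by gcongr; exact le_abs_self C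
    _ ≤ |C| * (τ⁻¹) ^ b * (τ ^ ((a : ℝ) / 2) * (K * Real.exp (c * y ^ 2))) * 1 := by
        rw [mul_one]; gcongr
    _ ≤ |C| * (τ⁻¹) ^ b * (τ ^ ((a : ℝ) / 2) * (K * Real.exp (c * y ^ 2))) *
        (T ^ κ * τ ^ (-κ) * Real.exp (-(2 * c) * y ^ 2)) := by gcongr
    _ = |C| * K * T ^ κ * (((τ⁻¹) ^ b * τ ^ ((a : ℝ) / 2) * τ ^ (-κ)) *
        (Real.exp (c * y ^ 2) * Real.exp (-(2 * c) * y ^ 2))) := by ring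
    _ = _ := by
      congr 2
      · rw [inv_pow, ← Real.rpow_natCast, ← Real.rpow_neg hq0.le, ← Real.rpow_add hq0,
          ← Real.rpow_add hq0]
        congr 1; ring
      · rw [← Real.exp_add, hy2]; congr 1; ring

end HeatMeanValue

/-! ### Polar coordinates adapted to heat spheres -/

namespace HeatMeanValue
open Set Filter Topology ENNReal

lemma lintegral_eq_lintegral_sphere {d : ℕ} (hd : 1 ≤ d) {g : Space d → ℝ≥0∞} (hg : Measurable g) :
    ∫⁻ z, g z = ∫⁻ y, (∫⁻ r in Ioi (0 : ℝ), ENNReal.ofReal (r ^ (d - 1)) * g (r • (y : Space d)))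
      ∂(volume : Measure (Space d)).toSphere := by
  have : Nonempty (Fin d) := ⟨⟨0, hd⟩⟩
  have hmp := (volume : Measure (Space d)).measurePreserving_homeomorphUnitSphereProd
  have hmps := hmp.symm (homeomorphUnitSphereProd (Space d)).toMeasurableEquiv
  calc ∫⁻ z, g z = ∫⁻ z in {0}ᶜ, g z := by rw [restrict_compl_singleton]
    _ = ∫⁻ z : ({0}ᶜ : Set (Space d)), g z ∂((volume : Measure (Space d)).comap (↑)) := by
      rw [lintegral_subtype_comap (measurableSet_singleton _).compl]
    _ = ∫⁻ p, g ((homeomorphUnitSphereProd (Space d)).toMeasurableEquiv.symm p)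
        ∂((volume : Measure (Space d)).toSphere.prod
          (Measure.volumeIoiPow (Module.finrank ℝ (Space d) - 1))) :=
      (hmps.lintegral_comp (hg.comp measurable_subtype_coe)).symm
    _ = ∫⁻ y, (∫⁻ r, g (r.1 • (y : Space d)) ∂(Measure.volumeIoiPow (d - 1)))
          ∂(volume : Measure (Space d)).toSphere := by
      rw [lintegral_prod]
      · simp [Homeomorph.toMeasurableEquiv]
      · exact ((hg.comp measurable_subtype_coe).comp (MeasurableEquiv.measurable _)).aemeasurable
    _ = _ := by
      refine lintegral_congr fun y => ?_
      rw [Measure.volumeIoiPow, lintegral_withDensity_eq_lintegral_mul _ (by fun_prop) (by fun_prop),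
        ← lintegral_subtype_comap measurableSet_Ioi]
      rfl

lemma two_mul_sqrt_mul_psi {d : ℕ} {α s : ℝ} (hα : 0 ≤ α) (hs : s ∈ Ioo (0 : ℝ) 1) :
    2 * Real.sqrt α * psi d s = Real.sqrt (2 * d * (α * s) * -Real.log s) := by
  have h0 : 0 < -Real.log s := by linarith [Real.log_neg hs.1 hs.2]
  have := hs.1
  rw [psi, Real.log_rpow hs.1,
    show (2 : ℝ) = Real.sqrt 4 by rw [show (4 : ℝ) = 2 ^ 2 by norm_num]; simp,
    ← Real.sqrt_mul (by norm_num), ← Real.sqrt_mul (by positivity),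
    show Real.sqrt 4 = 2 by rw [show (4 : ℝ) = 2 ^ 2 by norm_num]; simp]
  congr 1; ring

lemma measurable_psi (d : ℕ) : Measurable (psi d) := by
  unfold psi; fun_prop

lemma psi_nonneg (d : ℕ) (s : ℝ) : 0 ≤ psi d s := Real.sqrt_nonneg _

/-- Substitution r = √(2dτ log(1/s)) at fixed τ, that is s = τ/L. Since |dr/ds| = dτ/(s r), the
weight r²/τ² turns r^(d-1) into a multiple of r^d. -/
lemma lintegral_Ioi_eq_lintegral_Ioo {d : ℕ} (hd : 1 ≤ d) {τ : ℝ} (hτ : 0 < τ) (g : ℝ → ℝ≥0∞) :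
    ∫⁻ r in Ioi (0 : ℝ), ENNReal.ofReal (r ^ (d - 1)) * (ENNReal.ofReal (r ^ 2 / τ ^ 2) * g r) =
      ∫⁻ s in Ioo (0 : ℝ) 1,
        ENNReal.ofReal (d * Real.sqrt (2 * d * τ * -Real.log s) ^ d / (τ * s)) *
          g (Real.sqrt (2 * d * τ * -Real.log s)) := by
  have hd' : (0 : ℝ) < d := by exact_mod_cast hd
  set f : ℝ → ℝ := fun s => Real.sqrt (2 * d * τ * -Real.log s) with hf
  have hlog : ∀ s ∈ Ioo (0 : ℝ) 1, 0 < -Real.log s := fun s hs => by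
    linarith [Real.log_neg hs.1 hs.2]
  have hfpos : ∀ s ∈ Ioo (0 : ℝ) 1, 0 < f s := fun s hs => by
    have := hlog s hs
    exact Real.sqrt_pos.2 (by positivity)
  have himage : f '' Ioo 0 1 = Ioi 0 := by
    ext r
    constructor
    · rintro ⟨s, hs, rfl⟩
      exact hfpos s hs
    · intro hr
      have hr : 0 < r := hr
      refine ⟨Real.exp (-(r ^ 2 / (2 * d * τ))), ⟨Real.exp_pos _, ?_⟩, ?_⟩
      · rw [Real.exp_lt_one_iff]
        have : 0 < r ^ 2 / (2 * d * τ) := by positivity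
        linarith
      · simp only [hf, Real.log_exp, neg_neg]
        rw [mul_div_cancel₀ _ (by positivity), Real.sqrt_sq hr.le]
  have hinj : InjOn f (Ioo 0 1) := by
    intro s hs s' hs' h
    have h1 := hlog s hs
    have h2 := hlog s' hs'
    simp only [hf] at h
    rw [Real.sqrt_inj (by positivity) (by positivity)] at h
    have h3 : -Real.log s = -Real.log s' := mul_left_cancel₀ (by positivity) h
    exact Real.log_injOn_pos hs.1 hs'.1 (neg_injective h3)
  have hderiv : ∀ s ∈ Ioo (0 : ℝ) 1, HasDerivWithinAt f (-(d * τ / (s * f s))) (Ioo 0 1) s := by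
    intro s hs
    have h1 := hlog s hs
    have h2 := hfpos s hs
    have h3 := (((Real.hasDerivAt_log hs.1.ne').neg).const_mul (2 * d * τ)).sqrt
      (by positivity)
    refine h3.hasDerivWithinAt.congr_deriv ?_
    change _ / (2 * f s) = _
    have := hs.1
    field_simp
  rw [← himage, lintegral_image_eq_lintegral_abs_deriv_mul measurableSet_Ioo hderiv hinj]
  refine setLIntegral_congr_fun measurableSet_Ioo fun s hs => ?_
  have h2 := hfpos s hs
  have hs0 := hs.1
  rw [← mul_assoc, ← mul_assoc, ← ENNReal.ofReal_mul (abs_nonneg _),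
    ← ENNReal.ofReal_mul (by positivity)]
  congr 2
  rw [abs_neg, abs_of_pos (by positivity)]
  change _ = ↑d * f s ^ d / (τ * s)
  obtain ⟨n, rfl⟩ : ∃ n, d = n + 1 := ⟨d - 1, by omega⟩
  simp only [Nat.add_sub_cancel]
  field_simp
  ring

lemma lintegral_Ioi_eq_lintegral_Ioi_mul {s : ℝ} (hs : 0 < s) (g : ℝ → ℝ≥0∞) :
    ∫⁻ τ in Ioi (0 : ℝ), g τ = ∫⁻ α in Ioi (0 : ℝ), ENNReal.ofReal s * g (α * s) := by
  have himage : (fun α => α * s) '' Ioi 0 = Ioi 0 := by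
    ext τ
    constructor
    · rintro ⟨α, hα, rfl⟩
      exact mul_pos hα hs
    · intro hτ
      exact ⟨τ / s, div_pos hτ hs, by field_simp⟩
  conv_lhs => rw [← himage]
  rw [lintegral_image_eq_lintegral_abs_deriv_mul (f' := fun _ => s) measurableSet_Ioi
    (fun x _ => by simpa using ((hasDerivAt_id x).mul_const s).hasDerivWithinAt)
    (fun a _ b _ h => mul_right_cancel₀ hs.ne' h)]
  simp [abs_of_pos hs]

/-- The point `(α s, 2 √α ψ_d(s) y)` of the heat sphere of level `α`. -/
noncomputable def heatSpherePoint (d : ℕ) (p : ℝ × ℝ × Metric.sphere (0 : Space d) 1) :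
    ℝ × Space d :=
  (p.1 * p.2.1, (2 * Real.sqrt p.1 * psi d p.2.1) • (p.2.2 : Space d))

lemma measurable_heatSpherePoint (d : ℕ) : Measurable (heatSpherePoint d) := by
  have := measurable_psi d
  unfold heatSpherePoint
  fun_prop

/-- The density of the heat sphere decomposition in the level variable. -/
noncomputable def levelDensity (d : ℕ) (α : ℝ) : ℝ := d * (2 * Real.sqrt α) ^ d / α

lemma levelDensity_nonneg (d : ℕ) {α : ℝ} (hα : 0 < α) : 0 ≤ levelDensity d α := by
  unfold levelDensity; positivity

instance (d : ℕ) : SFinite (meanMeasure d) := by unfold meanMeasure; infer_instance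

/-- Three changes of variables: polar coordinates in z, then s = τ/L in place of the radius at fixed
τ, then α = τ/s in place of τ at fixed s. By Tonelli the order of integration can be exchanged
freely between them. -/
lemma lintegral_heatSphere {d : ℕ} (hd : 1 ≤ d) {g : ℝ × Space d → ℝ≥0∞} (hg : Measurable g) :
    ∫⁻ q in Ioi (0 : ℝ) ×ˢ univ, ENNReal.ofReal (‖q.2‖ ^ 2 / q.1 ^ 2) * g q =
      ∫⁻ α in Ioi (0 : ℝ), ∫⁻ p,
        ENNReal.ofReal (levelDensity d α * (psi d p.1 ^ d / p.1)) *
          g (heatSpherePoint d (α, p)) ∂(meanMeasure d) := by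
  have hd' : (0 : ℝ) < d := by exact_mod_cast hd
  have hpsi := measurable_psi d
  have hsp := measurable_heatSpherePoint d
  calc ∫⁻ q in Ioi (0 : ℝ) ×ˢ univ, ENNReal.ofReal (‖q.2‖ ^ 2 / q.1 ^ 2) * g q
      = ∫⁻ τ in Ioi (0 : ℝ), ∫⁻ z : Space d, ENNReal.ofReal (‖z‖ ^ 2 / τ ^ 2) * g (τ, z) := by
        rw [Measure.volume_eq_prod, ← Measure.prod_restrict, Measure.restrict_univ,
          lintegral_prod _ (by fun_prop)]
    _ = ∫⁻ τ in Ioi (0 : ℝ), ∫⁻ y, (∫⁻ s in Ioo (0 : ℝ) 1,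
          ENNReal.ofReal (d * Real.sqrt (2 * d * τ * -Real.log s) ^ d / (τ * s)) *
          g (τ, Real.sqrt (2 * d * τ * -Real.log s) • (y : Space d)))
          ∂(volume : Measure (Space d)).toSphere := by
        refine setLIntegral_congr_fun measurableSet_Ioi fun τ hτ => ?_
        rw [lintegral_eq_lintegral_sphere hd (by fun_prop)]
        refine lintegral_congr fun y => ?_
        rw [← lintegral_Ioi_eq_lintegral_Ioo hd hτ (fun r => g (τ, r • (y : Space d)))]
        refine setLIntegral_congr_fun measurableSet_Ioi fun r hr => ?_
        simp [norm_smul]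
    _ = ∫⁻ τ in Ioi (0 : ℝ), ∫⁻ p,
          ENNReal.ofReal (d * Real.sqrt (2 * d * τ * -Real.log p.1) ^ d / (τ * p.1)) *
          g (τ, Real.sqrt (2 * d * τ * -Real.log p.1) • (p.2 : Space d)) ∂(meanMeasure d) := by
        refine lintegral_congr fun τ => ?_
        rw [meanMeasure, lintegral_prod_symm _ (by fun_prop)]
    _ = ∫⁻ p, (∫⁻ τ in Ioi (0 : ℝ),
          ENNReal.ofReal (d * Real.sqrt (2 * d * τ * -Real.log p.1) ^ d / (τ * p.1)) *
          g (τ, Real.sqrt (2 * d * τ * -Real.log p.1) • (p.2 : Space d))) ∂(meanMeasure d) := by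
        rw [lintegral_lintegral_swap]
        fun_prop
    _ = ∫⁻ p, (∫⁻ α in Ioi (0 : ℝ),
        ENNReal.ofReal (levelDensity d α * (psi d p.1 ^ d / p.1)) *
          g (heatSpherePoint d (α, p))) ∂(meanMeasure d) := by
        have hae : ∀ᵐ p ∂(meanMeasure d), p.1 ∈ Ioo (0 : ℝ) 1 := by
          rw [meanMeasure]
          exact Measure.quasiMeasurePreserving_fst.ae (ae_restrict_mem measurableSet_Ioo)
        refine lintegral_congr_ae ?_
        filter_upwards [hae] with p hp
        rw [lintegral_Ioi_eq_lintegral_Ioi_mul hp.1]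
        refine setLIntegral_congr_fun measurableSet_Ioi fun α hα => ?_
        have hα : 0 < α := hα
        have hp0 := hp.1
        simp only [heatSpherePoint]
        rw [← two_mul_sqrt_mul_psi hα.le hp, ← mul_assoc, ← ENNReal.ofReal_mul hp0.le]
        congr 2
        rw [levelDensity]
        field_simp
        rw [mul_pow]
    _ = _ := by
        rw [lintegral_lintegral_swap]
        unfold levelDensity
        fun_prop

lemma heatLevel_heatSpherePoint {d : ℕ} (hd : 1 ≤ d) {α : ℝ} (hα : 0 < α)
    {p : ℝ × Metric.sphere (0 : Space d) 1} (hp : p.1 ∈ Ioo (0 : ℝ) 1) :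
    heatLevel d (heatSpherePoint d (α, p)) = α := by
  have hd' : (0 : ℝ) < d := by exact_mod_cast hd
  have hp0 := hp.1
  have hlog : 0 < -Real.log p.1 := by linarith [Real.log_neg hp.1 hp.2]
  simp only [heatSpherePoint, heatLevel]
  rw [two_mul_sqrt_mul_psi hα.le hp, norm_smul, Real.norm_of_nonneg (Real.sqrt_nonneg _),
    norm_eq_of_mem_sphere, mul_one, Real.sq_sqrt (by positivity),
    mul_div_cancel_left₀ _ (by positivity), Real.exp_neg, Real.exp_log hp0]
  field_simp

lemma ae_meanMeasure (d : ℕ) : ∀ᵐ p ∂(meanMeasure d), p.1 ∈ Ioo (0 : ℝ) 1 := by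
  rw [meanMeasure]
  exact Measure.quasiMeasurePreserving_fst.ae (ae_restrict_mem measurableSet_Ioo)

lemma integral_heatSphere {d : ℕ} (hd : 1 ≤ d) {F : ℝ × Space d → ℝ}
    (hF : IntegrableOn (fun q => ‖q.2‖ ^ 2 / q.1 ^ 2 * F q) (Ioi (0 : ℝ) ×ˢ univ)) :
    ∫ q in Ioi (0 : ℝ) ×ˢ univ, ‖q.2‖ ^ 2 / q.1 ^ 2 * F q =
      ∫ α in Ioi (0 : ℝ), levelDensity d α *
        ∫ p, psi d p.1 ^ d / p.1 * F (heatSpherePoint d (α, p)) ∂(meanMeasure d) := by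
  have hpsi := measurable_psi d
  have hsp := measurable_heatSpherePoint d
  set κ : ℝ × Space d → ℝ := fun q => ‖q.2‖ ^ 2 / q.1 ^ 2 with hκ
  have hκm : Measurable κ := by fun_prop
  have hκ0 : ∀ q, 0 ≤ κ q := fun q => by positivity
  set J : ℝ × ℝ × Metric.sphere (0 : Space d) 1 → ℝ :=
    fun p => levelDensity d p.1 * (psi d p.2.1 ^ d / p.2.1) with hJ
  have hJm : Measurable J := by simp only [hJ]; unfold levelDensity; fun_prop
  set μ := ((volume : Measure ℝ).restrict (Ioi 0)).prod (meanMeasure d) with hμ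
  set ν := (volume : Measure (ℝ × Space d)).restrict (Ioi (0 : ℝ) ×ˢ univ) with hν
  have hJ0 : ∀ᵐ p ∂μ, 0 ≤ J p := by
    have h1 : ∀ᵐ p ∂μ, p.1 ∈ Ioi (0 : ℝ) :=
      Measure.quasiMeasurePreserving_fst.ae (ae_restrict_mem measurableSet_Ioi)
    have h2 : ∀ᵐ p ∂μ, p.2.1 ∈ Ioo (0 : ℝ) 1 :=
      Measure.quasiMeasurePreserving_snd.ae (ae_meanMeasure d)
    filter_upwards [h1, h2] with p hp1 hp2
    exact mul_nonneg (levelDensity_nonneg d hp1)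
      (div_nonneg (pow_nonneg (psi_nonneg d _) _) hp2.1.le)
  -- Stated as an equality of measures, the identity for nonnegative integrands transfers to signed
  -- ones.
  have hmap : (μ.withDensity fun p => ENNReal.ofReal (J p)).map (heatSpherePoint d) =
      ν.withDensity fun q => ENNReal.ofReal (κ q) := by
    refine Measure.ext_of_lintegral _ fun g hg => ?_
    rw [lintegral_map hg hsp, lintegral_withDensity_eq_lintegral_mul _ (by fun_prop) (by fun_prop),
      lintegral_withDensity_eq_lintegral_mul _ (by fun_prop) hg]
    have := lintegral_heatSphere hd hg
    simp only [Pi.mul_apply]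
    rw [this, hμ, lintegral_prod _ (by fun_prop)]
  have hFν : Integrable F (ν.withDensity fun q => ENNReal.ofReal (κ q)) := by
    rw [integrable_withDensity_iff_integrable_smul' (by fun_prop) (by simp)]
    refine hF.congr (Eventually.of_forall fun q => ?_)
    simp only [smul_eq_mul, ENNReal.toReal_ofReal (hκ0 q)]
    rfl
  have hFμ : Integrable (fun p => J p * F (heatSpherePoint d p)) μ := by
    rw [← hmap] at hFν
    have h1 := (integrable_map_measure hFν.aestronglyMeasurable hsp.aemeasurable).1 hFν
    rw [integrable_withDensity_iff_integrable_smul' (by fun_prop) (by simp)] at h1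
    refine h1.congr ?_
    filter_upwards [hJ0] with p hp
    simp [ENNReal.toReal_ofReal hp]
  calc ∫ q in Ioi (0 : ℝ) ×ˢ univ, κ q * F q
      = ∫ q, F q ∂(ν.withDensity fun q => ENNReal.ofReal (κ q)) := by
        rw [integral_withDensity_eq_integral_toReal_smul (by fun_prop) (by simp)]
        simp only [smul_eq_mul, ENNReal.toReal_ofReal (hκ0 _)]
        rfl
    _ = ∫ p, F (heatSpherePoint d p) ∂(μ.withDensity fun p => ENNReal.ofReal (J p)) := by
        rw [← hmap, integral_map hsp.aemeasurable]
        rw [hmap]; exact hFν.aestronglyMeasurable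
    _ = ∫ p, J p * F (heatSpherePoint d p) ∂μ := by
        rw [integral_withDensity_eq_integral_toReal_smul (by fun_prop) (by simp)]
        refine integral_congr_ae ?_
        filter_upwards [hJ0] with p hp
        simp [ENNReal.toReal_ofReal hp]
    _ = _ := by
        rw [hμ, integral_prod _ hFμ]
        refine integral_congr_ae (Eventually.of_forall fun α => ?_)
        simp only [hJ]
        rw [← integral_const_mul]
        simp only [mul_assoc]

/-- Averages of the mean value integrals over the level are volume integrals. -/
lemma integral_heatLevel_mul_eq {d : ℕ} (hd : 1 ≤ d) {w : ℝ → ℝ} {f : ℝ × Space d → ℝ}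
    {t : ℝ} {x : Space d}
    (hF : IntegrableOn (fun q => ‖q.2‖ ^ 2 / q.1 ^ 2 *
      (w (heatLevel d q) * f (t - q.1, x + q.2))) (Ioi (0 : ℝ) ×ˢ univ)) :
    ∫ q in Ioi (0 : ℝ) ×ˢ univ, ‖q.2‖ ^ 2 / q.1 ^ 2 *
      (w (heatLevel d q) * f (t - q.1, x + q.2)) =
      ∫ α in Ioi (0 : ℝ), levelDensity d α * w α *
        ∫ p, meanIntegrand f t x α p ∂(meanMeasure d) := by
  rw [integral_heatSphere hd hF]
  refine setIntegral_congr_fun measurableSet_Ioi fun α hα => ?_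
  rw [mul_assoc, ← integral_const_mul (w α)]
  congr 1
  refine integral_congr_ae ?_
  filter_upwards [ae_meanMeasure d] with p hp
  rw [heatLevel_heatSpherePoint hd hα hp]
  simp only [meanIntegrand, heatSpherePoint]
  ring

end HeatMeanValue

/-! ### The mean integral as a function of the level: normalisation and continuity -/

namespace HeatMeanValue
open Set Filter Topology ENNReal

/-- With s = e^(-u) the integrand becomes (d/2)^(d/2) u^(d/2) e^(-du/2), a Gamma integral. -/
lemma integral_psi_pow_div {d : ℕ} (hd : 1 ≤ d) :
    ∫ s in Ioo (0 : ℝ) 1, psi d s ^ d / s = 2 / d * Real.Gamma (d / 2 + 1) := by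
  have hd' : (0 : ℝ) < d := by exact_mod_cast hd
  have himage : (fun u : ℝ => Real.exp (-u)) '' Ioi 0 = Ioo 0 1 := by
    ext s
    constructor
    · rintro ⟨u, hu, rfl⟩
      exact ⟨Real.exp_pos _, by rw [Real.exp_lt_one_iff]; simpa using hu⟩
    · intro hs
      refine ⟨-Real.log s, ?_, by simp [Real.exp_log hs.1]⟩
      simpa using Real.log_neg hs.1 hs.2
  rw [← himage, integral_image_eq_integral_abs_deriv_smul (f' := fun u => -Real.exp (-u))
    measurableSet_Ioi (fun u _ => by
      simpa using ((hasDerivAt_neg u).exp).hasDerivWithinAt)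
    (fun a _ b _ h => by simpa using h)]
  have : ∀ u ∈ Ioi (0 : ℝ), |-Real.exp (-u)| • (psi d (Real.exp (-u)) ^ d / Real.exp (-u)) =
      ((d : ℝ) / 2) ^ ((d : ℝ) / 2) *
        (u ^ ((d : ℝ) / 2 + 1 - 1) * Real.exp (-((d : ℝ) / 2 * u))) := by
    intro u hu
    have hu : 0 < u := hu
    rw [abs_neg, abs_of_pos (Real.exp_pos _), smul_eq_mul,
      mul_div_cancel₀ _ (Real.exp_pos _).ne', psi, Real.log_rpow (Real.exp_pos _), Real.log_exp,
      Real.sqrt_eq_rpow, ← Real.rpow_natCast (_ ^ _), ← Real.rpow_mul (by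
        rw [show (-(d : ℝ) / 2 * -u) = d / 2 * u by ring]; positivity),
      show Real.exp (-u) * (-(d : ℝ) / 2 * -u) = (d / 2) * (u * Real.exp (-u)) by ring,
      Real.mul_rpow (by positivity) (by positivity), Real.mul_rpow hu.le (Real.exp_pos _).le,
      ← Real.exp_mul, show 1 / 2 * (d : ℝ) = d / 2 by ring, add_sub_cancel_right,
      show -u * ((d : ℝ) / 2) = -(d / 2 * u) by ring]
  rw [setIntegral_congr_fun measurableSet_Ioi this, integral_const_mul,
    Real.integral_rpow_mul_exp_neg_mul_Ioi (by positivity) (by positivity),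
    Real.rpow_add_one (by positivity), ← mul_assoc, ← mul_assoc,
    ← Real.mul_rpow (by positivity) (by positivity)]
  rw [show (d : ℝ) / 2 * (1 / (d / 2)) = 1 by field_simp]
  simp

lemma toSphere_real_univ {d : ℕ} (hd : 1 ≤ d) :
    (volume : Measure (Space d)).toSphere.real univ =
      d * (Real.pi ^ ((d : ℝ) / 2) / Real.Gamma (d / 2 + 1)) := by
  have : Nonempty (Fin d) := ⟨⟨0, hd⟩⟩
  rw [Measure.toSphere_real_apply_univ, finrank_euclideanSpace, Fintype.card_fin, measureReal_def,
    EuclideanSpace.volume_ball]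
  simp only [ENNReal.ofReal_one, one_pow, one_mul, Fintype.card_fin]
  rw [ENNReal.toReal_ofReal (by positivity), Real.sqrt_eq_rpow, ← Real.rpow_natCast (_ ^ _),
    ← Real.rpow_mul Real.pi_pos.le]
  congr 3; ring

lemma integrable_psi_pow_div {d : ℕ} (hd : 1 ≤ d) :
    Integrable (fun p : ℝ × Metric.sphere (0 : Space d) 1 => psi d p.1 ^ d / p.1)
      (meanMeasure d) := by
  have hd' : (0 : ℝ) < d := by exact_mod_cast hd
  have : IntegrableOn (fun s => psi d s ^ d / s) (Ioo 0 1) := by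
    apply Integrable.of_integral_ne_zero
    rw [integral_psi_pow_div hd]
    positivity
  unfold meanMeasure
  exact Integrable.comp_fst this _

/-- The Gamma factor cancels against the one in the area of the sphere; what is left is the constant
of the mean value formula. -/
lemma integral_meanMeasure_psi_pow_div {d : ℕ} (hd : 1 ≤ d) :
    ∫ p, psi d p.1 ^ d / p.1 ∂(meanMeasure d) = 2 * Real.pi ^ ((d : ℝ) / 2) := by
  have hd' : (0 : ℝ) < d := by exact_mod_cast hd
  have hG : 0 < Real.Gamma (d / 2 + 1) := Real.Gamma_pos_of_pos (by positivity)
  unfold meanMeasure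
  rw [integral_fun_fst (fun s => psi d s ^ d / s), integral_psi_pow_div hd, toSphere_real_univ hd]
  simp only [smul_eq_mul]
  field_simp

lemma Admissible.mapsTo {d : ℕ} {A : Set (ℝ × Space d)} {t : ℝ} {x : Space d} {T : ℝ}
    (h : Admissible A t x T) :
    MapsTo (fun q : ℝ × Space d => (t - q.1, x + q.2)) (heatCylinder d T) A := by
  intro q hq
  apply h.2
  have h1 := hq.1
  have h2 := hq.2
  simp only [mem_Icc] at h1
  refine ⟨⟨by linarith [h1.2], by linarith [h1.1]⟩, ?_⟩
  simpa [dist_eq_norm] using h2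

lemma Admissible.mono {d : ℕ} {A : Set (ℝ × Space d)} {t : ℝ} {x : Space d} {T α : ℝ}
    (h : Admissible A t x T) (hα : 0 < α) (hαT : α ≤ T) : Admissible A t x α := by
  refine ⟨hα, subset_trans (prod_mono ?_ ?_) h.2⟩
  · exact Icc_subset_Icc (by linarith) le_rfl
  · apply Metric.closedBall_subset_closedBall
    gcongr

lemma heatSpherePoint_mem_heatCylinder {d : ℕ} (hd : 1 ≤ d) {α T : ℝ} (hα : 0 ≤ α) (hαT : α ≤ T)
    {p : ℝ × Metric.sphere (0 : Space d) 1} (hp : p.1 ∈ Ioo (0 : ℝ) 1) :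
    heatSpherePoint d (α, p) ∈ heatCylinder d T := by
  rcases hα.eq_or_lt with rfl | hα
  · simp only [heatSpherePoint, heatCylinder]
    refine ⟨by simpa using hαT, by simp⟩
  · exact mem_heatCylinder hd (mul_pos hα hp.1) ((heatLevel_heatSpherePoint hd hα hp).trans_le hαT)

lemma continuousOn_psi (d : ℕ) : ContinuousOn (psi d) (Ioi 0) := by
  unfold psi
  refine (continuousOn_id.mul (ContinuousOn.log ?_ ?_)).sqrt
  · exact continuousOn_id.rpow_const fun s hs => Or.inl (ne_of_gt hs)
  · exact fun s hs => (Real.rpow_pos_of_pos hs _).ne'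

lemma meanIntegrand_eq {d : ℕ} (h : ℝ × Space d → ℝ) (t : ℝ) (x : Space d) (α : ℝ)
    (p : ℝ × Metric.sphere (0 : Space d) 1) :
    meanIntegrand h t x α p = psi d p.1 ^ d / p.1 *
      h (t - (heatSpherePoint d (α, p)).1, x + (heatSpherePoint d (α, p)).2) := by
  simp only [meanIntegrand, heatSpherePoint]
  ring

lemma aestronglyMeasurable_meanIntegrand {d : ℕ} (hd : 1 ≤ d) {A : Set (ℝ × Space d)}
    {h : ℝ × Space d → ℝ} (hh : ContinuousOn h A) {t : ℝ} {x : Space d} {T : ℝ}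
    (hT : Admissible A t x T) {α : ℝ} (hα : α ∈ Icc 0 T) :
    AEStronglyMeasurable (meanIntegrand h t x α) (meanMeasure d) := by
  have hμ : meanMeasure d = ((volume : Measure ℝ).prod
      (volume : Measure (Space d)).toSphere).restrict (Ioo 0 1 ×ˢ univ) := by
    rw [meanMeasure, ← Measure.prod_restrict, Measure.restrict_univ]
  simp only [funext (meanIntegrand_eq h t x α)]
  rw [hμ]
  apply ContinuousOn.aestronglyMeasurable _ (measurableSet_Ioo.prod MeasurableSet.univ)
  have hψ : ContinuousOn (fun p : ℝ × Metric.sphere (0 : Space d) 1 => psi d p.1)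
      (Ioo 0 1 ×ˢ univ) :=
    (continuousOn_psi d).comp continuousOn_fst fun p hp => hp.1.1
  refine ((hψ.pow d).div continuousOn_fst fun p hp => hp.1.1.ne').mul (hh.comp ?_ ?_)
  · simp only [heatSpherePoint]
    have : ContinuousOn (fun p : ℝ × Metric.sphere (0 : Space d) 1 => (p.2 : Space d))
      (Ioo 0 1 ×ˢ univ) := by fun_prop
    refine ContinuousOn.prodMk (by fun_prop) ?_
    exact continuousOn_const.add ((continuousOn_const.mul hψ).smul this)
  · intro p hp
    exact hT.mapsTo (heatSpherePoint_mem_heatCylinder hd hα.1 hα.2 hp.1)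

lemma exists_bound_on_heatCylinder {d : ℕ} {A : Set (ℝ × Space d)}
    {h : ℝ × Space d → ℝ} (hh : ContinuousOn h A) {t : ℝ} {x : Space d} {T : ℝ}
    (hT : Admissible A t x T) :
    ∃ M, 0 ≤ M ∧ ∀ q ∈ heatCylinder d T, |h (t - q.1, x + q.2)| ≤ M := by
  have hc : ContinuousOn (fun q : ℝ × Space d => h (t - q.1, x + q.2)) (heatCylinder d T) :=
    hh.comp (by fun_prop) hT.mapsTo
  obtain ⟨M, hM⟩ := (isCompact_heatCylinder d T).exists_bound_of_continuousOn hc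
  exact ⟨max M 0, le_max_right _ _, fun q hq => (hM q hq).trans (le_max_left _ _)⟩

lemma integrable_meanIntegrand {d : ℕ} (hd : 1 ≤ d) {A : Set (ℝ × Space d)}
    {h : ℝ × Space d → ℝ} (hh : ContinuousOn h A) {t : ℝ} {x : Space d} {T : ℝ}
    (hT : Admissible A t x T) {α : ℝ} (hα : α ∈ Icc 0 T) :
    Integrable (meanIntegrand h t x α) (meanMeasure d) := by
  obtain ⟨M, hM0, hM⟩ := exists_bound_on_heatCylinder hh hT
  refine ((integrable_psi_pow_div hd).mul_const M).mono'
    (aestronglyMeasurable_meanIntegrand hd hh hT hα) ?_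
  filter_upwards [ae_meanMeasure d] with p hp
  have h0 : 0 ≤ psi d p.1 ^ d / p.1 := div_nonneg (pow_nonneg (psi_nonneg d _) _) hp.1.le
  rw [meanIntegrand_eq, norm_mul, Real.norm_of_nonneg h0]
  gcongr
  exact hM _ (heatSpherePoint_mem_heatCylinder hd hα.1 hα.2 hp)

/-- Dominated convergence, h being bounded on the compact cylinder. Continuity up to α = 0 is what
links the mean integrals to the value at the centre. -/
lemma continuousOn_integral_meanIntegrand {d : ℕ} (hd : 1 ≤ d) {A : Set (ℝ × Space d)}
    {h : ℝ × Space d → ℝ} (hh : ContinuousOn h A) {t : ℝ} {x : Space d} {T : ℝ}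
    (hT : Admissible A t x T) :
    ContinuousOn (fun α => ∫ p, meanIntegrand h t x α p ∂(meanMeasure d)) (Icc 0 T) := by
  obtain ⟨M, hM0, hM⟩ := exists_bound_on_heatCylinder hh hT
  refine continuousOn_of_dominated (bound := fun p => psi d p.1 ^ d / p.1 * M)
    (fun α hα => aestronglyMeasurable_meanIntegrand hd hh hT hα) ?_
    ((integrable_psi_pow_div hd).mul_const M) ?_
  · intro α hα
    filter_upwards [ae_meanMeasure d] with p hp
    have h0 : 0 ≤ psi d p.1 ^ d / p.1 := div_nonneg (pow_nonneg (psi_nonneg d _) _) hp.1.le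
    rw [meanIntegrand_eq, norm_mul, Real.norm_of_nonneg h0]
    gcongr
    exact hM _ (heatSpherePoint_mem_heatCylinder hd hα.1 hα.2 hp)
  · filter_upwards [ae_meanMeasure d] with p hp
    simp only [meanIntegrand_eq]
    refine continuousOn_const.mul (hh.comp ?_ ?_)
    · simp only [heatSpherePoint]
      fun_prop
    · intro α hα
      exact hT.mapsTo (heatSpherePoint_mem_heatCylinder hd hα.1 hα.2 hp)

lemma integral_meanIntegrand_zero {d : ℕ} (hd : 1 ≤ d) (h : ℝ × Space d → ℝ) (t : ℝ)
    (x : Space d) :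
    ∫ p, meanIntegrand h t x 0 p ∂(meanMeasure d) = 2 * Real.pi ^ ((d : ℝ) / 2) * h (t, x) := by
  simp only [meanIntegrand_eq, heatSpherePoint]
  simp only [zero_mul, sub_zero, Real.sqrt_zero, mul_zero, zero_smul, add_zero]
  rw [integral_mul_const, integral_meanMeasure_psi_pow_div hd]

end HeatMeanValue

/-! ### Green's identity in space, and derivatives of functions of the level -/

namespace HeatMeanValue
open Set Filter Topology ENNReal

section Laplacian

variable {d : ℕ}

lemma laplacian_eq_sum (u : Space d → ℝ) (z : Space d) :
    Laplacian.laplacian u z = ∑ i, fderiv ℝ (fderiv ℝ u) z (EuclideanSpace.basisFun (Fin d) ℝ i)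
      (EuclideanSpace.basisFun (Fin d) ℝ i) := by
  rw [InnerProductSpace.laplacian_eq_iteratedFDeriv_orthonormalBasis u
    (EuclideanSpace.basisFun (Fin d) ℝ)]
  simp [iteratedFDeriv_two_apply]

lemma integrable_mul_of_continuousAt_tsupport {v w : Space d → ℝ} (hv : Continuous v)
    (hvc : HasCompactSupport v) (hw : ∀ z ∈ tsupport v, ContinuousAt w z) :
    Integrable (fun z => v z * w z) := by
  apply Continuous.integrable_of_hasCompactSupport
  · refine continuous_of_tsupport fun z hz => ?_
    exact hv.continuousAt.mul (hw z (closure_mono (fun y hy => by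
      simp only [Function.mem_support] at hy ⊢
      exact left_ne_zero_of_mul hy) hz))
  · exact hvc.mul_right

lemma fderiv_apply_fderiv {u : Space d → ℝ} {z : Space d} (hu : ContDiffAt ℝ 2 u z)
    (e : Space d) :
    fderiv ℝ (fun y => fderiv ℝ u y e) z e = fderiv ℝ (fderiv ℝ u) z e e := by
  have h1 : DifferentiableAt ℝ (fderiv ℝ u) z :=
    (hu.fderiv_right (m := 1) (by norm_num)).differentiableAt (by norm_num)
  rw [fderiv_clm_apply h1 (differentiableAt_const e)]
  simp

/-- Green's identity for the second derivative in one direction. -/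
lemma integral_mul_fderiv_fderiv {v u : Space d → ℝ} (hv : ContDiff ℝ 2 v)
    (hvc : HasCompactSupport v) (hu : ∀ z ∈ tsupport v, ContDiffAt ℝ 2 u z) (e : Space d) :
    Integrable (fun z => v z * fderiv ℝ (fderiv ℝ u) z e e) ∧
    Integrable (fun z => fderiv ℝ (fun y => fderiv ℝ v y e) z e * u z) ∧
    ∫ z, v z * fderiv ℝ (fderiv ℝ u) z e e =
      ∫ z, fderiv ℝ (fun y => fderiv ℝ v y e) z e * u z := by
  have hv1 : ContDiff ℝ 1 (fun y => fderiv ℝ v y e) :=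
    (hv.fderiv_right (m := 1) (by norm_num)).clm_apply contDiff_const
  have hv2 : Continuous (fun z => fderiv ℝ (fun y => fderiv ℝ v y e) z e) :=
    (hv1.continuous_fderiv (by norm_num)).clm_apply continuous_const
  have ht1 : tsupport (fun y => fderiv ℝ v y e) ⊆ tsupport v := tsupport_fderiv_apply_subset ℝ e
  have hc1 : HasCompactSupport (fun y => fderiv ℝ v y e) := hvc.mono' (subset_tsupport _ |>.trans ht1)
  have ht2 : tsupport (fun z => fderiv ℝ (fun y => fderiv ℝ v y e) z e) ⊆ tsupport v :=
    (tsupport_fderiv_apply_subset ℝ e).trans ht1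
  have hc2 : HasCompactSupport (fun z => fderiv ℝ (fun y => fderiv ℝ v y e) z e) :=
    hvc.mono' (subset_tsupport _ |>.trans ht2)
  have hu1 : ∀ z ∈ tsupport v, ContDiffAt ℝ 1 (fun y => fderiv ℝ u y e) z := fun z hz =>
    ((hu z hz).fderiv_right (m := 1) (by norm_num)).clm_apply contDiffAt_const
  have hu2 : ∀ z ∈ tsupport v, ContinuousAt (fun z => fderiv ℝ (fderiv ℝ u) z e e) z :=
    fun z hz =>
    ((((hu z hz).fderiv_right (m := 1) (by norm_num)).fderiv_right (m := 0) (by norm_num)).clm_apply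
      contDiffAt_const |>.clm_apply contDiffAt_const).continuousAt
  -- The two second derivatives need only agree on the support of v; u may fail to be smooth
  -- elsewhere.
  have hcongr : (fun z => v z * fderiv ℝ (fderiv ℝ u) z e e) =
      fun z => v z * fderiv ℝ (fun y => fderiv ℝ u y e) z e := by
    ext z
    by_cases hz : z ∈ tsupport v
    · rw [fderiv_apply_fderiv (hu z hz)]
    · simp [image_eq_zero_of_notMem_tsupport hz]
  have i1 := integrable_mul_of_continuousAt_tsupport hv.continuous hvc hu2
  have i2 := integrable_mul_of_continuousAt_tsupport hv2 hc2
    fun z hz => (hu z (ht2 hz)).continuousAt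
  have i3 := integrable_mul_of_continuousAt_tsupport hv1.continuous hc1
    fun z hz => (hu1 z (ht1 hz)).continuousAt
  have i4 := integrable_mul_of_continuousAt_tsupport hv.continuous hvc
    fun z hz => (hu1 z hz).continuousAt
  have i5 := integrable_mul_of_continuousAt_tsupport hv1.continuous hc1
    fun z hz => (hu z (ht1 hz)).continuousAt
  refine ⟨i1, i2, ?_⟩
  rw [hcongr] at i1 ⊢
  rw [integral_mul_fderiv_eq_neg_fderiv_mul_of_integrable i3 i1 i4
    (fun z _ => hv.differentiable (by norm_num) z)
    (fun z hz => (hu1 z hz).differentiableAt (by norm_num))]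
  have hcongr2 : (fun z => fderiv ℝ v z e * fderiv ℝ u z e) =
      fun z => (fun y => fderiv ℝ v y e) z * fderiv ℝ u z e := rfl
  have i3' : Integrable (fun z => fderiv ℝ v z e * fderiv ℝ u z e) := i3
  rw [integral_mul_fderiv_eq_neg_fderiv_mul_of_integrable (f := fun y => fderiv ℝ v y e) i2 i3' i5
    (fun z _ => hv1.differentiable (by norm_num) z)
    (fun z hz => (hu z (ht1 hz)).differentiableAt (by norm_num)), neg_neg]

lemma integral_mul_laplacian {v u : Space d → ℝ} (hv : ContDiff ℝ 2 v)
    (hvc : HasCompactSupport v) (hu : ∀ z ∈ tsupport v, ContDiffAt ℝ 2 u z) :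
    ∫ z, v z * Laplacian.laplacian u z =
      ∫ z, (∑ i, fderiv ℝ (fun y => fderiv ℝ v y (EuclideanSpace.basisFun (Fin d) ℝ i)) z
        (EuclideanSpace.basisFun (Fin d) ℝ i)) * u z := by
  simp only [laplacian_eq_sum, Finset.mul_sum, Finset.sum_mul]
  rw [integral_finsetSum _ fun i _ => (integral_mul_fderiv_fderiv hv hvc hu _).1,
    integral_finsetSum _ fun i _ => (integral_mul_fderiv_fderiv hv hvc hu _).2.1]
  exact Finset.sum_congr rfl fun i _ => (integral_mul_fderiv_fderiv hv hvc hu _).2.2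

end Laplacian

section LevelDerivatives

variable {d : ℕ}

lemma hasDerivAt_heatLevel_time (hd : 1 ≤ d) {τ : ℝ} (hτ : τ ≠ 0) (z : Space d) :
    HasDerivAt (fun σ => heatLevel d (σ, z))
      (heatLevel d (τ, z) * (τ⁻¹ - ‖z‖ ^ 2 / (2 * d) * (τ⁻¹) ^ 2)) τ := by
  have hd' : (0 : ℝ) < d := by exact_mod_cast hd
  unfold heatLevel
  have h1 : HasDerivAt (fun σ : ℝ => ‖z‖ ^ 2 / (2 * d * σ))
      (-(‖z‖ ^ 2 / (2 * d) * (τ⁻¹) ^ 2)) τ := by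
    have := (hasDerivAt_inv hτ).const_mul (‖z‖ ^ 2 / (2 * d))
    refine (this.congr_deriv ?_).congr_of_eventuallyEq ?_
    · simp
    · exact Eventually.of_forall fun σ => by simp only [div_eq_mul_inv, mul_inv]; ring
  refine ((hasDerivAt_id τ).mul h1.exp).congr_deriv ?_
  simp only [id]
  field_simp
  ring

lemma hasFDerivAt_heatLevel_space (hd : 1 ≤ d) {τ : ℝ} (hτ : τ ≠ 0) (z : Space d) :
    HasFDerivAt (fun y => heatLevel d (τ, y))
      ((heatLevel d (τ, z) / (d * τ)) • (innerSL ℝ z)) z := by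
  have hd' : (0 : ℝ) < d := by exact_mod_cast hd
  unfold heatLevel
  have h1 : HasFDerivAt (fun y : Space d => ‖y‖ ^ 2 / (2 * d * τ))
      ((2 * d * τ)⁻¹ • (2 • innerSL ℝ z)) z := by
    simp only [div_eq_mul_inv]
    simpa using (hasStrictFDerivAt_norm_sq z).hasFDerivAt.mul_const (2 * d * τ)⁻¹
  refine (h1.exp.const_mul τ).congr_fderiv ?_
  ext y
  simp only [smul_apply, smul_eq_mul, nsmul_eq_mul, Nat.cast_ofNat]
  field_simp

lemma contDiff_heatLevel_space (d : ℕ) (τ : ℝ) :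
    ContDiff ℝ 2 (fun y : Space d => heatLevel d (τ, y)) := by
  unfold heatLevel
  have h : ContDiff ℝ 2 fun y : Space d => ‖y‖ ^ 2 := contDiff_norm_sq ℝ
  exact contDiff_const.mul (h.div_const (2 * d * τ)).exp

lemma fderiv_comp_heatLevel (hd : 1 ≤ d) {τ : ℝ} (hτ : τ ≠ 0) {Ψ g : ℝ → ℝ}
    (hΨ : ∀ a, HasDerivAt Ψ (g a) a) (z e : Space d) :
    fderiv ℝ (fun y => Ψ (heatLevel d (τ, y))) z e =
      g (heatLevel d (τ, z)) * heatLevel d (τ, z) / (d * τ) * inner ℝ z e := by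
  have h : HasFDerivAt (fun y => Ψ (heatLevel d (τ, y))) _ z :=
    (hΨ _).hasFDerivAt.comp z (hasFDerivAt_heatLevel_space hd hτ z)
  rw [h.fderiv]
  simp
  ring

lemma fderiv_fderiv_comp_heatLevel (hd : 1 ≤ d) {τ : ℝ} (hτ : τ ≠ 0) {Ψ g g' : ℝ → ℝ}
    (hΨ : ∀ a, HasDerivAt Ψ (g a) a) (hg : ∀ a, HasDerivAt g (g' a) a) (z e : Space d) :
    fderiv ℝ (fun y => fderiv ℝ (fun y => Ψ (heatLevel d (τ, y))) y e) z e =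
      (g' (heatLevel d (τ, z)) * heatLevel d (τ, z) + g (heatLevel d (τ, z))) *
        heatLevel d (τ, z) / (d * τ) ^ 2 * inner ℝ z e ^ 2 +
      g (heatLevel d (τ, z)) * heatLevel d (τ, z) / (d * τ) * inner ℝ e e := by
  have h0 : (fun y => fderiv ℝ (fun y => Ψ (heatLevel d (τ, y))) y e) =
      fun y => (g (heatLevel d (τ, y)) * heatLevel d (τ, y) * inner ℝ y e) / (d * τ) := by
    ext y; rw [fderiv_comp_heatLevel hd hτ hΨ]; ring
  have hL := hasFDerivAt_heatLevel_space hd hτ z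
  have h1 := (hg _).hasFDerivAt.comp z hL
  have h2 : HasFDerivAt (fun y : Space d => inner ℝ y e) (innerSL ℝ e) z := by
    simp only [real_inner_comm]
    exact (innerSL ℝ e).hasFDerivAt
  have h3 := ((h1.mul hL).mul h2).mul_const (d * τ)⁻¹
  rw [h0]
  simp only [div_eq_mul_inv]
  have h4 : HasFDerivAt (fun y => g (heatLevel d (τ, y)) * heatLevel d (τ, y) * inner ℝ y e *
    (↑d * τ)⁻¹) _ z := h3
  rw [h4.fderiv]
  simp
  ring

/-- Parseval gives ‖z‖² in the first term, and the d unit vectors cancel the d of dτ in the second.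
The term g L/τ is the one that the time derivative of Ψ∘L will cancel. -/
lemma laplacian_comp_heatLevel (hd : 1 ≤ d) {τ : ℝ} (hτ : τ ≠ 0) {Ψ g g' : ℝ → ℝ}
    (hΨ : ∀ a, HasDerivAt Ψ (g a) a) (hg : ∀ a, HasDerivAt g (g' a) a) (z : Space d) :
    (∑ i, fderiv ℝ (fun y => fderiv ℝ (fun y => Ψ (heatLevel d (τ, y))) y
      (EuclideanSpace.basisFun (Fin d) ℝ i)) z (EuclideanSpace.basisFun (Fin d) ℝ i)) =
      (g' (heatLevel d (τ, z)) * heatLevel d (τ, z) + g (heatLevel d (τ, z))) *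
        heatLevel d (τ, z) / (d * τ) ^ 2 * ‖z‖ ^ 2 +
      g (heatLevel d (τ, z)) * heatLevel d (τ, z) / τ := by
  have hd' : (0 : ℝ) < d := by exact_mod_cast hd
  simp only [fderiv_fderiv_comp_heatLevel hd hτ hΨ hg]
  rw [Finset.sum_add_distrib, ← Finset.mul_sum, ← Finset.mul_sum,
    OrthonormalBasis.sum_sq_inner_left]
  simp only [real_inner_self_eq_norm_sq, OrthonormalBasis.norm_eq_one]
  simp
  field_simp

end LevelDerivatives

end HeatMeanValue

/-! ### Green's identity for the heat operator in a heat ball -/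

namespace HeatMeanValue
open Set Filter Topology ENNReal

variable {d : ℕ}

/-- Products of a kernel supported in a heat ball with a function continuous there. -/
lemma integrableOn_levelKernel_mul (hd : 1 ≤ d) {A : Set (ℝ × Space d)} {u : ℝ × Space d → ℝ}
    (hu : ContinuousOn u A) {t : ℝ} {x : Space d} {T : ℝ} (hT : Admissible A t x T)
    {W : ℝ → ℝ} (hW : Continuous W) (hW0 : ∀ a, T < a → W a = 0) {a b : ℕ}
    (hab : (b : ℝ) - a / 2 < d / 2 + 1) :
    IntegrableOn (fun q : ℝ × Space d =>
      W (heatLevel d q) * (q.1⁻¹) ^ b * ‖q.2‖ ^ a * u (t - q.1, x + q.2))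
      (Ioi (0 : ℝ) ×ˢ univ) := by
  obtain ⟨M, hM0, hM⟩ := exists_bound_on_heatCylinder hu hT
  obtain ⟨N, hN⟩ := (isCompact_Icc (a := 0) (b := T)).exists_bound_of_continuousOn hW.continuousOn
  have hS : MeasurableSet (Ioi (0 : ℝ) ×ˢ (univ : Set (Space d))) :=
    measurableSet_Ioi.prod MeasurableSet.univ
  have hcyl := (isCompact_heatCylinder d T).measurableSet
  -- Nothing is known of u off A, so u is cut off to the cylinder, which contains the part of the
  -- support of the kernel at positive times.
  set U : ℝ × Space d → ℝ := (heatCylinder d T).indicator fun q => u (t - q.1, x + q.2) with hU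
  have hUm : AEStronglyMeasurable U := by
    rw [hU, aestronglyMeasurable_indicator_iff hcyl]
    exact (hu.comp (by fun_prop) hT.mapsTo).aestronglyMeasurable hcyl
  have hUM : ∀ q, |U q| ≤ M := by
    intro q
    by_cases hq : q ∈ heatCylinder d T
    · rw [hU, indicator_of_mem hq]; exact hM q hq
    · rw [hU, indicator_of_notMem hq]; simpa using hM0
  have hL := measurable_heatLevel d
  rw [← integrable_indicator_iff hS]
  have hWL : ∀ q : ℝ × Space d, W (heatLevel d q) ≠ 0 → heatLevel d q ≤ T := fun q hq => by
    by_contra hcon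
    exact hq (hW0 _ (not_le.1 hcon))
  have heq : (Ioi (0 : ℝ) ×ˢ (univ : Set (Space d))).indicator (fun q : ℝ × Space d =>
      W (heatLevel d q) * (q.1⁻¹) ^ b * ‖q.2‖ ^ a * u (t - q.1, x + q.2)) =
      (Ioi (0 : ℝ) ×ˢ (univ : Set (Space d))).indicator (fun q : ℝ × Space d =>
      W (heatLevel d q) * (q.1⁻¹) ^ b * ‖q.2‖ ^ a * U q) := by
    refine indicator_congr fun q hq => ?_
    by_cases hq0 : W (heatLevel d q) = 0
    · simp [hq0]
    · rw [hU, indicator_of_mem (mem_heatCylinder hd hq.1 (hWL q hq0))]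
  rw [heq]
  have hWm : Measurable fun q : ℝ × Space d => W (heatLevel d q) * (q.1⁻¹) ^ b * ‖q.2‖ ^ a :=
    ((hW.measurable.comp hL).mul (by fun_prop)).mul (by fun_prop)
  refine integrable_of_heatLevel_le hd (T := T) (a := a) (b := b) (C := N * M)
    ((hWm.aestronglyMeasurable.mul hUm).indicator hS) ?_ ?_ hab
  · intro q hq
    rw [indicator_apply_ne_zero] at hq
    exact ⟨hq.1.1, hWL q fun h0 => hq.2 (by simp [h0])⟩
  · intro q hq hqT
    rw [indicator_of_mem (show q ∈ Ioi (0 : ℝ) ×ˢ (univ : Set (Space d)) from ⟨hq, mem_univ _⟩)]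
    have h1 := hN (heatLevel d q) ⟨(heatLevel_pos hq).le, hqT⟩
    have hN0 : 0 ≤ N := (norm_nonneg _).trans h1
    rw [norm_mul, norm_mul, norm_mul, norm_pow, norm_pow, norm_norm, Real.norm_of_nonneg
      (inv_nonneg.2 hq.le)]
    calc ‖W (heatLevel d q)‖ * q.1⁻¹ ^ b * ‖q.2‖ ^ a * ‖U q‖
        ≤ N * q.1⁻¹ ^ b * ‖q.2‖ ^ a * M := by gcongr; exact hUM q
      _ = _ := by ring

/-- The primitive `Ψ` of `g` vanishing at `T`. -/
noncomputable def levelPotential (g : ℝ → ℝ) (T a : ℝ) : ℝ := ∫ s in T..a, g s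

/-- The weight `w` such that `(∂_τ - Δ) (Ψ ∘ heatLevel) = -(‖z‖² / τ²) w ∘ heatLevel`, where
`Ψ' = g`. -/
noncomputable def levelWeight (d : ℕ) (g : ℝ → ℝ) (a : ℝ) : ℝ :=
  1 / (d : ℝ) ^ 2 * (((d : ℝ) / 2 + 1) * (a * g a) + a ^ 2 * deriv g a)

lemma hasDerivAt_levelPotential {g : ℝ → ℝ} (hg : Continuous g) (T a : ℝ) :
    HasDerivAt (levelPotential g T) (g a) a :=
  intervalIntegral.integral_hasDerivAt_right (hg.intervalIntegrable _ _)
    (hg.stronglyMeasurableAtFilter _ _) hg.continuousAt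

lemma levelPotential_eq_zero {g : ℝ → ℝ} {T a : ℝ} (hg : ∀ a, T ≤ a → g a = 0) (ha : T ≤ a) :
    levelPotential g T a = 0 := by
  rw [levelPotential, intervalIntegral.integral_congr (g := fun _ => 0)]
  · simp
  · intro s hs
    rw [uIcc_of_le ha] at hs
    exact hg s hs.1

lemma deriv_eq_zero_of_lt {g : ℝ → ℝ} {T a : ℝ} (hg : ∀ a, T ≤ a → g a = 0) (ha : T < a) :
    deriv g a = 0 := by
  have : g =ᶠ[𝓝 a] fun _ => 0 := by
    filter_upwards [lt_mem_nhds ha] with s hs using hg s hs.le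
  rw [this.deriv_eq]; simp

lemma continuous_levelWeight {g : ℝ → ℝ} (hg : ContDiff ℝ 1 g) : Continuous (levelWeight d g) := by
  have h1 := hg.continuous
  have h2 := hg.continuous_deriv (by norm_num)
  unfold levelWeight
  fun_prop

lemma levelWeight_eq_zero {g : ℝ → ℝ} {T a : ℝ} (hg : ∀ a, T ≤ a → g a = 0) (ha : T < a) :
    levelWeight d g a = 0 := by
  simp [levelWeight, hg a ha.le, deriv_eq_zero_of_lt hg ha]

/-- The quadratic term of the exponential gives L ≥ ‖z‖⁴/(8d²τ). Hence Ψ∘L vanishes for small τ on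
each vertical line with z ≠ 0, and no boundary term arises at τ = 0. -/
lemma eventually_lt_heatLevel (hd : 1 ≤ d) {z : Space d} (hz : z ≠ 0) (T : ℝ) :
    ∀ᶠ τ in 𝓝[>] (0 : ℝ), T < heatLevel d (τ, z) := by
  have hd' : (0 : ℝ) < d := by exact_mod_cast hd
  have hz' : 0 < ‖z‖ := norm_pos_iff.2 hz
  have : ∀ᶠ τ in 𝓝[>] (0 : ℝ), τ < ‖z‖ ^ 4 / (8 * d ^ 2 * (|T| + 1)) :=
    eventually_nhdsWithin_of_eventually_nhds (gt_mem_nhds (by positivity))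
  filter_upwards [this, self_mem_nhdsWithin] with τ h1 h2
  have hτ : 0 < τ := h2
  have h3 : (‖z‖ ^ 2 / (2 * d * τ)) ^ 2 / 2 ≤ Real.exp (‖z‖ ^ 2 / (2 * d * τ)) := by
    have := Real.pow_div_factorial_le_exp (‖z‖ ^ 2 / (2 * d * τ)) (by positivity) 2
    simpa using this
  have h4 : |T| + 1 < τ * ((‖z‖ ^ 2 / (2 * d * τ)) ^ 2 / 2) := by
    rw [lt_div_iff₀ (by positivity)] at h1
    rw [show τ * ((‖z‖ ^ 2 / (2 * d * τ)) ^ 2 / 2) = ‖z‖ ^ 4 / (8 * d ^ 2 * τ) by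
      field_simp; ring, lt_div_iff₀ (by positivity)]
    linarith
  calc T ≤ |T| := le_abs_self T
    _ < |T| + 1 := by linarith
    _ < _ := h4
    _ ≤ _ := by unfold heatLevel; gcongr

lemma tendsto_heatLevel_atTop (z : Space d) (T : ℝ) :
    ∀ᶠ τ in atTop, T < heatLevel d (τ, z) := by
  filter_upwards [eventually_gt_atTop (max T 0)] with τ hτ
  exact ((le_max_left _ _).trans_lt hτ).trans_le
    (le_heatLevel (q := (τ, z)) ((le_max_right _ _).trans hτ.le))

lemma continuousAt_heatLevel_time (hd : 1 ≤ d) {τ : ℝ} (hτ : τ ≠ 0) (z : Space d) :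
    ContinuousAt (fun σ => heatLevel d (σ, z)) τ :=
  (hasDerivAt_heatLevel_time hd hτ z).continuousAt

variable {A : Set (ℝ × Space d)} {h : ℝ × Space d → ℝ} {t : ℝ} {x : Space d} {T : ℝ} {g : ℝ → ℝ}

/-- Integration by parts in the time variable along a vertical line. -/
lemma integral_time_eq_zero (hd : 1 ≤ d) (hh : IsC12On h A) (hT : Admissible A t x T)
    (hg : Continuous g) (hgT : ∀ a, T ≤ a → g a = 0) {z : Space d} (hz : z ≠ 0)
    (hint : IntegrableOn (fun τ => g (heatLevel d (τ, z)) *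
        (heatLevel d (τ, z) * (τ⁻¹ - ‖z‖ ^ 2 / (2 * d) * (τ⁻¹) ^ 2)) * h (t - τ, x + z) -
        levelPotential g T (heatLevel d (τ, z)) * timeDeriv h (t - τ, x + z)) (Ioi 0)) :
    ∫ τ in Ioi (0 : ℝ), (g (heatLevel d (τ, z)) *
        (heatLevel d (τ, z) * (τ⁻¹ - ‖z‖ ^ 2 / (2 * d) * (τ⁻¹) ^ 2)) * h (t - τ, x + z) -
        levelPotential g T (heatLevel d (τ, z)) * timeDeriv h (t - τ, x + z)) = 0 := by
  -- The value 0 for τ ≤ 0 is imposed because at τ = 0 the level is 0 by the convention for division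
  -- by zero, which is not its limit.
  set f : ℝ → ℝ := fun τ => if 0 < τ then
    levelPotential g T (heatLevel d (τ, z)) * h (t - τ, x + z) else 0 with hf
  have hΨ0 : ∀ τ, T < heatLevel d (τ, z) → f τ = 0 := by
    intro τ hτ
    simp only [hf]
    rw [levelPotential_eq_zero hgT hτ.le]
    simp
  have hcont : ContinuousWithinAt f (Ici 0) 0 := by
    have h0 : f 0 = 0 := by simp [hf]
    rw [← continuousWithinAt_Ioi_iff_Ici, ContinuousWithinAt, h0]
    refine tendsto_const_nhds.congr' ?_
    filter_upwards [eventually_lt_heatLevel hd hz T] with τ hτ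
    exact (hΨ0 τ hτ).symm
  have hlim : Tendsto f atTop (𝓝 0) := by
    refine tendsto_const_nhds.congr' ?_
    filter_upwards [tendsto_heatLevel_atTop z T] with τ hτ
    exact (hΨ0 τ hτ).symm
  have hderiv : ∀ τ ∈ Ioi (0 : ℝ), HasDerivAt f (g (heatLevel d (τ, z)) *
        (heatLevel d (τ, z) * (τ⁻¹ - ‖z‖ ^ 2 / (2 * d) * (τ⁻¹) ^ 2)) * h (t - τ, x + z) -
        levelPotential g T (heatLevel d (τ, z)) * timeDeriv h (t - τ, x + z)) τ := by
    intro τ hτ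
    have hτ : 0 < τ := hτ
    rcases le_or_gt (heatLevel d (τ, z)) T with hle | hlt
    · have hmem := hT.mapsTo (mem_heatCylinder hd (q := (τ, z)) hτ hle)
      have h1 := (hasDerivAt_levelPotential hg T (heatLevel d (τ, z))).comp τ
        (hasDerivAt_heatLevel_time hd hτ.ne' z)
      have h2 : HasDerivAt (fun τ => h (t - τ, x + z)) (-timeDeriv h (t - τ, x + z)) τ :=
        ((hh.differentiableAt_time _ hmem).hasDerivAt).comp_const_sub t τ
      refine ((h1.mul h2).congr_deriv ?_).congr_of_eventuallyEq ?_
      · simp only [Function.comp]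
        ring
      · filter_upwards [lt_mem_nhds hτ] with σ hσ
        simp [hf, hσ]
    · have hev : f =ᶠ[𝓝 τ] fun _ => 0 := by
        filter_upwards [(continuousAt_heatLevel_time hd hτ.ne' z).eventually (lt_mem_nhds hlt)]
          with σ hσ using hΨ0 σ hσ
      rw [hgT _ hlt.le, levelPotential_eq_zero hgT hlt.le]
      simpa using (hasDerivAt_const τ (0 : ℝ)).congr_of_eventuallyEq hev
  rw [integral_Ioi_of_hasDerivAt_of_tendsto hcont hderiv hint hlim]
  simp [hf]

/-- Green's identity in the space variable on a time slice. -/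
lemma integral_space_eq (hd : 1 ≤ d) (hh : IsC12On h A) (hT : Admissible A t x T)
    (hg : ContDiff ℝ 1 g) (hgT : ∀ a, T ≤ a → g a = 0) {τ : ℝ} (hτ : 0 < τ) :
    ∫ z, levelPotential g T (heatLevel d (τ, z)) * spaceLaplacian h (t - τ, x + z) =
      ∫ z, ((deriv g (heatLevel d (τ, z)) * heatLevel d (τ, z) + g (heatLevel d (τ, z))) *
        heatLevel d (τ, z) / (d * τ) ^ 2 * ‖z‖ ^ 2 +
        g (heatLevel d (τ, z)) * heatLevel d (τ, z) / τ) * h (t - τ, x + z) := by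
  have hΨ := hasDerivAt_levelPotential hg.continuous T
  have hg' : ∀ a, HasDerivAt g (deriv g a) a := fun a =>
    (hg.differentiable (by norm_num) a).hasDerivAt
  have hLc := (contDiff_heatLevel_space d τ).continuous
  have hΨ2 : ContDiff ℝ 2 (levelPotential g T) := by
    rw [show (2 : WithTop ℕ∞) = 1 + 1 by norm_num, contDiff_succ_iff_deriv]
    refine ⟨fun a => (hΨ a).differentiableAt, by simp, ?_⟩
    rwa [show deriv (levelPotential g T) = g from funext fun a => (hΨ a).deriv]
  have hv : ContDiff ℝ 2 fun z => levelPotential g T (heatLevel d (τ, z)) :=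
    hΨ2.comp (contDiff_heatLevel_space d τ)
  have hsub : tsupport (fun z => levelPotential g T (heatLevel d (τ, z))) ⊆
      {z | heatLevel d (τ, z) ≤ T} := by
    refine closure_minimal (fun z hz => ?_) (isClosed_le hLc continuous_const)
    by_contra hcon
    exact hz (levelPotential_eq_zero hgT (not_le.1 hcon).le)
  have hcyl : ∀ z ∈ tsupport (fun z => levelPotential g T (heatLevel d (τ, z))),
      (τ, z) ∈ heatCylinder d T := fun z hz =>
    mem_heatCylinder hd (q := (τ, z)) hτ (hsub hz)
  have hvc : HasCompactSupport fun z => levelPotential g T (heatLevel d (τ, z)) :=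
    HasCompactSupport.of_support_subset_isCompact (isCompact_closedBall _ _)
      ((subset_tsupport _).trans fun z hz => (hcyl z hz).2)
  have hu : ∀ z ∈ tsupport (fun z => levelPotential g T (heatLevel d (τ, z))),
      ContDiffAt ℝ 2 (fun z => h (t - τ, x + z)) z := by
    intro z hz
    have h1 := hh.contDiffAt_space _ (hT.mapsTo (hcyl z hz))
    exact ContDiffAt.comp z (g := fun y => h (t - τ, y)) (f := fun z => x + z) h1
      (contDiffAt_const.add contDiffAt_id)
  have hΔ : ∀ z, Laplacian.laplacian (fun z => h (t - τ, x + z)) z =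
      spaceLaplacian h (t - τ, x + z) := by
    intro z
    rw [spaceLaplacian, laplacian_eq_sum, laplacian_eq_sum]
    -- Translation commutes with `fderiv` without any differentiability, so the identity holds at
    -- every z, including points where h is not regular.
    have h1 : fderiv ℝ (fun z => h (t - τ, x + z)) =
        fun z => fderiv ℝ (fun y => h (t - τ, y)) (x + z) :=
      funext fun z => fderiv_comp_add_left (f := fun y => h (t - τ, y)) x
    rw [h1, fderiv_comp_add_left (f := fderiv ℝ (fun y => h (t - τ, y))) x]
  simp only [← hΔ]
  rw [integral_mul_laplacian hv hvc hu]
  simp only [laplacian_comp_heatLevel hd hτ.ne' hΨ hg']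

lemma continuousOn_spaceLaplacian (hh : IsC12On h A) : ContinuousOn (spaceLaplacian h) A := by
  have : spaceLaplacian h = fun p => ∑ i, fderiv ℝ (fderiv ℝ (fun x => h (p.1, x))) p.2
      (EuclideanSpace.basisFun (Fin d) ℝ i) (EuclideanSpace.basisFun (Fin d) ℝ i) := by
    ext p; exact laplacian_eq_sum _ _
  rw [this]
  exact continuousOn_finsetSum _ fun i _ =>
    (hh.continuousOn_fderiv_fderiv_space.clm_apply continuousOn_const).clm_apply continuousOn_const

lemma restrict_Ioi_prod_univ : (volume : Measure (ℝ × Space d)).restrict (Ioi (0 : ℝ) ×ˢ univ) =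
    ((volume : Measure ℝ).restrict (Ioi 0)).prod volume := by
  rw [Measure.volume_eq_prod, ← Measure.prod_restrict, Measure.restrict_univ]

lemma integrableOn_levelWeight (hd : 1 ≤ d) {u : ℝ × Space d → ℝ}
    (hu : ContinuousOn u A) (hT : Admissible A t x T)
    {W : ℝ → ℝ} (hW : Continuous W) (hW0 : ∀ a, T < a → W a = 0) :
    IntegrableOn (fun q : ℝ × Space d =>
      ‖q.2‖ ^ 2 / q.1 ^ 2 * (W (heatLevel d q) * u (t - q.1, x + q.2)))
      (Ioi (0 : ℝ) ×ˢ univ) := by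
  have hd' : (0 : ℝ) < d := by exact_mod_cast hd
  refine (integrableOn_levelKernel_mul hd hu hT hW hW0 (a := 2) (b := 2)
    (by push_cast; linarith)).congr_fun (fun q hq => ?_) (measurableSet_Ioi.prod MeasurableSet.univ)
  simp only [inv_pow]
  ring

/-- Green's identity for the heat operator in a heat ball. -/
theorem integral_heatBall (hd : 1 ≤ d) (hh : IsC12On h A) (hT : Admissible A t x T)
    (hg : ContDiff ℝ 1 g) (hgT : ∀ a, T ≤ a → g a = 0) :
    ∫ q in Ioi (0 : ℝ) ×ˢ univ, ‖q.2‖ ^ 2 / q.1 ^ 2 *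
      (levelWeight d g (heatLevel d q) * h (t - q.1, x + q.2)) =
    -∫ q in Ioi (0 : ℝ) ×ˢ univ, levelPotential g T (heatLevel d q) *
      (timeDeriv h (t - q.1, x + q.2) - spaceLaplacian h (t - q.1, x + q.2)) := by
  have hd' : (0 : ℝ) < d := by exact_mod_cast hd
  set S : Set (ℝ × Space d) := Ioi (0 : ℝ) ×ˢ univ with hS
  have hSm : MeasurableSet S := measurableSet_Ioi.prod MeasurableSet.univ
  have hgc := hg.continuous
  have hg'c := hg.continuous_deriv (by norm_num)
  have hΨc : Continuous (levelPotential g T) :=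
    continuous_iff_continuousAt.2 fun a => (hasDerivAt_levelPotential hgc T a).continuousAt
  set f1 : ℝ × Space d → ℝ := fun q => g (heatLevel d q) *
    (heatLevel d q * (q.1⁻¹ - ‖q.2‖ ^ 2 / (2 * d) * (q.1⁻¹) ^ 2)) * h (t - q.1, x + q.2) with hf1
  set f2 : ℝ × Space d → ℝ := fun q =>
    levelPotential g T (heatLevel d q) * timeDeriv h (t - q.1, x + q.2) with hf2
  set f3 : ℝ × Space d → ℝ := fun q =>
    levelPotential g T (heatLevel d q) * spaceLaplacian h (t - q.1, x + q.2) with hf3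
  set f4 : ℝ × Space d → ℝ := fun q =>
    ((deriv g (heatLevel d q) * heatLevel d q + g (heatLevel d q)) *
        heatLevel d q / (d * q.1) ^ 2 * ‖q.2‖ ^ 2 +
        g (heatLevel d q) * heatLevel d q / q.1) * h (t - q.1, x + q.2) with hf4
  have hga : Continuous fun a => g a * a := by fun_prop
  have hga0 : ∀ a, T < a → g a * a = 0 := fun a ha => by rw [hgT a ha.le, zero_mul]
  have i0 : IntegrableOn (fun q : ℝ × Space d =>
      g (heatLevel d q) * heatLevel d q * (q.1⁻¹) ^ 1 * ‖q.2‖ ^ 0 * h (t - q.1, x + q.2)) S :=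
    integrableOn_levelKernel_mul hd hh.continuousOn hT hga hga0 (by push_cast; linarith)
  have i1 : IntegrableOn f1 S := by
    have h2 : IntegrableOn (fun q : ℝ × Space d =>
        g (heatLevel d q) * heatLevel d q * (q.1⁻¹) ^ 2 * ‖q.2‖ ^ 2 * h (t - q.1, x + q.2)) S :=
      integrableOn_levelKernel_mul hd hh.continuousOn hT hga hga0 (by push_cast; linarith)
    refine (i0.sub (h2.mul_const (2 * d : ℝ)⁻¹)).congr_fun (fun q hq => ?_) hSm
    simp only [hf1, Pi.sub_apply]
    ring
  have hΨ0 : ∀ a, T < a → levelPotential g T a = 0 := fun a ha =>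
    levelPotential_eq_zero hgT ha.le
  have i2 : IntegrableOn f2 S := by
    refine (integrableOn_levelKernel_mul hd hh.continuousOn_timeDeriv hT hΨc hΨ0 (a := 0) (b := 0)
      (by push_cast; linarith)).congr_fun (fun q hq => ?_) hSm
    simp [hf2]
  have i3 : IntegrableOn f3 S := by
    refine (integrableOn_levelKernel_mul hd (continuousOn_spaceLaplacian hh) hT hΨc hΨ0
      (a := 0) (b := 0) (by push_cast; linarith)).congr_fun (fun q hq => ?_) hSm
    simp [hf3]
  have i4 : IntegrableOn f4 S := by
    have h2 : IntegrableOn (fun q : ℝ × Space d =>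
        (deriv g (heatLevel d q) * heatLevel d q + g (heatLevel d q)) * heatLevel d q *
          (q.1⁻¹) ^ 2 * ‖q.2‖ ^ 2 * h (t - q.1, x + q.2)) S :=
      integrableOn_levelKernel_mul (W := fun a => (deriv g a * a + g a) * a) hd hh.continuousOn hT
        (by fun_prop) (fun a ha => by rw [hgT a ha.le, deriv_eq_zero_of_lt hgT ha]; simp)
        (by push_cast; linarith)
    refine IntegrableOn.congr_fun (Integrable.add (h2.mul_const ((d : ℝ) ^ 2)⁻¹) i0) (fun q hq => ?_) hSm
    simp only [hf4, Pi.add_apply, div_eq_mul_inv, mul_inv, mul_pow]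
    ring
  have e12 : ∫ q in S, (f1 q - f2 q) = 0 := by
    have hi : IntegrableOn (fun q => f1 q - f2 q) S := i1.sub i2
    rw [hS, IntegrableOn, restrict_Ioi_prod_univ] at hi
    rw [hS, restrict_Ioi_prod_univ, integral_prod_symm _ hi]
    rw [integral_eq_zero_of_ae]
    -- On the line z = 0 the level tends to 0 with τ and the boundary term may survive; that line is
    -- negligible.
    have hne : ∀ᵐ z : Space d, z ≠ 0 := by
      have : Nonempty (Fin d) := ⟨⟨0, hd⟩⟩
      exact Measure.ae_ne volume 0
    filter_upwards [hi.prod_left_ae, hne] with z hz hz0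
    exact integral_time_eq_zero hd hh hT hgc hgT hz0 hz
  have e34 : ∫ q in S, f3 q = ∫ q in S, f4 q := by
    rw [IntegrableOn, hS, restrict_Ioi_prod_univ] at i3 i4
    rw [hS, restrict_Ioi_prod_univ, integral_prod _ i3, integral_prod _ i4]
    exact setIntegral_congr_fun measurableSet_Ioi fun τ hτ =>
      integral_space_eq hd hh hT hg hgT hτ
  -- The terms g(L) L/τ of the Laplacian and of the time derivative cancel. Every remaining term
  -- carries ‖z‖²/τ² and a function of L alone, which is the definition of `levelWeight`.
  have e14 : ∀ q ∈ S, ‖q.2‖ ^ 2 / q.1 ^ 2 *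
      (levelWeight d g (heatLevel d q) * h (t - q.1, x + q.2)) = f4 q - f1 q := by
    intro q hq
    have hq0 : 0 < q.1 := hq.1
    simp only [hf1, hf4, levelWeight]
    field_simp
    ring
  rw [setIntegral_congr_fun hSm e14, integral_sub i4 i1]
  have e23 : ∀ q ∈ S, levelPotential g T (heatLevel d q) *
      (timeDeriv h (t - q.1, x + q.2) - spaceLaplacian h (t - q.1, x + q.2)) = f2 q - f3 q := by
    intro q hq
    simp only [hf2, hf3]
    ring
  rw [setIntegral_congr_fun hSm e23, integral_sub i2 i3]
  rw [integral_sub i1 i2] at e12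
  linarith

end HeatMeanValue

/-! ### The lemma of du Bois-Reymond and the mean value property for C^{1,2} functions -/

namespace HeatMeanValue
open Set Filter Topology ENNReal
open scoped ContDiff

/-- The primitive starting at 0 vanishes before the support of η, and the zero total integral makes
it vanish after the support too. -/
lemma exists_primitive_of_integral_eq_zero {T : ℝ} (hT : 0 < T) {η : ℝ → ℝ} (hη : Continuous η)
    (hηc : HasCompactSupport η) (hηs : tsupport η ⊆ Ioo 0 T) (hη0 : ∫ a, η a = 0) :
    ∃ q : ℝ → ℝ, (∀ a, HasDerivAt q (η a) a) ∧ ∃ a₀ ∈ Ioo 0 T, ∃ b₀ ∈ Ioo 0 T,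
      ∀ a, a ∉ Icc a₀ b₀ → q a = 0 := by
  obtain ⟨a₀, ha₀, b₀, hb₀, hsub⟩ : ∃ a₀ ∈ Ioo 0 T, ∃ b₀ ∈ Ioo 0 T, tsupport η ⊆ Icc a₀ b₀ := by
    rcases (tsupport η).eq_empty_or_nonempty with he | hne
    · exact ⟨T / 2, ⟨by linarith, by linarith⟩, T / 2, ⟨by linarith, by linarith⟩, by simp [he]⟩
    · have hK : IsCompact (tsupport η) := hηc
      refine ⟨sInf (tsupport η), hηs (hK.sInf_mem hne), sSup (tsupport η),
        hηs (hK.sSup_mem hne), fun s hs => ⟨csInf_le hK.bddBelow hs, le_csSup hK.bddAbove hs⟩⟩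
  have hz : ∀ s, s ∉ Icc a₀ b₀ → η s = 0 := fun s hs =>
    image_eq_zero_of_notMem_tsupport fun h => hs (hsub h)
  have hint : Integrable η := hη.integrable_of_hasCompactSupport hηc
  refine ⟨fun a => ∫ s in (0 : ℝ)..a, η s, fun a =>
    intervalIntegral.integral_hasDerivAt_right (hη.intervalIntegrable _ _)
      (hη.stronglyMeasurableAtFilter _ _) hη.continuousAt, a₀, ha₀, b₀, hb₀, fun a ha => ?_⟩
  have h0 : ∀ a < a₀, ∫ s in (0 : ℝ)..a, η s = 0 := by
    intro a ha
    rw [intervalIntegral.integral_congr (g := fun _ => 0)]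
    · simp
    · intro s hs
      refine hz s fun h => ?_
      have h1 := hs.2
      rcases le_total 0 a with h2 | h2
      · rw [sup_of_le_right h2] at h1; linarith [h.1]
      · rw [sup_of_le_left h2] at h1; linarith [h.1, ha₀.1]
  rcases lt_or_ge a a₀ with h | h
  · exact h0 a h
  have hb : b₀ < a := by
    by_contra hcon
    exact ha ⟨h, not_lt.1 hcon⟩
  have h1 : ∫ s in Iic (0 : ℝ), η s = 0 := by
    rw [setIntegral_congr_fun (g := fun _ => 0) measurableSet_Iic]
    · simp
    · intro s hs
      exact hz s fun h => by linarith [h.1, ha₀.1, show s ≤ 0 from hs]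
  have h2 : ∫ s in Ioi a, η s = 0 := by
    rw [setIntegral_congr_fun (g := fun _ => 0) measurableSet_Ioi]
    · simp
    · intro s hs
      exact hz s fun h => by linarith [h.2, show a < s from hs]
  have h3 := intervalIntegral.integral_Iic_sub_Iic (a := 0) (b := a) (f := η) (μ := volume)
    hint.integrableOn hint.integrableOn
  have h4 := intervalIntegral.integral_Iic_add_Ioi (b := a) (f := η) (μ := volume)
    hint.integrableOn hint.integrableOn
  simp only
  linarith

/-- The lemma of du Bois-Reymond. -/
lemma eq_of_integral_deriv_mul_eq_zero {T : ℝ} (hT : 0 < T) {Φ : ℝ → ℝ}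
    (hΦ : ContinuousOn Φ (Icc 0 T))
    (h : ∀ q η : ℝ → ℝ, Continuous η → (∀ a, HasDerivAt q (η a) a) →
      (∃ a₀ ∈ Ioo 0 T, ∃ b₀ ∈ Ioo 0 T, ∀ a, a ∉ Icc a₀ b₀ → q a = 0) →
      ∫ a in Ioi (0 : ℝ), η a * Φ a = 0) : Φ T = Φ 0 := by
  set b : ContDiffBump (T / 2) := ⟨T / 8, T / 4, by linarith, by linarith⟩ with hb
  set φ : ℝ → ℝ := b.normed volume with hφ
  have hφc : Continuous φ := b.continuous_normed
  have hφs : tsupport φ ⊆ Ioo 0 T := by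
    rw [hφ, b.tsupport_normed_eq, hb]
    intro s hs
    rw [Metric.mem_closedBall, Real.dist_eq, abs_le] at hs
    constructor <;> linarith [hs.1, hs.2]
  have hφcs : HasCompactSupport φ := b.hasCompactSupport_normed
  have hφ1 : ∫ a, φ a = 1 := b.integral_normed
  have hmulint : ∀ η : ℝ → ℝ, Continuous η → HasCompactSupport η → tsupport η ⊆ Ioo 0 T →
      Integrable fun a => η a * Φ a := by
    intro η hη hηc hηs
    apply Continuous.integrable_of_hasCompactSupport
    · refine continuous_of_tsupport fun a ha => ?_
      have ha' := hηs (tsupport_mul_subset_left ha)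
      exact hη.continuousAt.mul (hΦ.continuousAt (Icc_mem_nhds ha'.1 ha'.2))
    · exact hηc.mul_right
  have hset : ∀ η : ℝ → ℝ, tsupport η ⊆ Ioo 0 T →
      ∫ a in Ioi (0 : ℝ), η a * Φ a = ∫ a, η a * Φ a := by
    intro η hηs
    apply setIntegral_eq_integral_of_forall_compl_eq_zero
    intro a ha
    rw [image_eq_zero_of_notMem_tsupport fun h => ha (hηs h).1, zero_mul]
  set c := ∫ a, φ a * Φ a with hc
  -- Subtracting (∫η)φ, where φ has integral 1, leaves a function of mean zero, to which the
  -- hypothesis applies through its primitive. So Φ acts on test functions as the constant c.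
  have key : ∀ η : ℝ → ℝ, Continuous η → HasCompactSupport η → tsupport η ⊆ Ioo 0 T →
      ∫ a, η a * Φ a = (∫ a, η a) * c := by
    intro η hη hηc hηs
    set I := ∫ a, η a with hI
    have hts : tsupport (fun a => η a - I * φ a) ⊆ Ioo 0 T := by
      refine (tsupport_sub η (fun a => I * φ a)).trans (union_subset hηs ?_)
      exact (tsupport_mul_subset_right (f := fun _ => I) (g := φ)).trans hφs
    have hcs : HasCompactSupport (fun a => η a - I * φ a) :=
      hηc.sub (hφcs.mul_left (f := fun _ => I))
    have hcont : Continuous (fun a => η a - I * φ a) := by fun_prop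
    have h0 : ∫ a, (η a - I * φ a) = 0 := by
      rw [integral_sub (hη.integrable_of_hasCompactSupport hηc)
        ((hφc.integrable_of_hasCompactSupport hφcs).const_mul _), integral_const_mul, hφ1]
      simp [hI]
    obtain ⟨q, hq, hq0⟩ := exists_primitive_of_integral_eq_zero hT hcont hcs hts h0
    have h1 := h q _ hcont hq hq0
    rw [hset _ hts] at h1
    have h2 : ∫ a, (η a - I * φ a) * Φ a = (∫ a, η a * Φ a) - I * c := by
      rw [hc, ← integral_const_mul, ← integral_sub (hmulint η hη hηc hηs)
        ((hmulint φ hφc hφcs hφs).const_mul _)]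
      congr 1; ext a; ring
    linarith
  have hae : ∀ᵐ a, a ∈ Ioo 0 T → Φ a - c = 0 := by
    have hΦ' : ContinuousOn (fun a => Φ a - c) (Ioo 0 T) :=
      (hΦ.mono Ioo_subset_Icc_self).sub continuousOn_const
    refine isOpen_Ioo.ae_eq_zero_of_integral_contDiff_smul_eq_zero
      (hΦ'.locallyIntegrableOn measurableSet_Ioo) fun η hη hηc hηs => ?_
    have h1 := key η hη.continuous hηc hηs
    simp only [smul_eq_mul, mul_sub]
    rw [integral_sub (hmulint η hη.continuous hηc hηs)
      ((hη.continuous.integrable_of_hasCompactSupport hηc).mul_const _), integral_mul_const, h1,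
      sub_self]
  have hcl : ∀ a ∈ Icc 0 T, Φ a = c := by
    have h1 : EqOn Φ (fun _ => c) (Icc 0 T) := by
      rw [← ae_restrict_iff' measurableSet_Ioo, Measure.restrict_congr_set Ioo_ae_eq_Icc] at hae
      refine Measure.eqOn_Icc_of_ae_eq volume hT.ne ?_ hΦ continuousOn_const
      filter_upwards [hae] with a ha
      linarith
    exact h1
  rw [hcl T ⟨hT.le, le_rfl⟩, hcl 0 ⟨le_rfl, hT.le⟩]

variable {d : ℕ} {A : Set (ℝ × Space d)} {h : ℝ × Space d → ℝ} {t : ℝ} {x : Space d} {T : ℝ}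

/-- The defect in the averaged mean value formula is an integral of the heat operator. -/
theorem integral_levelDensity_mul_meanIntegral (hd : 1 ≤ d) (hh : IsC12On h A)
    (hT : Admissible A t x T) {g : ℝ → ℝ} (hg : ContDiff ℝ 1 g) (hgT : ∀ a, T ≤ a → g a = 0) :
    ∫ α in Ioi (0 : ℝ), levelDensity d α * levelWeight d g α *
        ∫ p, meanIntegrand h t x α p ∂(meanMeasure d) =
    -∫ q in Ioi (0 : ℝ) ×ˢ univ, levelPotential g T (heatLevel d q) *
      (timeDeriv h (t - q.1, x + q.2) - spaceLaplacian h (t - q.1, x + q.2)) := by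
  rw [← integral_heatBall hd hh hT hg hgT]
  exact (integral_heatLevel_mul_eq hd (integrableOn_levelWeight hd hh.continuousOn hT
    (continuous_levelWeight hg) fun a ha => levelWeight_eq_zero hgT ha)).symm

/-- The product of density and weight is (2^d/d) times the derivative of α^(d/2+1) g(α). The choice
g = q α^(-(d/2+1)) makes this derivative exactly q'. -/
lemma levelDensity_mul_levelWeight (hd : 1 ≤ d) {q η : ℝ → ℝ} (hq : ∀ a, HasDerivAt q (η a) a)
    {α : ℝ} (hα : 0 < α) :
    levelDensity d α * levelWeight d (fun a => q a * a ^ (-((d : ℝ) / 2 + 1))) α =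
      2 ^ d / d * η α := by
  have hd' : (0 : ℝ) < d := by exact_mod_cast hd
  have h1 : HasDerivAt (fun a => q a * a ^ (-((d : ℝ) / 2 + 1)))
      (η α * α ^ (-((d : ℝ) / 2 + 1)) +
        q α * (-((d : ℝ) / 2 + 1) * α ^ (-((d : ℝ) / 2 + 1) - 1))) α :=
    (hq α).mul (Real.hasDerivAt_rpow_const (Or.inl hα.ne'))
  have h2 : (2 * Real.sqrt α) ^ d = 2 ^ d * α ^ ((d : ℝ) / 2) := by
    rw [mul_pow, Real.sqrt_eq_rpow, ← Real.rpow_natCast (α ^ _), ← Real.rpow_mul hα.le]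
    congr 2; ring
  rw [levelDensity, levelWeight, h1.deriv, h2, Real.rpow_sub_one hα.ne', Real.rpow_neg hα.le,
    Real.rpow_add_one hα.ne']
  field_simp
  ring

/-- The power is singular only at 0, and q vanishes on a neighbourhood of 0. -/
lemma contDiff_mul_rpow {q η : ℝ → ℝ} (hη : Continuous η) (hq : ∀ a, HasDerivAt q (η a) a)
    {a₀ : ℝ} (ha₀ : 0 < a₀) (hq0 : ∀ a < a₀, q a = 0) (r : ℝ) :
    ContDiff ℝ 1 fun a => q a * a ^ r := by
  have hq1 : ContDiff ℝ 1 q := by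
    rw [contDiff_one_iff_deriv]
    refine ⟨fun a => (hq a).differentiableAt, ?_⟩
    rwa [show deriv q = η from funext fun a => (hq a).deriv]
  rw [contDiff_iff_contDiffAt]
  intro a
  rcases lt_or_ge a a₀ with ha | ha
  · have : (fun a => q a * a ^ r) =ᶠ[𝓝 a] fun _ => 0 := by
      filter_upwards [gt_mem_nhds ha] with s hs
      rw [hq0 s hs, zero_mul]
    exact contDiffAt_const.congr_of_eventuallyEq this
  · exact hq1.contDiffAt.mul (Real.contDiffAt_rpow_const (Or.inl (ha₀.trans_le ha).ne'))

/-- The right side of the averaged identity is zero for every test q, so the mean integral takes the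
same value at level T as at level 0. -/
theorem IsTemperature.meanValueProperty (hd : 1 ≤ d) (hh : IsTemperature h A) :
    MeanValueProperty h A := by
  intro t x T _ hT
  have hd' : (0 : ℝ) < d := by exact_mod_cast hd
  have hT0 := hT.1
  refine ⟨integrable_meanIntegrand hd hh.1.continuousOn hT ⟨hT0.le, le_rfl⟩, ?_⟩
  have hconst := eq_of_integral_deriv_mul_eq_zero hT0
    (continuousOn_integral_meanIntegrand hd hh.1.continuousOn hT) ?_
  · rw [hconst, integral_meanIntegrand_zero hd]
    have : 0 < Real.pi ^ ((d : ℝ) / 2) := Real.rpow_pos_of_pos Real.pi_pos _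
    field_simp
  · rintro q η hη hq ⟨a₀, ha₀, b₀, hb₀, hq0⟩
    set g : ℝ → ℝ := fun a => q a * a ^ (-((d : ℝ) / 2 + 1)) with hg
    have hgC : ContDiff ℝ 1 g :=
      contDiff_mul_rpow hη hq ha₀.1 (fun a ha => hq0 a fun h => by linarith [h.1]) _
    have hgT : ∀ a, T ≤ a → g a = 0 := fun a ha => by
      simp only [hg]
      rw [hq0 a fun h => by linarith [h.2, hb₀.2], zero_mul]
    have key := integral_levelDensity_mul_meanIntegral hd hh.1 hT hgC hgT
    have hzero : ∀ p ∈ Ioi (0 : ℝ) ×ˢ (univ : Set (Space d)), levelPotential g T (heatLevel d p) *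
        (timeDeriv h (t - p.1, x + p.2) - spaceLaplacian h (t - p.1, x + p.2)) = 0 := by
      intro p hp
      rcases le_or_gt (heatLevel d p) T with hle | hlt
      · rw [hh.2 _ (hT.mapsTo (mem_heatCylinder hd hp.1 hle)), mul_zero]
      · rw [levelPotential_eq_zero hgT hlt.le, zero_mul]
    rw [setIntegral_congr_fun (measurableSet_Ioi.prod MeasurableSet.univ) hzero] at key
    have hcongr : ∀ α ∈ Ioi (0 : ℝ), levelDensity d α * levelWeight d g α *
        ∫ p, meanIntegrand h t x α p ∂(meanMeasure d) =
        2 ^ d / d * (η α * ∫ p, meanIntegrand h t x α p ∂(meanMeasure d)) := by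
      intro α hα
      rw [hg, levelDensity_mul_levelWeight hd hq hα, mul_assoc]
    rw [setIntegral_congr_fun measurableSet_Ioi hcongr, integral_const_mul] at key
    simp only [integral_zero, neg_zero, mul_eq_zero] at key
    exact key.resolve_left (by positivity)

lemma isTemperature_const (c : ℝ) (A : Set (ℝ × Space d)) :
    IsTemperature (fun _ : ℝ × Space d => c) A := by
  refine ⟨⟨continuousOn_const, fun p _ => by simp, ?_, fun p _ => contDiffAt_const, ?_, ?_⟩, ?_⟩
  · have : timeDeriv (fun _ : ℝ × Space d => c) = fun _ => 0 := by ext p; simp [timeDeriv]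
    rw [this]; exact continuousOn_const
  · simpa using continuousOn_const
  · have : (fun p : ℝ × Space d => fderiv ℝ (fderiv ℝ fun _ : Space d => c) p.2) =
        fun _ => 0 := by
      ext p : 1
      rw [show fderiv ℝ (fun _ : Space d => c) = fun _ => 0 from funext fun x => by simp]
      simp
    rw [this]; exact continuousOn_const
  · intro p _
    simp [timeDeriv, spaceLaplacian]

/-- Small heat cylinders at nearby points lie in a given neighbourhood. -/
lemma exists_admissible {U : Set (ℝ × Space d)} {p : ℝ × Space d} (hU : U ∈ 𝓝 p) :
    ∃ T > 0, ∀ᶠ p' in 𝓝 p, Admissible U p'.1 p'.2 T := by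
  obtain ⟨δ, hδ, hball⟩ := Metric.mem_nhds_iff.1 hU
  have hcont : ContinuousAt (fun T : ℝ => 2 * Real.sqrt (T * d / (2 * Real.exp 1))) 0 := by
    fun_prop
  have h1 : ∀ᶠ T in 𝓝[>] (0 : ℝ), 2 * Real.sqrt (T * d / (2 * Real.exp 1)) < δ / 2 := by
    refine eventually_nhdsWithin_of_eventually_nhds (hcont.eventually (gt_mem_nhds ?_))
    simpa using hδ
  have h2 : ∀ᶠ T in 𝓝[>] (0 : ℝ), T < δ / 2 :=
    eventually_nhdsWithin_of_eventually_nhds (gt_mem_nhds (by linarith))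
  obtain ⟨T, hT1, hT2, hT0⟩ := (h1.and (h2.and self_mem_nhdsWithin)).exists
  refine ⟨T, hT0, ?_⟩
  filter_upwards [Metric.ball_mem_nhds p (half_pos hδ)] with p' hp'
  refine ⟨hT0, fun q hq => hball ?_⟩
  rw [Metric.mem_ball] at hp' ⊢
  have h3 : dist q p' < δ / 2 := by
    rw [Prod.dist_eq, max_lt_iff]
    have ha := hq.1
    have hb := hq.2
    rw [Metric.mem_closedBall] at hb
    refine ⟨?_, hb.trans_lt hT1⟩
    rw [Real.dist_eq, abs_lt]
    constructor <;> linarith [ha.1, ha.2]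
  linarith [dist_triangle q p' p]

lemma continuousOn_heatOperator (hh : IsC12On h A) :
    ContinuousOn (fun p => timeDeriv h p - spaceLaplacian h p) A :=
  hh.continuousOn_timeDeriv.sub (continuousOn_spaceLaplacian hh)

lemma isOpen_heatBall (d : ℕ) (T : ℝ) :
    IsOpen {q : ℝ × Space d | 0 < q.1 ∧ heatLevel d q < T} := by
  have h1 : IsOpen {q : ℝ × Space d | 0 < q.1} := isOpen_lt continuous_const continuous_fst
  have hc : ContinuousOn (heatLevel d) {q : ℝ × Space d | 0 < q.1} := by
    intro q hq
    have hq : 0 < q.1 := hq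
    rcases Nat.eq_zero_or_pos d with hd | hd
    · subst hd
      unfold heatLevel
      simp only [Nat.cast_zero, mul_zero, zero_mul]
      fun_prop
    have hd' : (0 : ℝ) < d := by exact_mod_cast hd
    apply ContinuousAt.continuousWithinAt
    unfold heatLevel
    refine continuousAt_fst.mul (Real.continuous_exp.continuousAt.comp
      (ContinuousAt.div (by fun_prop) (by fun_prop) (by positivity)))
  exact hc.isOpen_inter_preimage h1 isOpen_Iio

theorem IsC12On.isTemperature_of_meanValueProperty (hd : 1 ≤ d) (hA : IsOpen A) (hh : IsC12On h A)
    (hmv : MeanValueProperty h A) : IsTemperature h A := by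
  refine ⟨hh, fun p₀ hp₀ => ?_⟩
  have hd' : (0 : ℝ) < d := by exact_mod_cast hd
  by_contra hne
  set H : ℝ × Space d → ℝ := fun p => timeDeriv h p - spaceLaplacian h p with hH
  have hne : H p₀ ≠ 0 := hne
  set U : Set (ℝ × Space d) := {p | p ∈ A ∧ 0 < H p₀ * H p} with hU
  have hUn : U ∈ 𝓝 p₀ := by
    have hc := (continuousOn_heatOperator hh).continuousAt (hA.mem_nhds hp₀)
    have : ContinuousAt (fun p => H p₀ * H p) p₀ := continuousAt_const.mul hc
    filter_upwards [hA.mem_nhds hp₀, this.eventually (lt_mem_nhds (mul_self_pos.2 hne))]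
      with p h1 h2 using ⟨h1, h2⟩
  obtain ⟨T, hT0, hTev⟩ := exists_admissible hUn
  have hTU : Admissible U p₀.1 p₀.2 T := hTev.self_of_nhds
  have hT : Admissible A p₀.1 p₀.2 T := ⟨hT0, hTU.2.trans fun p hp => hp.1⟩
  -- The sign makes Ψ(a) the integral of a positive function over (a,T), hence positive below T.
  set g : ℝ → ℝ := fun a => -Real.smoothTransition (T - a) with hg
  have hgC : ContDiff ℝ 1 g :=
    (Real.smoothTransition.contDiff.comp (contDiff_const.sub contDiff_id)).neg
  have hgT : ∀ a, T ≤ a → g a = 0 := fun a ha => by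
    simp only [hg]
    rw [Real.smoothTransition.zero_of_nonpos (by linarith), neg_zero]
  have hΨ : ∀ a < T, 0 < levelPotential g T a := by
    intro a ha
    rw [levelPotential, intervalIntegral.integral_symm, ← intervalIntegral.integral_neg]
    refine intervalIntegral.intervalIntegral_pos_of_pos_on (hgC.continuous.neg.intervalIntegrable _ _)
      (fun s hs => ?_) ha
    simp only [hg, neg_neg]
    exact Real.smoothTransition.pos_of_pos (by linarith [hs.2])
  have key1 := integral_levelDensity_mul_meanIntegral hd hh hT hgC hgT
  -- The constant function with value h(p₀) has the same mean integrals as h at every level up to T.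
  -- As it is a temperature, its identity shows that the left side of `key1` vanishes, without any
  -- computation of the weight.
  have key2 := integral_levelDensity_mul_meanIntegral hd
    (isTemperature_const (h p₀) A).1 hT hgC hgT
  have hright : ∀ q : ℝ × Space d, levelPotential g T (heatLevel d q) *
      (timeDeriv (fun _ : ℝ × Space d => h p₀) (p₀.1 - q.1, p₀.2 + q.2) -
        spaceLaplacian (fun _ : ℝ × Space d => h p₀) (p₀.1 - q.1, p₀.2 + q.2)) = 0 := fun q => by
    rw [(isTemperature_const (h p₀) univ).2 _ (mem_univ _), mul_zero]
  simp only [hright, integral_zero, neg_zero] at key2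
  have hleft : ∀ α ∈ Ioi (0 : ℝ), levelDensity d α * levelWeight d g α *
        ∫ p, meanIntegrand h p₀.1 p₀.2 α p ∂(meanMeasure d) =
      levelDensity d α * levelWeight d g α *
        ∫ p, meanIntegrand (fun _ => h p₀) p₀.1 p₀.2 α p ∂(meanMeasure d) := by
    intro α hα
    rcases le_or_gt α T with hle | hlt
    · have hαA := hT.mono hα hle
      have h1 := (hmv p₀.1 p₀.2 α hp₀ hαA).2
      have h2 := ((isTemperature_const (h p₀) A).meanValueProperty hd p₀.1 p₀.2 α hp₀ hαA).2
      have hπ : 0 < 1 / (2 * Real.pi ^ ((d : ℝ) / 2)) := by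
        have := Real.rpow_pos_of_pos Real.pi_pos ((d : ℝ) / 2)
        positivity
      rw [mul_left_cancel₀ hπ.ne' (h1.symm.trans h2)]
    · rw [levelWeight_eq_zero hgT hlt]; simp
  rw [setIntegral_congr_fun measurableSet_Ioi hleft, key2] at key1
  have hS : MeasurableSet (Ioi (0 : ℝ) ×ˢ (univ : Set (Space d))) :=
    measurableSet_Ioi.prod MeasurableSet.univ
  -- The factor H p₀ makes the integrand nonnegative whichever sign H has near p₀.
  set f : ℝ × Space d → ℝ := fun q => H p₀ * (levelPotential g T (heatLevel d q) *
    H (p₀.1 - q.1, p₀.2 + q.2)) with hf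
  have hfint : IntegrableOn f (Ioi (0 : ℝ) ×ˢ univ) := by
    have hΨc : Continuous (levelPotential g T) := continuous_iff_continuousAt.2 fun a =>
      (hasDerivAt_levelPotential hgC.continuous T a).continuousAt
    have := (integrableOn_levelKernel_mul hd (continuousOn_heatOperator hh) hT hΨc
      (fun a ha => levelPotential_eq_zero hgT ha.le) (a := 0) (b := 0)
      (by push_cast; linarith)).const_mul (H p₀)
    refine IntegrableOn.congr_fun this (fun q hq => ?_) hS
    simp [hf, hH]
  have hf0 : ∫ q in Ioi (0 : ℝ) ×ˢ univ, f q = 0 := by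
    rw [hf, integral_const_mul]
    simp only [hH] at key1 ⊢
    rw [neg_eq_zero.1 key1.symm, mul_zero]
  have hfpos : ∀ q, 0 < q.1 → heatLevel d q < T → 0 < f q := by
    intro q hq hqT
    have h1 := (hTU.mapsTo (mem_heatCylinder hd hq hqT.le)).2
    have h2 := mul_pos (hΨ _ hqT) h1
    simp only [hf]
    linarith
  have hfnn : 0 ≤ᵐ[volume.restrict (Ioi (0 : ℝ) ×ˢ univ)] f := by
    filter_upwards [ae_restrict_mem hS] with q hq
    rcases lt_or_ge (heatLevel d q) T with hlt | hge
    · exact (hfpos q hq.1 hlt).le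
    · simp [hf, levelPotential_eq_zero hgT hge]
  have hpos : 0 < ∫ q in Ioi (0 : ℝ) ×ˢ univ, f q := by
    rw [setIntegral_pos_iff_support_of_nonneg_ae hfnn hfint]
    have hsub : {q : ℝ × Space d | 0 < q.1 ∧ heatLevel d q < T} ⊆
        Function.support f ∩ Ioi (0 : ℝ) ×ˢ univ := fun q hq =>
      ⟨(hfpos q hq.1 hq.2).ne', hq.1, mem_univ _⟩
    refine lt_of_lt_of_le ?_ (measure_mono hsub)
    refine (isOpen_heatBall d T).measure_pos volume ⟨(T / 2, 0), ?_, ?_⟩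
    · simpa using hT0
    · simp [heatLevel]; exact hT0
  linarith

end HeatMeanValue

/-! ### Convolution of bounded functions with singular causal kernels -/

namespace HeatMeanValue
open Set Filter Topology ENNReal
open scoped ContDiff Convolution

section Convolution

variable {X F : Type*} [NormedAddCommGroup X] [MeasurableSpace X] [BorelSpace X]
  [NormedAddCommGroup F] [NormedSpace ℝ F] [NormedSpace ℝ X] [FiniteDimensional ℝ X]
  {μ : Measure X} [μ.IsAddHaarMeasure]

lemma integrable_smul_comp_sub {f : X → ℝ} {M : ℝ} (hf : AEStronglyMeasurable f μ)
    (hM : ∀ x, |f x| ≤ M) {k : X → F} (hk : Integrable k μ) (x : X) :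
    Integrable (fun t => f t • k (x - t)) μ :=
  (hk.comp_sub_left x).bdd_smul M hf (Eventually.of_forall hM)

lemma norm_integral_smul_comp_sub_le {f : X → ℝ} {M : ℝ}
    (hM : ∀ x, |f x| ≤ M) {k : X → F} (hk : Integrable k μ) (x : X) :
    ‖∫ t, f t • k (x - t) ∂μ‖ ≤ M * ∫ t, ‖k t‖ ∂μ := by
  rw [← integral_sub_left_eq_self (fun t => ‖k t‖) μ x, ← integral_const_mul]
  refine norm_integral_le_of_norm_le ((hk.comp_sub_left x).norm.const_mul M)
    (Eventually.of_forall fun t => ?_)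
  rw [norm_smul]
  gcongr
  exact hM t

/-- Young's inequality for a bounded factor and an integrable one: L¹ convergence of the kernels
becomes uniform convergence of the convolutions. -/
lemma tendstoUniformly_integral_smul_comp_sub {f : X → ℝ} {M : ℝ} (hf : AEStronglyMeasurable f μ)
    (hM : ∀ x, |f x| ≤ M) {k : X → F} {kn : ℕ → X → F} (hk : Integrable k μ)
    (hkn : ∀ n, Integrable (kn n) μ)
    (hlim : Tendsto (fun n => ∫ t, ‖kn n t - k t‖ ∂μ) atTop (𝓝 0)) :
    TendstoUniformly (fun n x => ∫ t, f t • kn n (x - t) ∂μ) (fun x => ∫ t, f t • k (x - t) ∂μ)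
      atTop := by
  rw [Metric.tendstoUniformly_iff]
  intro ε hε
  have h1 : Tendsto (fun n => M * ∫ t, ‖kn n t - k t‖ ∂μ) atTop (𝓝 0) := by
    simpa using hlim.const_mul M
  filter_upwards [h1.eventually (gt_mem_nhds hε)] with n hn x
  rw [dist_comm, dist_eq_norm, ← integral_sub (integrable_smul_comp_sub hf hM (hkn n) x)
    (integrable_smul_comp_sub hf hM hk x)]
  simp only [← smul_sub]
  exact (norm_integral_smul_comp_sub_le hM ((hkn n).sub hk) x).trans_lt hn

/-- Convolution of a bounded function with a kernel which is a limit of smooth kernels in the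
Sobolev space `W^{1,1}`. -/
lemma hasFDerivAt_integral_smul_comp_sub {f : X → ℝ} {M : ℝ} (hf : AEStronglyMeasurable f μ)
    (hM : ∀ x, |f x| ≤ M) {k : X → F} {k' : X → X →L[ℝ] F} {kn : ℕ → X → F}
    (hk : Integrable k μ) (hk' : Integrable k' μ)
    (hkn : ∀ n, ContDiff ℝ 1 (kn n)) (hknc : ∀ n, HasCompactSupport (kn n))
    (hlim : Tendsto (fun n => ∫ t, ‖kn n t - k t‖ ∂μ) atTop (𝓝 0))
    (hlim' : Tendsto (fun n => ∫ t, ‖fderiv ℝ (kn n) t - k' t‖ ∂μ) atTop (𝓝 0)) :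
    (∀ x, HasFDerivAt (fun x => ∫ t, f t • k (x - t) ∂μ) (∫ t, f t • k' (x - t) ∂μ) x) ∧
      Continuous fun x => ∫ t, f t • k' (x - t) ∂μ := by
  have hfl : LocallyIntegrable f μ := by
    refine (memLp_top_of_bound hf M (Eventually.of_forall hM)).locallyIntegrable le_top
  have hd : ∀ n x, HasFDerivAt (fun x => ∫ t, f t • kn n (x - t) ∂μ)
      (∫ t, f t • fderiv ℝ (kn n) (x - t) ∂μ) x := by
    intro n x
    have h1 := (hknc n).hasFDerivAt_convolution_right (ContinuousLinearMap.lsmul ℝ ℝ) (μ := μ)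
      hfl (hkn n) x
    exact h1
  have hcont : ∀ n, Continuous fun x => ∫ t, f t • fderiv ℝ (kn n) (x - t) ∂μ := fun n =>
    ((hknc n).fderiv (𝕜 := ℝ)).continuous_convolution_right
      (ContinuousLinearMap.lsmul ℝ ℝ) (μ := μ) hfl ((hkn n).continuous_fderiv (by norm_num))
  have hu' := tendstoUniformly_integral_smul_comp_sub hf hM hk'
    (fun n => ((hkn n).continuous_fderiv (by norm_num)).integrable_of_hasCompactSupport
      ((hknc n).fderiv (𝕜 := ℝ))) hlim'
  have hu := tendstoUniformly_integral_smul_comp_sub hf hM hk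
    (fun n => (hkn n).continuous.integrable_of_hasCompactSupport (hknc n)) hlim
  refine ⟨fun x => hasFDerivAt_of_tendstoUniformly hu' hd (fun y => hu.tendsto_at y) x,
    hu'.continuous (Frequently.of_forall hcont)⟩

end Convolution

lemma exists_bound_deriv_smoothTransition :
    ∃ C, 0 ≤ C ∧ ∀ y, |deriv Real.smoothTransition y| ≤ C := by
  have hc : Continuous (deriv Real.smoothTransition) :=
    (Real.smoothTransition.contDiff (n := 1)).continuous_deriv (by norm_num)
  obtain ⟨C, hC⟩ := (isCompact_Icc (a := (0 : ℝ)) (b := 1)).exists_bound_of_continuousOn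
    hc.continuousOn
  refine ⟨max C 0, le_max_right _ _, fun y => ?_⟩
  by_cases hy : y ∈ Icc (0 : ℝ) 1
  · exact (hC y hy).trans (le_max_left _ _)
  · have h0 : deriv Real.smoothTransition y = 0 := by
      rcases lt_or_ge y 0 with h | h
      · have : Real.smoothTransition =ᶠ[𝓝 y] fun _ => 0 := by
          filter_upwards [gt_mem_nhds h] with s hs using Real.smoothTransition.zero_of_nonpos hs.le
        rw [this.deriv_eq]; simp
      · have h1 : 1 < y := by
          by_contra hcon
          exact hy ⟨h, not_lt.1 hcon⟩
        have : Real.smoothTransition =ᶠ[𝓝 y] fun _ => 1 := by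
          filter_upwards [lt_mem_nhds h1] with s hs using Real.smoothTransition.one_of_one_le hs.le
        rw [this.deriv_eq]; simp
    rw [h0, abs_zero]
    exact le_max_right _ _

lemma deriv_smoothTransition_of_one_lt {y : ℝ} (hy : 1 < y) :
    deriv Real.smoothTransition y = 0 := by
  have : Real.smoothTransition =ᶠ[𝓝 y] fun _ => 1 := by
    filter_upwards [lt_mem_nhds hy] with s hs using Real.smoothTransition.one_of_one_le hs.le
  rw [this.deriv_eq]; simp

section Kernel

variable {d : ℕ} {F : Type*} [NormedAddCommGroup F] [NormedSpace ℝ F]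

/-- Cutting off a causal kernel near the initial time. -/
noncomputable def timeCutoff (k : ℝ × Space d → F) (n : ℕ) (q : ℝ × Space d) : F :=
  Real.smoothTransition ((n + 1) * q.1 - 1) • k q

variable {k : ℝ × Space d → F}

lemma contDiff_timeCutoff (hk : ∀ q, 0 < q.1 → ContDiffAt ℝ 1 k q) (n : ℕ) :
    ContDiff ℝ 1 (timeCutoff k n) := by
  rw [contDiff_iff_contDiffAt]
  intro q
  rcases lt_or_ge 0 q.1 with hq | hq
  · refine ContDiffAt.smul ?_ (hk q hq)
    exact Real.smoothTransition.contDiffAt.comp q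
      ((contDiffAt_const.mul contDiffAt_fst).sub contDiffAt_const)
  · have hc : ContinuousAt (fun q : ℝ × Space d => (n + 1) * q.1 - 1) q := by fun_prop
    have h1 : (fun q : ℝ × Space d => (n + 1) * q.1 - 1) q < 0 := by
      have : (n + 1 : ℝ) * q.1 ≤ 0 := mul_nonpos_of_nonneg_of_nonpos (by positivity) hq
      simp only; linarith
    have : timeCutoff k n =ᶠ[𝓝 q] fun _ => 0 := by
      filter_upwards [hc.eventually (gt_mem_nhds h1)] with p hp
      rw [timeCutoff, Real.smoothTransition.zero_of_nonpos (le_of_lt hp), zero_smul]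
    exact contDiffAt_const.congr_of_eventuallyEq this

lemma fderiv_timeCutoff (hk : ∀ q, 0 < q.1 → ContDiffAt ℝ 1 k q) (n : ℕ) {q : ℝ × Space d}
    (hq : 0 < q.1) :
    fderiv ℝ (timeCutoff k n) q = Real.smoothTransition ((n + 1) * q.1 - 1) • fderiv ℝ k q +
      ((deriv Real.smoothTransition ((n + 1) * q.1 - 1) * (n + 1)) •
        ContinuousLinearMap.fst ℝ ℝ (Space d)).smulRight (k q) := by
  have h1 : HasFDerivAt (fun q : ℝ × Space d => ((n : ℝ) + 1) * q.1 - 1)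
      (((n : ℝ) + 1) • ContinuousLinearMap.fst ℝ ℝ (Space d)) q :=
    (hasFDerivAt_fst.const_mul _).sub_const _
  have h2 : HasDerivAt Real.smoothTransition
      (deriv Real.smoothTransition ((n + 1) * q.1 - 1)) ((n + 1) * q.1 - 1) :=
    ((Real.smoothTransition.contDiff (n := 1)).differentiable (by norm_num) _).hasDerivAt
  have h3 := (h2.hasFDerivAt.comp q h1).smul
    ((hk q hq).differentiableAt (by norm_num)).hasFDerivAt
  have h4 : HasFDerivAt (timeCutoff k n) _ q := h3
  rw [h4.fderiv]
  ext y <;> simp [mul_comm]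

lemma tendsto_integral_timeCutoff (hk0 : ∀ q, q.1 ≤ 0 → k q = 0) (hki : Integrable k) :
    Tendsto (fun n => ∫ q, ‖timeCutoff k n q - k q‖) atTop (𝓝 0) := by
  have hθ : Measurable Real.smoothTransition := Real.smoothTransition.continuous.measurable
  have : Tendsto (fun n => ∫ q, ‖timeCutoff k n q - k q‖) atTop
      (𝓝 (∫ _ : ℝ × Space d, (0 : ℝ))) := by
    refine tendsto_integral_of_dominated_convergence (fun q => ‖k q‖) (fun n => ?_) hki.norm
      (fun n => Eventually.of_forall fun q => ?_) (Eventually.of_forall fun q => ?_)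
    · have : Measurable fun q : ℝ × Space d => Real.smoothTransition ((n + 1) * q.1 - 1) :=
        hθ.comp (by fun_prop)
      exact ((this.aestronglyMeasurable.smul hki.1).sub hki.1).norm
    · have h1 : timeCutoff k n q - k q =
          -((1 - Real.smoothTransition ((n + 1) * q.1 - 1)) • k q) := by
        rw [timeCutoff, sub_smul, one_smul, neg_sub]
      rw [norm_norm, h1, norm_neg, norm_smul]
      have h2 := Real.smoothTransition.nonneg ((n + 1) * q.1 - 1)
      have h3 := Real.smoothTransition.le_one ((n + 1) * q.1 - 1)
      rw [Real.norm_of_nonneg (by linarith)]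
      exact mul_le_of_le_one_left (norm_nonneg _) (by linarith)
    · rcases le_or_gt q.1 0 with hq | hq
      · simp [timeCutoff, hk0 q hq]
      · refine tendsto_const_nhds.congr' ?_
        obtain ⟨N, hN⟩ := exists_nat_gt (2 / q.1)
        filter_upwards [eventually_ge_atTop N] with n hn
        have : (2 : ℝ) ≤ (n + 1) * q.1 := by
          rw [div_lt_iff₀ hq] at hN
          have : (N : ℝ) ≤ n := by exact_mod_cast hn
          nlinarith
        rw [timeCutoff, Real.smoothTransition.one_of_one_le (by linarith), one_smul, sub_self,
          norm_zero]
  simpa using this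

lemma fderiv_eq_zero_of_neg (hk0 : ∀ q, q.1 ≤ 0 → k q = 0) {q : ℝ × Space d} (hq : q.1 < 0) :
    fderiv ℝ k q = 0 := by
  have : k =ᶠ[𝓝 q] fun _ => 0 := by
    filter_upwards [continuousAt_fst.eventually (gt_mem_nhds hq)] with p hp using hk0 p (le_of_lt hp)
  rw [this.fderiv_eq]; simp

/-- At time zero a causal kernel may fail to be differentiable; this hyperplane is discarded in all
the integrals. -/
lemma ae_fst_ne_zero : ∀ᵐ q : ℝ × Space d, q.1 ≠ 0 := by
  rw [Measure.volume_eq_prod]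
  exact Measure.quasiMeasurePreserving_fst.ae (Measure.ae_ne volume 0)

/-- The derivative of the cutoff contributes (n+1)θ'((n+1)τ - 1) k, where θ is the smooth
transition. It lives where (n+1)τ ≤ 2, hence is at most (2C/τ)‖k‖; this is why integrability of τ⁻¹
k is required. -/
lemma tendsto_integral_fderiv_timeCutoff (hk0 : ∀ q, q.1 ≤ 0 → k q = 0)
    (hk : ∀ q, 0 < q.1 → ContDiffAt ℝ 1 k q)
    (hkτ : Integrable fun q => q.1⁻¹ • k q) (hk' : Integrable (fderiv ℝ k)) :
    Tendsto (fun n => ∫ q, ‖fderiv ℝ (timeCutoff k n) q - fderiv ℝ k q‖) atTop (𝓝 0) := by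
  obtain ⟨C, hC0, hC⟩ := exists_bound_deriv_smoothTransition
  have hkn0 : ∀ n q, q.1 ≤ 0 → timeCutoff k n q = 0 := fun n q hq => by
    rw [timeCutoff, hk0 q hq, smul_zero]
  have : Tendsto (fun n => ∫ q, ‖fderiv ℝ (timeCutoff k n) q - fderiv ℝ k q‖) atTop
      (𝓝 (∫ _ : ℝ × Space d, (0 : ℝ))) := by
    refine tendsto_integral_of_dominated_convergence
      (fun q => ‖fderiv ℝ k q‖ + 2 * C * ‖q.1⁻¹ • k q‖) (fun n => ?_)
      (hk'.norm.add (hkτ.norm.const_mul _)) (fun n => ?_) ?_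
    · exact (((contDiff_timeCutoff hk n).continuous_fderiv
        (by norm_num)).aestronglyMeasurable.sub hk'.1).norm
    · filter_upwards [ae_fst_ne_zero] with q hq
      rcases lt_or_gt_of_ne hq with hq | hq
      · rw [fderiv_eq_zero_of_neg (hkn0 n) hq, fderiv_eq_zero_of_neg hk0 hq]
        simp only [sub_self, norm_zero]
        positivity
      · rw [norm_norm, fderiv_timeCutoff hk n hq]
        set θ := Real.smoothTransition ((n + 1) * q.1 - 1)
        have h2 : 0 ≤ θ := Real.smoothTransition.nonneg _
        have h3 : θ ≤ 1 := Real.smoothTransition.le_one _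
        set c := deriv Real.smoothTransition ((n + 1) * q.1 - 1) * (n + 1) with hc
        have h4 : |c| ≤ 2 * C * q.1⁻¹ := by
          rcases lt_or_ge 1 ((n + 1) * q.1 - 1) with h | h
          · rw [hc, deriv_smoothTransition_of_one_lt h]
            simp only [zero_mul, abs_zero]
            positivity
          · rw [hc, abs_mul, abs_of_nonneg (show (0 : ℝ) ≤ n + 1 by positivity)]
            have : (n + 1 : ℝ) ≤ 2 * q.1⁻¹ := by
              rw [← div_eq_mul_inv, le_div_iff₀ hq]; linarith
            calc _ ≤ C * (2 * q.1⁻¹) := by gcongr; exact hC _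
              _ = _ := by ring
        have h5 : θ • fderiv ℝ k q +
            (c • ContinuousLinearMap.fst ℝ ℝ (Space d)).smulRight (k q) - fderiv ℝ k q =
            -((1 - θ) • fderiv ℝ k q) +
            (c • ContinuousLinearMap.fst ℝ ℝ (Space d)).smulRight (k q) := by
          rw [show (1 - θ) • fderiv ℝ k q = fderiv ℝ k q - θ • fderiv ℝ k q by
            ext y <;> simp [sub_smul]]
          abel
        rw [h5]
        refine (norm_add_le _ _).trans (add_le_add ?_ ?_)
        · rw [norm_neg, norm_smul, Real.norm_of_nonneg (by linarith)]
          exact mul_le_of_le_one_left (norm_nonneg _) (by linarith)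
        · rw [ContinuousLinearMap.norm_smulRight_apply, norm_smul, norm_smul, Real.norm_eq_abs c,
            Real.norm_of_nonneg (inv_nonneg.2 hq.le), ← mul_assoc]
          have := ContinuousLinearMap.norm_fst_le ℝ ℝ (Space d)
          refine mul_le_mul_of_nonneg_right ?_ (norm_nonneg _)
          calc |c| * ‖ContinuousLinearMap.fst ℝ ℝ (Space d)‖ ≤ |c| * 1 := by gcongr
            _ ≤ _ := by rw [mul_one]; exact h4
    · filter_upwards [ae_fst_ne_zero] with q hq
      rcases lt_or_gt_of_ne hq with hq | hq
      · simp only [fderiv_eq_zero_of_neg (hkn0 _) hq, fderiv_eq_zero_of_neg hk0 hq, sub_self,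
          norm_zero]
        exact tendsto_const_nhds
      · refine tendsto_const_nhds.congr' ?_
        obtain ⟨N, hN⟩ := exists_nat_gt (2 / q.1)
        filter_upwards [eventually_ge_atTop N] with n hn
        have : (2 : ℝ) < (n + 1) * q.1 := by
          rw [div_lt_iff₀ hq] at hN
          have : (N : ℝ) ≤ n := by exact_mod_cast hn
          nlinarith
        rw [fderiv_timeCutoff hk n hq, deriv_smoothTransition_of_one_lt (by linarith),
          Real.smoothTransition.one_of_one_le (by linarith)]
        have h0 : ((0 : ℝ) • ContinuousLinearMap.fst ℝ ℝ (Space d)).smulRight (k q) = 0 := by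
          ext <;> simp
        rw [zero_mul, h0, one_smul, add_zero, sub_self, norm_zero]
  simpa using this

instance : (volume : Measure (ℝ × Space d)).IsAddHaarMeasure := by
  rw [Measure.volume_eq_prod]; infer_instance

/-- Convolution of a bounded function with a causal kernel singular only at the initial time. -/
lemma hasFDerivAt_convolution_causal {f : ℝ × Space d → ℝ} {M : ℝ} (hf : AEStronglyMeasurable f)
    (hM : ∀ x, |f x| ≤ M) (hk0 : ∀ q, q.1 ≤ 0 → k q = 0)
    (hk : ∀ q, 0 < q.1 → ContDiffAt ℝ 1 k q) (hkc : HasCompactSupport k) (hki : Integrable k)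
    (hkτ : Integrable fun q => q.1⁻¹ • k q) (hk' : Integrable (fderiv ℝ k)) :
    (∀ x, HasFDerivAt (fun x => ∫ t, f t • k (x - t)) (∫ t, f t • fderiv ℝ k (x - t)) x) ∧
      Continuous fun x => ∫ t, f t • fderiv ℝ k (x - t) :=
  hasFDerivAt_integral_smul_comp_sub hf hM hki hk' (contDiff_timeCutoff hk)
    (fun n => hkc.smul_left (f := fun q : ℝ × Space d =>
      Real.smoothTransition ((n + 1) * q.1 - 1)))
    (tendsto_integral_timeCutoff hk0 hki) (tendsto_integral_fderiv_timeCutoff hk0 hk hkτ hk')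

end Kernel

end HeatMeanValue

/-! ### Kernels w(L) τ^(-b) p(z): derivatives and integrability -/

namespace HeatMeanValue
open Set Filter Topology ENNReal
open scoped ContDiff

variable {d : ℕ} {F : Type*} [NormedAddCommGroup F] [NormedSpace ℝ F]

lemma hasFDerivAt_heatLevel (hd : 1 ≤ d) {q : ℝ × Space d} (hq : 0 < q.1) :
    HasFDerivAt (heatLevel d)
      ((heatLevel d q * (q.1⁻¹ - ‖q.2‖ ^ 2 / (2 * d) * (q.1⁻¹) ^ 2)) •
        ContinuousLinearMap.fst ℝ ℝ (Space d) +
      (heatLevel d q / (d * q.1)) •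
        (innerSL ℝ q.2).comp (ContinuousLinearMap.snd ℝ ℝ (Space d))) q := by
  have hd' : (0 : ℝ) < d := by exact_mod_cast hd
  have hq0 := hq.ne'
  have h1 : HasFDerivAt (fun q : ℝ × Space d => (q.1)⁻¹)
      (-((q.1) ^ 2)⁻¹ • ContinuousLinearMap.fst ℝ ℝ (Space d)) q :=
    (hasDerivAt_inv hq0).comp_hasFDerivAt q hasFDerivAt_fst
  have h2 : HasFDerivAt (fun q : ℝ × Space d => ‖q.2‖ ^ 2)
      ((2 • innerSL ℝ q.2).comp (ContinuousLinearMap.snd ℝ ℝ (Space d))) q :=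
    (hasStrictFDerivAt_norm_sq q.2).hasFDerivAt.comp q hasFDerivAt_snd
  have h3 := hasFDerivAt_fst.mul ((h2.mul h1).mul_const (2 * d : ℝ)⁻¹).exp
  have h4 : HasFDerivAt (heatLevel d) _ q := h3.congr_of_eventuallyEq
    (Eventually.of_forall fun p => by
      simp only [heatLevel, Pi.mul_apply, div_eq_mul_inv, mul_inv]
      ring_nf)
  refine h4.congr_fderiv ?_
  ext y
  · simp [heatLevel]
    field_simp
    ring
  · simp [heatLevel]
    field_simp

lemma contDiffAt_heatLevel (hd : 1 ≤ d) {q : ℝ × Space d} (hq : 0 < q.1) {n : WithTop ℕ∞} :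
    ContDiffAt ℝ n (heatLevel d) q := by
  have hd' : (0 : ℝ) < d := by exact_mod_cast hd
  unfold heatLevel
  have h : ContDiffAt ℝ n (fun q : ℝ × Space d => ‖q.2‖ ^ 2) q :=
    (contDiff_norm_sq ℝ).contDiffAt.comp q contDiffAt_snd
  exact contDiffAt_fst.mul ((h.div (contDiffAt_const.mul contDiffAt_fst) (by positivity)).exp)

/-- Kernels of the form `w(heatLevel) τ^{-b} p(z)`. -/
noncomputable def levelKernel (w : ℝ → ℝ) (b : ℕ) (p : Space d → F) (q : ℝ × Space d) : F :=
  (w (heatLevel d q) * (q.1⁻¹) ^ b) • p q.2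

lemma heatLevel_nonpos {q : ℝ × Space d} (hq : q.1 ≤ 0) : heatLevel d q ≤ 0 :=
  mul_nonpos_of_nonpos_of_nonneg hq (Real.exp_pos _).le

variable {w : ℝ → ℝ} {p : Space d → F} {a b : ℕ} {a₀ T C : ℝ}

/-- For τ ≤ 0 the level is nonpositive, also at τ = 0 under division by zero, so a weight vanishing
on (-∞,0] makes the kernel causal. -/
lemma levelKernel_eq_zero (hw0 : ∀ s ≤ 0, w s = 0) {q : ℝ × Space d}
    (hq : q.1 ≤ 0) : levelKernel w b p q = 0 := by
  rw [levelKernel, hw0 _ (heatLevel_nonpos hq), zero_mul, zero_smul]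

lemma levelKernel_support (hw0 : ∀ s ≤ 0, w s = 0) (hwT : ∀ s, T ≤ s → w s = 0)
    {q : ℝ × Space d} (hq : levelKernel w b p q ≠ 0) : 0 < q.1 ∧ heatLevel d q ≤ T := by
  constructor
  · by_contra hcon
    exact hq (levelKernel_eq_zero hw0 (not_lt.1 hcon))
  · by_contra hcon
    exact hq (by rw [levelKernel, hwT _ (not_le.1 hcon).le, zero_mul, zero_smul])

lemma hasCompactSupport_levelKernel (hd : 1 ≤ d) (hw0 : ∀ s ≤ 0, w s = 0)
    (hwT : ∀ s, T ≤ s → w s = 0) : HasCompactSupport (levelKernel w b p) :=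
  HasCompactSupport.of_support_subset_isCompact (isCompact_heatCylinder d T) fun q hq => by
    obtain ⟨h1, h2⟩ := levelKernel_support hw0 hwT hq
    exact mem_heatCylinder hd h1 h2

lemma exists_bound_of_continuous_of_zero (hw : Continuous w) (hw0 : ∀ s ≤ 0, w s = 0)
    (hwT : ∀ s, T ≤ s → w s = 0) : ∃ N, 0 ≤ N ∧ ∀ s, |w s| ≤ N := by
  obtain ⟨N, hN⟩ := (isCompact_Icc (a := 0) (b := T)).exists_bound_of_continuousOn hw.continuousOn
  refine ⟨max N 0, le_max_right _ _, fun s => ?_⟩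
  by_cases hs : s ∈ Icc 0 T
  · exact (hN s hs).trans (le_max_left _ _)
  · have : w s = 0 := by
      rcases le_or_gt s 0 with h | h
      · exact hw0 s h
      · refine hwT s (le_of_lt ?_)
        by_contra hcon
        exact hs ⟨h.le, not_lt.1 hcon⟩
    rw [this, abs_zero]
    exact le_max_right _ _

lemma measurable_levelCoeff (hw : Continuous w) (b : ℕ) :
    Measurable fun q : ℝ × Space d => w (heatLevel d q) * (q.1⁻¹) ^ b :=
  (hw.measurable.comp (measurable_heatLevel d)).mul (by fun_prop)

lemma integrable_levelKernel (hd : 1 ≤ d) (hw : Continuous w) (hw0 : ∀ s ≤ 0, w s = 0)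
    (hwT : ∀ s, T ≤ s → w s = 0) (hp : Continuous p) (hpb : ∀ z, ‖p z‖ ≤ C * ‖z‖ ^ a)
    (hab : (b : ℝ) - a / 2 < d / 2 + 1) : Integrable (levelKernel w b p) := by
  obtain ⟨N, hN0, hN⟩ := exists_bound_of_continuous_of_zero hw hw0 hwT
  refine integrable_of_heatLevel_le hd (T := T) (a := a) (b := b) (C := N * C) ?_
    (fun q hq => levelKernel_support hw0 hwT hq) (fun q hq hqT => ?_) hab
  · exact (measurable_levelCoeff hw b).aestronglyMeasurable.smul
      (hp.comp continuous_snd).aestronglyMeasurable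
  · rw [levelKernel, norm_smul, norm_mul, norm_pow, Real.norm_of_nonneg (inv_nonneg.2 hq.le)]
    calc ‖w (heatLevel d q)‖ * q.1⁻¹ ^ b * ‖p q.2‖ ≤ N * q.1⁻¹ ^ b * (C * ‖q.2‖ ^ a) := by
          gcongr
          · exact hN _
          · exact hpb _
      _ = _ := by ring

lemma integrable_inv_smul_levelKernel (hd : 1 ≤ d) (hw : Continuous w) (hw0 : ∀ s ≤ 0, w s = 0)
    (hwT : ∀ s, T ≤ s → w s = 0) (hp : Continuous p) (hpb : ∀ z, ‖p z‖ ≤ C * ‖z‖ ^ a)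
    (hab : (b : ℝ) + 1 - a / 2 < d / 2 + 1) :
    Integrable fun q => q.1⁻¹ • levelKernel w b p q := by
  have := integrable_levelKernel (b := b + 1) hd hw hw0 hwT hp hpb (by push_cast; linarith)
  refine this.congr (Eventually.of_forall fun q => ?_)
  simp only [levelKernel, smul_smul]
  congr 1; ring

lemma hasFDerivAt_levelKernel (hd : 1 ≤ d) (hw : ContDiff ℝ 1 w) (hp : ContDiff ℝ 1 p)
    (b : ℕ) {q : ℝ × Space d} (hq : 0 < q.1) :
    HasFDerivAt (levelKernel w b p)
      ((w (heatLevel d q) * (q.1⁻¹) ^ b) •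
        (fderiv ℝ p q.2).comp (ContinuousLinearMap.snd ℝ ℝ (Space d)) +
      ((deriv w (heatLevel d q) * (q.1⁻¹) ^ b) •
        ((heatLevel d q * (q.1⁻¹ - ‖q.2‖ ^ 2 / (2 * d) * (q.1⁻¹) ^ 2)) •
          ContinuousLinearMap.fst ℝ ℝ (Space d) +
        (heatLevel d q / (d * q.1)) •
          (innerSL ℝ q.2).comp (ContinuousLinearMap.snd ℝ ℝ (Space d))) +
        (w (heatLevel d q) * -(b * (q.1⁻¹) ^ (b + 1))) •
          ContinuousLinearMap.fst ℝ ℝ (Space d)).smulRight (p q.2)) q := by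
  have hq0 := hq.ne'
  have h1 : HasFDerivAt (fun q : ℝ × Space d => (q.1⁻¹) ^ b)
      (-(b * (q.1⁻¹) ^ (b + 1)) • ContinuousLinearMap.fst ℝ ℝ (Space d)) q := by
    have h0 : HasDerivAt (fun s : ℝ => (s⁻¹) ^ b) (-(b * (q.1⁻¹) ^ (b + 1))) q.1 := by
      refine ((hasDerivAt_inv hq0).pow b).congr_deriv ?_
      rcases b with _ | n
      · simp
      · simp only [Nat.add_sub_cancel]
        rw [← inv_pow]
        ring
    exact h0.comp_hasFDerivAt q hasFDerivAt_fst
  have h2 : HasFDerivAt (fun q : ℝ × Space d => w (heatLevel d q)) _ q :=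
    ((hw.differentiable (by norm_num) (heatLevel d q)).hasDerivAt).comp_hasFDerivAt q
      (hasFDerivAt_heatLevel hd hq)
  have h3 : HasFDerivAt (fun q : ℝ × Space d => p q.2) _ q :=
    ((hp.differentiable (by norm_num) q.2).hasFDerivAt).comp q hasFDerivAt_snd
  have h4 : HasFDerivAt (levelKernel w b p) _ q := (h2.mul h1).smul h3
  refine h4.congr_fderiv ?_
  congr 2
  rw [add_comm, smul_smul, smul_smul, mul_comm ((q.1⁻¹) ^ b)]

/-- Each derivative of L contains a factor L, so w' enters only through the bounded function s
w'(s). The four monomials come, in order, from the derivative of p, from the 1/τ terms of the time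
derivative, from its ‖z‖²/τ² term, and from the space derivative of L. -/
lemma norm_fderiv_levelKernel_le (hd : 1 ≤ d) (hw : ContDiff ℝ 1 w) (hp : ContDiff ℝ 1 p)
    {N : ℝ} (hN : ∀ s, |w s| ≤ N) (hN' : ∀ s, |deriv w s * s| ≤ N)
    (hC : 0 ≤ C) (hpb : ∀ z, ‖p z‖ ≤ C * ‖z‖ ^ (a + 1)) (hpb' : ∀ z, ‖fderiv ℝ p z‖ ≤ C * ‖z‖ ^ a)
    {q : ℝ × Space d} (hq : 0 < q.1) :
    ‖fderiv ℝ (levelKernel w b p) q‖ ≤ N * C * (b + 1) *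
      ((q.1⁻¹) ^ b * ‖q.2‖ ^ a + (q.1⁻¹) ^ (b + 1) * ‖q.2‖ ^ (a + 1) +
        (q.1⁻¹) ^ (b + 2) * ‖q.2‖ ^ (a + 3) + (q.1⁻¹) ^ (b + 1) * ‖q.2‖ ^ (a + 2)) := by
  have hd' : (1 : ℝ) ≤ d := by exact_mod_cast hd
  have hN0 : 0 ≤ N := (abs_nonneg _).trans (hN 0)
  rw [(hasFDerivAt_levelKernel hd hw hp b hq).fderiv]
  set τ := q.1⁻¹ with hτ
  have hτ0 : 0 ≤ τ := inv_nonneg.2 hq.le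
  set r := ‖q.2‖ with hr
  have hr0 : 0 ≤ r := norm_nonneg _
  have hfst := ContinuousLinearMap.norm_fst_le ℝ ℝ (Space d)
  have hsnd := ContinuousLinearMap.norm_snd_le ℝ ℝ (Space d)
  set L := heatLevel d q
  have e1 : ‖(w L * τ ^ b) • (fderiv ℝ p q.2).comp (ContinuousLinearMap.snd ℝ ℝ (Space d))‖ ≤
      N * C * (τ ^ b * r ^ a) := by
    rw [norm_smul, norm_mul, norm_pow, Real.norm_of_nonneg hτ0]
    calc ‖w L‖ * τ ^ b * ‖(fderiv ℝ p q.2).comp (ContinuousLinearMap.snd ℝ ℝ (Space d))‖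
        ≤ N * τ ^ b * (C * r ^ a * 1) := by
          gcongr
          · exact hN _
          · exact (ContinuousLinearMap.opNorm_comp_le _ _).trans
              (mul_le_mul (hpb' _) hsnd (norm_nonneg _) (by positivity))
      _ = _ := by ring
  have e2 : ‖(deriv w L * τ ^ b) • ((L * (τ - r ^ 2 / (2 * d) * τ ^ 2)) •
      ContinuousLinearMap.fst ℝ ℝ (Space d) + (L / (d * q.1)) •
        (innerSL ℝ q.2).comp (ContinuousLinearMap.snd ℝ ℝ (Space d)))‖ ≤
      N * (τ ^ b * (τ + r ^ 2 * τ ^ 2 + r * τ)) := by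
    rw [show (deriv w L * τ ^ b) • ((L * (τ - r ^ 2 / (2 * d) * τ ^ 2)) •
      ContinuousLinearMap.fst ℝ ℝ (Space d) + (L / (d * q.1)) •
        (innerSL ℝ q.2).comp (ContinuousLinearMap.snd ℝ ℝ (Space d))) =
        ((deriv w L * L) * τ ^ b) • ((τ - r ^ 2 / (2 * d) * τ ^ 2) •
      ContinuousLinearMap.fst ℝ ℝ (Space d) + (τ / d) •
        (innerSL ℝ q.2).comp (ContinuousLinearMap.snd ℝ ℝ (Space d))) by
      rw [smul_add, smul_add, smul_smul, smul_smul, smul_smul, smul_smul]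
      congr 2
      · ring
      · rw [hτ]; field_simp]
    rw [norm_smul, norm_mul, norm_pow, Real.norm_of_nonneg hτ0, mul_assoc]
    refine mul_le_mul (hN' L) ?_ (by positivity) hN0
    refine mul_le_mul_of_nonneg_left ?_ (by positivity)
    refine (norm_add_le _ _).trans (add_le_add ?_ ?_)
    · rw [norm_smul]
      refine (mul_le_of_le_one_right (norm_nonneg _) hfst).trans ?_
      refine (norm_sub_le _ _).trans (add_le_add ?_ ?_)
      · rw [Real.norm_of_nonneg hτ0]
      · rw [Real.norm_of_nonneg (by positivity)]
        gcongr
        exact div_le_self (by positivity) (by linarith)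
    · rw [norm_smul, Real.norm_of_nonneg (by positivity)]
      calc τ / d * ‖(innerSL ℝ q.2).comp (ContinuousLinearMap.snd ℝ ℝ (Space d))‖
          ≤ τ * (r * 1) := by
            gcongr
            · exact div_le_self hτ0 hd'
            · refine (ContinuousLinearMap.opNorm_comp_le _ _).trans
                (mul_le_mul ?_ hsnd (norm_nonneg _) hr0)
              rw [innerSL_apply_norm]
        _ = r * τ := by ring
  have e3 : ‖(w L * -(b * τ ^ (b + 1))) • ContinuousLinearMap.fst ℝ ℝ (Space d)‖ ≤
      N * b * τ ^ (b + 1) := by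
    rw [norm_smul, norm_mul, norm_neg, Real.norm_of_nonneg (show 0 ≤ b * τ ^ (b + 1) by positivity)]
    calc ‖w L‖ * (b * τ ^ (b + 1)) * ‖ContinuousLinearMap.fst ℝ ℝ (Space d)‖
        ≤ N * (b * τ ^ (b + 1)) * 1 := by gcongr; exact hN _
      _ = _ := by ring
  refine (norm_add_le _ _).trans ?_
  rw [ContinuousLinearMap.norm_smulRight_apply]
  have e4 := (norm_add_le _ _).trans (add_le_add e2 e3)
  refine (add_le_add e1 (mul_le_mul e4 (hpb q.2) (norm_nonneg _) (by positivity))).trans ?_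
  have hb0 : (0 : ℝ) ≤ b := Nat.cast_nonneg b
  have k1 : 0 ≤ N * C * b * (τ ^ b * r ^ a) := by positivity
  have k2 : 0 ≤ N * C * b * (τ ^ (b + 2) * r ^ (a + 3)) := by positivity
  have k3 : 0 ≤ N * C * b * (τ ^ (b + 1) * r ^ (a + 2)) := by positivity
  have : N * C * (b + 1) * (τ ^ b * r ^ a + τ ^ (b + 1) * r ^ (a + 1) +
        τ ^ (b + 2) * r ^ (a + 3) + τ ^ (b + 1) * r ^ (a + 2)) =
      N * C * (τ ^ b * r ^ a) + (N * (τ ^ b * (τ + r ^ 2 * τ ^ 2 + r * τ)) +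
        N * b * τ ^ (b + 1)) * (C * r ^ (a + 1)) + N * C * b * (τ ^ b * r ^ a) +
        N * C * b * (τ ^ (b + 2) * r ^ (a + 3)) + N * C * b * (τ ^ (b + 1) * r ^ (a + 2)) := by
    ring
  rw [this]
  linarith

lemma contDiffAt_levelKernel (hd : 1 ≤ d) (hw : ContDiff ℝ 1 w) (hp : ContDiff ℝ 1 p)
    (b : ℕ) {q : ℝ × Space d} (hq : 0 < q.1) : ContDiffAt ℝ 1 (levelKernel w b p) q := by
  have h1 : ContDiffAt ℝ 1 (fun q : ℝ × Space d => w (heatLevel d q)) q :=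
    hw.contDiffAt.comp q (contDiffAt_heatLevel hd hq)
  have h2 : ContDiffAt ℝ 1 (fun q : ℝ × Space d => (q.1⁻¹) ^ b) q :=
    (contDiffAt_fst.inv hq.ne').pow b
  exact (h1.mul h2).smul (hp.contDiffAt.comp q contDiffAt_snd)

lemma integrable_indicator_monomial (hd : 1 ≤ d) (T : ℝ) {a b : ℕ}
    (hab : (b : ℝ) - a / 2 < d / 2 + 1) :
    Integrable ({q : ℝ × Space d | 0 < q.1 ∧ heatLevel d q ≤ T}.indicator
      fun q => (q.1⁻¹) ^ b * ‖q.2‖ ^ a) := by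
  have hm : MeasurableSet {q : ℝ × Space d | 0 < q.1 ∧ heatLevel d q ≤ T} :=
    (measurableSet_lt measurable_const measurable_fst).inter
      (measurableSet_le (measurable_heatLevel d) measurable_const)
  refine integrable_of_heatLevel_le hd (T := T) (a := a) (b := b) (C := 1) ?_ ?_ ?_ hab
  · exact (Measurable.indicator (by fun_prop) hm).aestronglyMeasurable
  · intro q hq
    rw [indicator_apply_ne_zero] at hq
    exact hq.1
  · intro q hq hqT
    rw [indicator_of_mem (show q ∈ {q : ℝ × Space d | 0 < q.1 ∧ heatLevel d q ≤ T} from ⟨hq, hqT⟩),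
      one_mul, Real.norm_of_nonneg (by
      have := inv_nonneg.2 hq.le
      positivity)]

/-- With β = b - a/2 ≤ 2, the four monomials of the gradient bound have orders β, β + 1/2, β + 1/2,
β. All are at most 5/2, hence below d/2 + 1. -/
lemma integrable_fderiv_levelKernel [FiniteDimensional ℝ F] (hd : 4 < d) (hw : ContDiff ℝ 1 w)
    (hw0 : ∀ s ≤ 0, w s = 0) (hwT : ∀ s, T ≤ s → w s = 0) (hp : ContDiff ℝ 1 p)
    (hC : 0 ≤ C) (hpb : ∀ z, ‖p z‖ ≤ C * ‖z‖ ^ (a + 1)) (hpb' : ∀ z, ‖fderiv ℝ p z‖ ≤ C * ‖z‖ ^ a)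
    (hab : (b : ℝ) - a / 2 ≤ 2) : Integrable (fderiv ℝ (levelKernel w b p)) := by
  have hd1 : 1 ≤ d := by omega
  have hd4 : (4 : ℝ) < d := by exact_mod_cast hd
  obtain ⟨N₁, hN₁0, hN₁⟩ := exists_bound_of_continuous_of_zero hw.continuous hw0 hwT
  have hdw : Continuous fun s => deriv w s * s :=
    (hw.continuous_deriv (by norm_num)).mul continuous_id
  -- T + 1 stands in for T because the derivative is seen to vanish strictly beyond T, where w is
  -- locally zero.
  obtain ⟨N₂, hN₂0, hN₂⟩ := exists_bound_of_continuous_of_zero (w := fun s => deriv w s * s)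
    (T := T + 1) hdw (fun s hs => by
      rcases hs.eq_or_lt with rfl | hs
      · simp
      · have : w =ᶠ[𝓝 s] fun _ => 0 := by
          filter_upwards [gt_mem_nhds hs] with y hy using hw0 y (le_of_lt hy)
        rw [this.deriv_eq]; simp) (fun s hs => by
      rw [deriv_eq_zero_of_lt hwT (by linarith), zero_mul])
  set N := max N₁ N₂
  have hN : ∀ s, |w s| ≤ N := fun s => (hN₁ s).trans (le_max_left _ _)
  have hN' : ∀ s, |deriv w s * s| ≤ N := fun s => (hN₂ s).trans (le_max_right _ _)
  have i1 := integrable_indicator_monomial hd1 T (a := a) (b := b) (by linarith)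
  have i2 := integrable_indicator_monomial hd1 T (a := a + 1) (b := b + 1) (by push_cast; linarith)
  have i3 := integrable_indicator_monomial hd1 T (a := a + 3) (b := b + 2) (by push_cast; linarith)
  have i4 := integrable_indicator_monomial hd1 T (a := a + 2) (b := b + 1) (by push_cast; linarith)
  have hmeas : AEStronglyMeasurable (fderiv ℝ (levelKernel w b p)) := by
    have : FiniteDimensional ℝ (ℝ × Space d →L[ℝ] F) := inferInstance
    have : CompleteSpace F := FiniteDimensional.complete ℝ F
    have : SecondCountableTopology (ℝ × Space d →L[ℝ] F) :=
      have := FiniteDimensional.proper ℝ (ℝ × Space d →L[ℝ] F)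
      inferInstance
    exact (measurable_fderiv ℝ _).aestronglyMeasurable
  refine ((((i1.add i2).add i3).add i4).const_mul (N * C * (b + 1))).mono' hmeas ?_
  filter_upwards [ae_fst_ne_zero] with q hq
  simp only [Pi.add_apply]
  set B : Set (ℝ × Space d) := {q | 0 < q.1 ∧ heatLevel d q ≤ T}
  by_cases hqB : q ∈ B
  · simp only [indicator_of_mem hqB]
    exact norm_fderiv_levelKernel_le hd1 hw hp hN hN' hC hpb hpb' hqB.1
  · simp only [indicator_of_notMem hqB, add_zero, mul_zero]
    have h0 : fderiv ℝ (levelKernel w b p) q = 0 := by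
      rcases lt_or_gt_of_ne hq with h | h
      · exact fderiv_eq_zero_of_neg (fun q hq => levelKernel_eq_zero hw0 hq) h
      · have hlt : T < heatLevel d q := by
          by_contra hcon
          exact hqB ⟨h, not_lt.1 hcon⟩
        have hc : ContinuousAt (heatLevel d) q :=
          (contDiffAt_heatLevel hd1 h (n := 0)).continuousAt
        have : levelKernel w b p =ᶠ[𝓝 q] fun _ => 0 := by
          filter_upwards [hc.eventually (lt_mem_nhds hlt)] with y hy
          rw [levelKernel, hwT _ (le_of_lt hy), zero_mul, zero_smul]
        rw [this.fderiv_eq]; simp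
    rw [h0, norm_zero]

/-- Convolution of a bounded function with a level kernel of low parabolic order. -/
lemma hasFDerivAt_convolution_levelKernel [FiniteDimensional ℝ F] (hd : 4 < d)
    (hw : ContDiff ℝ 1 w) (hw0 : ∀ s ≤ 0, w s = 0) (hwT : ∀ s, T ≤ s → w s = 0)
    (hp : ContDiff ℝ 1 p) (hC : 0 ≤ C) (hpb : ∀ z, ‖p z‖ ≤ C * ‖z‖ ^ (a + 1))
    (hpb' : ∀ z, ‖fderiv ℝ p z‖ ≤ C * ‖z‖ ^ a) (hab : (b : ℝ) - a / 2 ≤ 2)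
    {f : ℝ × Space d → ℝ} {M : ℝ} (hf : AEStronglyMeasurable f) (hM : ∀ x, |f x| ≤ M) :
    (∀ x, HasFDerivAt (fun x => ∫ t, f t • levelKernel w b p (x - t))
      (∫ t, f t • fderiv ℝ (levelKernel w b p) (x - t)) x) ∧
      Continuous fun x => ∫ t, f t • fderiv ℝ (levelKernel w b p) (x - t) := by
  have hd1 : 1 ≤ d := by omega
  have hd4 : (4 : ℝ) < d := by exact_mod_cast hd
  exact hasFDerivAt_convolution_causal hf hM (fun q hq => levelKernel_eq_zero hw0 hq)
    (fun q hq => contDiffAt_levelKernel hd1 hw hp b hq) (hasCompactSupport_levelKernel hd1 hw0 hwT)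
    (integrable_levelKernel hd1 hw.continuous hw0 hwT hp.continuous hpb
      (by push_cast; linarith))
    (integrable_inv_smul_levelKernel hd1 hw.continuous hw0 hwT hp.continuous hpb
      (by push_cast; linarith))
    (integrable_fderiv_levelKernel hd hw hw0 hwT hp hC hpb hpb' hab)

end HeatMeanValue

/-! ### Regularity of the convolution, and the averaged formula as a convolution -/

namespace HeatMeanValue
open Set Filter Topology ENNReal
open scoped ContDiff

variable {d : ℕ} {u h : ℝ × Space d → ℝ}

/-- Joint C¹ regularity of u and of its space gradient asks for more than class C^{1,2}, but both
conditions are instances of one statement about convolutions. -/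
lemma isC12On_univ_of_contDiff (hu : ContDiff ℝ 1 u)
    (hD : ContDiff ℝ 1 fun q => (fderiv ℝ u q).comp (ContinuousLinearMap.inr ℝ ℝ (Space d))) :
    IsC12On u univ := by
  have hfd : ∀ q, HasFDerivAt u (fderiv ℝ u q) q := fun q =>
    (hu.differentiable (by norm_num) q).hasFDerivAt
  have hx : ∀ q : ℝ × Space d, fderiv ℝ (fun x => u (q.1, x)) q.2 =
      (fderiv ℝ u q).comp (ContinuousLinearMap.inr ℝ ℝ (Space d)) := fun q =>
    ((hfd q).comp q.2 (hasFDerivAt_prodMk_right q.1 q.2)).fderiv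
  have hx' : ∀ t : ℝ, fderiv ℝ (fun x => u (t, x)) =
      fun x => (fderiv ℝ u (t, x)).comp (ContinuousLinearMap.inr ℝ ℝ (Space d)) := fun t =>
    funext fun x => hx (t, x)
  have ht : ∀ q : ℝ × Space d, HasDerivAt (fun t => u (t, q.2)) (fderiv ℝ u q (1, 0)) q.1 := by
    intro q
    have h0 : HasFDerivAt (fun t => u (t, q.2))
        ((fderiv ℝ u q).comp (ContinuousLinearMap.inl ℝ ℝ (Space d))) q.1 :=
      (hfd q).comp q.1 (hasFDerivAt_prodMk_left q.1 q.2)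
    exact h0.hasDerivAt.congr_deriv (by simp)
  have hxx : ∀ q : ℝ × Space d, fderiv ℝ (fderiv ℝ fun x => u (q.1, x)) q.2 =
      (fderiv ℝ (fun q => (fderiv ℝ u q).comp (ContinuousLinearMap.inr ℝ ℝ (Space d))) q).comp
        (ContinuousLinearMap.inr ℝ ℝ (Space d)) := by
    intro q
    rw [hx']
    exact (HasFDerivAt.comp
      (g := fun q => (fderiv ℝ u q).comp (ContinuousLinearMap.inr ℝ ℝ (Space d)))
      (f := fun x => (q.1, x)) q.2 (hD.differentiable (by norm_num) (q.1, q.2)).hasFDerivAt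
      (hasFDerivAt_prodMk_right q.1 q.2)).fderiv
  refine ⟨hu.continuous.continuousOn, fun q _ => (ht q).differentiableAt, ?_, fun q _ => ?_, ?_, ?_⟩
  · have : timeDeriv u = fun q => fderiv ℝ u q (1, 0) := funext fun q => (ht q).deriv
    rw [this]
    exact ((hu.continuous_fderiv (by norm_num)).clm_apply continuous_const).continuousOn
  · apply ContDiff.contDiffAt
    rw [show (2 : WithTop ℕ∞) = 1 + 1 by norm_num, contDiff_succ_iff_fderiv]
    refine ⟨fun x => ?_, by simp, ?_⟩
    · exact ((hfd (q.1, x)).comp x (hasFDerivAt_prodMk_right q.1 x)).differentiableAt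
    · rw [hx']
      exact hD.comp (contDiff_const.prodMk contDiff_id)
  · simp only [hx]
    exact hD.continuous.continuousOn
  · simp only [hxx]
    exact ((hD.continuous_fderiv (by norm_num)).clm_comp continuous_const).continuousOn

lemma IsC12On.of_locally {A : Set (ℝ × Space d)}
    (hloc : ∀ p ∈ A, ∃ u, IsC12On u univ ∧ h =ᶠ[𝓝 p] u) : IsC12On h A := by
  have hx : ∀ {u : ℝ × Space d → ℝ} {p}, h =ᶠ[𝓝 p] u →
      (fun x => h (p.1, x)) =ᶠ[𝓝 p.2] fun x => u (p.1, x) := fun {u p} hu =>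
    ((Continuous.prodMk_right p.1).continuousAt (x := p.2)).eventually hu
  have ht : ∀ {u : ℝ × Space d → ℝ} {p}, h =ᶠ[𝓝 p] u →
      (fun t => h (t, p.2)) =ᶠ[𝓝 p.1] fun t => u (t, p.2) := fun {u p} hu =>
    ((Continuous.prodMk_left p.2).continuousAt (x := p.1)).eventually hu
  refine ⟨fun p hp => ?_, fun p hp => ?_, fun p hp => ?_, fun p hp => ?_, fun p hp => ?_,
    fun p hp => ?_⟩ <;> obtain ⟨u, hu, heq⟩ := hloc p hp
  · exact ((hu.continuousOn.continuousAt univ_mem).congr heq.symm).continuousWithinAt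
  · exact (hu.differentiableAt_time p (mem_univ p)).congr_of_eventuallyEq (ht heq)
  · refine ((hu.continuousOn_timeDeriv.continuousAt univ_mem).congr ?_).continuousWithinAt
    filter_upwards [heq.eventuallyEq_nhds] with y hy
    exact ((ht hy).deriv_eq).symm
  · exact (hu.contDiffAt_space p (mem_univ p)).congr_of_eventuallyEq (hx heq)
  · refine ((hu.continuousOn_fderiv_space.continuousAt univ_mem).congr ?_).continuousWithinAt
    filter_upwards [heq.eventuallyEq_nhds] with y hy
    exact ((hx hy).fderiv_eq).symm
  · refine ((hu.continuousOn_fderiv_fderiv_space.continuousAt univ_mem).congr ?_).continuousWithinAt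
    filter_upwards [heq.eventuallyEq_nhds] with y hy
    exact ((hx hy).fderiv.fderiv_eq).symm

section Convolution

variable {w : ℝ → ℝ} {T : ℝ} {f : ℝ × Space d → ℝ} {M : ℝ}

lemma norm_two_smul_innerSL (z : Space d) : ‖(2 : ℝ) • innerSL ℝ z‖ = 2 * ‖z‖ := by
  rw [norm_smul, innerSL_apply_norm]; simp

lemma fderiv_norm_sq_eq (z : Space d) :
    fderiv ℝ (fun z : Space d => ‖z‖ ^ 2) z = (2 : ℝ) • innerSL ℝ z := by
  rw [(hasStrictFDerivAt_norm_sq z).hasFDerivAt.fderiv]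
  ext y; simp

/-- The space derivative of the averaged heat sphere kernel. -/
lemma fderiv_levelKernel_comp_inr (hd : 1 ≤ d) (hw : ContDiff ℝ 1 w) {q : ℝ × Space d}
    (hq : 0 < q.1) :
    (fderiv ℝ (levelKernel w 2 fun z : Space d => ‖z‖ ^ 2) q).comp
      (ContinuousLinearMap.inr ℝ ℝ (Space d)) =
    levelKernel (fun s => deriv w s * s) 3 (fun z => (‖z‖ ^ 2 / d) • innerSL ℝ z) q +
      levelKernel w 2 (fun z => (2 : ℝ) • innerSL ℝ z) q := by
  have hd' : (0 : ℝ) < d := by exact_mod_cast hd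
  have hp : ContDiff ℝ 1 fun z : Space d => ‖z‖ ^ 2 := contDiff_norm_sq ℝ
  rw [(hasFDerivAt_levelKernel hd hw hp 2 hq).fderiv, fderiv_norm_sq_eq]
  ext y
  simp [levelKernel]
  field_simp
  ring

/-- The space gradient of the kernel is a sum of two level kernels with (b,a) = (3,2) and (2,0).
Both have b - a/2 = 2, so the differentiation lemma for level kernels applies once more to the
gradient of the convolution. -/
lemma isC12On_convolution (hd : 4 < d) (hw : ContDiff ℝ 2 w) (hw0 : ∀ s ≤ 0, w s = 0)
    (hwT : ∀ s, T ≤ s → w s = 0) (hf : AEStronglyMeasurable f) (hM : ∀ x, |f x| ≤ M) :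
    IsC12On (fun x => ∫ t, f t • levelKernel w 2 (fun z : Space d => ‖z‖ ^ 2) (x - t)) univ := by
  have hd1 : 1 ≤ d := by omega
  have hd' : (1 : ℝ) ≤ d := by exact_mod_cast hd1
  have hw1 : ContDiff ℝ 1 w := hw.of_le (by norm_num)
  have hsq : ContDiff ℝ 1 fun z : Space d => ‖z‖ ^ 2 := contDiff_norm_sq ℝ
  have hinner : ContDiff ℝ 1 fun z : Space d => innerSL ℝ z := (innerSL ℝ).contDiff
  obtain ⟨hK, hKc⟩ := hasFDerivAt_convolution_levelKernel (b := 2) (a := 1) (C := 2) hd hw1 hw0 hwT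
    hsq (by norm_num)
    (fun z => by
      rw [Real.norm_of_nonneg (by positivity), one_add_one_eq_two]; nlinarith [sq_nonneg ‖z‖])
    (fun z => by rw [fderiv_norm_sq_eq, norm_two_smul_innerSL, pow_one]) (by norm_num) hf hM
  have hw1' : ContDiff ℝ 1 fun s => deriv w s * s :=
    (ContDiff.deriv' (by rwa [one_add_one_eq_two])).mul contDiff_id
  have hw10 : ∀ s ≤ 0, (fun s => deriv w s * s) s = 0 := fun s hs => by
    rcases hs.eq_or_lt with rfl | hs
    · simp
    · have : w =ᶠ[𝓝 s] fun _ => 0 := by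
        filter_upwards [gt_mem_nhds hs] with y hy using hw0 y (le_of_lt hy)
      simp only
      rw [this.deriv_eq]; simp
  have hw1T : ∀ s, T + 1 ≤ s → (fun s => deriv w s * s) s = 0 := fun s hs => by
    simp only
    rw [deriv_eq_zero_of_lt hwT (by linarith), zero_mul]
  have hp1 : ContDiff ℝ 1 fun z : Space d => (‖z‖ ^ 2 / d) • innerSL ℝ z :=
    (hsq.div_const _).smul hinner
  have hp1' : ∀ z : Space d, ‖fderiv ℝ (fun z : Space d => (‖z‖ ^ 2 / d) • innerSL ℝ z) z‖ ≤
      3 * ‖z‖ ^ 2 := by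
    intro z
    have h1 : HasFDerivAt (fun z : Space d => ‖z‖ ^ 2 / (d : ℝ))
        ((d : ℝ)⁻¹ • ((2 : ℝ) • innerSL ℝ z)) z := by
      rw [← fderiv_norm_sq_eq]
      simp only [div_eq_mul_inv]
      exact (hsq.differentiable (by norm_num) z).hasFDerivAt.mul_const _
    set L : Space d →L[ℝ] Space d →L[ℝ] ℝ := innerSL ℝ
    have h2 : HasFDerivAt (fun z : Space d => (‖z‖ ^ 2 / d) • L z)
        ((‖z‖ ^ 2 / (d : ℝ)) • L + ((d : ℝ)⁻¹ • ((2 : ℝ) • innerSL ℝ z)).smulRight (L z)) z :=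
      h1.smul L.hasFDerivAt
    change ‖fderiv ℝ (fun z : Space d => (‖z‖ ^ 2 / d) • L z) z‖ ≤ _
    rw [h2.fderiv]
    have hinv : (d : ℝ)⁻¹ ≤ 1 := inv_le_one_of_one_le₀ hd'
    have hinv0 : 0 ≤ (d : ℝ)⁻¹ := by positivity
    refine ContinuousLinearMap.opNorm_le_bound _ (by positivity) fun v => ?_
    change ‖(‖z‖ ^ 2 / (d : ℝ)) • innerSL ℝ v + ((d : ℝ)⁻¹ * (2 * inner ℝ z v)) • innerSL ℝ z‖ ≤ _
    have e1 : ‖(‖z‖ ^ 2 / (d : ℝ)) • innerSL ℝ v‖ ≤ ‖z‖ ^ 2 * ‖v‖ := by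
      rw [norm_smul, Real.norm_of_nonneg (by positivity), innerSL_apply_norm]
      gcongr
      exact div_le_self (by positivity) hd'
    have e2 : ‖((d : ℝ)⁻¹ * (2 * inner ℝ z v)) • innerSL ℝ z‖ ≤ 2 * ‖z‖ ^ 2 * ‖v‖ := by
      rw [norm_smul, norm_mul, norm_mul, innerSL_apply_norm, Real.norm_of_nonneg hinv0,
        Real.norm_ofNat]
      calc (d : ℝ)⁻¹ * (2 * ‖inner ℝ z v‖) * ‖z‖ ≤ 1 * (2 * (‖z‖ * ‖v‖)) * ‖z‖ := by
            gcongr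
            exact norm_inner_le_norm z v
        _ = _ := by ring
    exact (norm_add_le_of_le e1 e2).trans (le_of_eq (by ring))
  have hp1b : ∀ z : Space d, ‖(‖z‖ ^ 2 / (d : ℝ)) • innerSL ℝ z‖ ≤ 3 * ‖z‖ ^ (2 + 1) := by
    intro z
    rw [norm_smul, innerSL_apply_norm, Real.norm_of_nonneg (by positivity)]
    calc ‖z‖ ^ 2 / d * ‖z‖ ≤ ‖z‖ ^ 2 * ‖z‖ := by
          gcongr; exact div_le_self (by positivity) hd'
      _ ≤ 3 * ‖z‖ ^ (2 + 1) := by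
          rw [pow_succ]; nlinarith [pow_nonneg (norm_nonneg z) 3, pow_succ ‖z‖ 2]
  have hp2 : ContDiff ℝ 1 fun z : Space d => (2 : ℝ) • innerSL ℝ z := hinner.const_smul 2
  have hp2' : ∀ z : Space d, ‖fderiv ℝ (fun z : Space d => (2 : ℝ) • innerSL ℝ z) z‖ ≤
      2 * ‖z‖ ^ 0 := by
    intro z
    have h2 : HasFDerivAt (fun z : Space d => (2 : ℝ) • innerSL ℝ z) _ z :=
      (innerSL ℝ (E := Space d)).hasFDerivAt.const_smul (2 : ℝ)
    rw [h2.fderiv, pow_zero, mul_one]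
    exact ContinuousLinearMap.opNorm_le_bound _ zero_le_two fun v =>
      (norm_two_smul_innerSL v).le
  have hp2b : ∀ z : Space d, ‖(2 : ℝ) • innerSL ℝ z‖ ≤ 2 * ‖z‖ ^ (0 + 1) := fun z => by
    rw [norm_two_smul_innerSL, zero_add, pow_one]
  obtain ⟨hK1, hK1c⟩ := hasFDerivAt_convolution_levelKernel (b := 3) (a := 2) (C := 3) hd hw1' hw10
    hw1T hp1 (by norm_num) hp1b hp1' (by norm_num) hf hM
  obtain ⟨hK2, hK2c⟩ := hasFDerivAt_convolution_levelKernel (b := 2) (a := 0) (C := 2) hd hw1 hw0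
    hwT hp2 (by norm_num) hp2b hp2' (by norm_num) hf hM
  have hd4 : (4 : ℝ) < d := by exact_mod_cast hd
  have i1 := integrable_levelKernel (b := 3) hd1 hw1'.continuous hw10 hw1T hp1.continuous hp1b
    (by push_cast; linarith)
  have i2 := integrable_levelKernel (b := 2) hd1 hw1.continuous hw0 hwT hp2.continuous hp2b
    (by push_cast; linarith)
  have i0 := integrable_fderiv_levelKernel (b := 2) (a := 1) (C := 2) hd hw1 hw0 hwT hsq
    (by norm_num)
    (fun z => by
      rw [Real.norm_of_nonneg (by positivity), one_add_one_eq_two]; nlinarith [sq_nonneg ‖z‖])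
    (fun z => by rw [fderiv_norm_sq_eq, norm_two_smul_innerSL, pow_one]) (by norm_num)
  refine isC12On_univ_of_contDiff ?_ ?_
  · rw [contDiff_one_iff_fderiv]
    refine ⟨fun x => (hK x).differentiableAt, ?_⟩
    rwa [show fderiv ℝ _ = _ from funext fun x => (hK x).fderiv]
  · have heq : (fun x => (fderiv ℝ (fun x => ∫ t, f t •
        levelKernel w 2 (fun z : Space d => ‖z‖ ^ 2) (x - t)) x).comp
          (ContinuousLinearMap.inr ℝ ℝ (Space d))) =
        fun x => (∫ t, f t • levelKernel (fun s => deriv w s * s) 3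
          (fun z => (‖z‖ ^ 2 / d) • innerSL ℝ z) (x - t)) +
          ∫ t, f t • levelKernel w 2 (fun z => (2 : ℝ) • innerSL ℝ z) (x - t) := by
      ext x : 1
      rw [(hK x).fderiv, ← integral_add (integrable_smul_comp_sub hf hM i1 x)
        (integrable_smul_comp_sub hf hM i2 x)]
      have hcomp := (ContinuousLinearMap.precomp ℝ
        (ContinuousLinearMap.inr ℝ ℝ (Space d))).integral_comp_comm
        (integrable_smul_comp_sub hf hM i0 x)
      refine hcomp.symm.trans (integral_congr_ae ?_)
      filter_upwards [(Measure.measurePreserving_sub_left volume x).quasiMeasurePreserving.ae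
        (ae_fst_ne_zero (d := d))] with t ht
      have hkey : (fderiv ℝ (levelKernel w 2 fun z : Space d => ‖z‖ ^ 2) (x - t)).comp
          (ContinuousLinearMap.inr ℝ ℝ (Space d)) =
          levelKernel (fun s => deriv w s * s) 3 (fun z => (‖z‖ ^ 2 / d) • innerSL ℝ z) (x - t) +
            levelKernel w 2 (fun z => (2 : ℝ) • innerSL ℝ z) (x - t) := by
        rcases lt_or_gt_of_ne ht with hlt | hgt
        · rw [fderiv_eq_zero_of_neg (fun q hq => levelKernel_eq_zero hw0 hq) hlt,
            levelKernel_eq_zero hw10 hlt.le, levelKernel_eq_zero hw0 hlt.le]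
          simp
        · exact fderiv_levelKernel_comp_inr hd1 hw1 hgt
      change (f t • fderiv ℝ (levelKernel w 2 fun z : Space d => ‖z‖ ^ 2) (x - t)).comp
        (ContinuousLinearMap.inr ℝ ℝ (Space d)) = _
      rw [ContinuousLinearMap.smul_comp, hkey, smul_add]
    rw [heq]
    refine ContDiff.add ?_ ?_
    · rw [contDiff_one_iff_fderiv]
      refine ⟨fun x => (hK1 x).differentiableAt, ?_⟩
      rwa [show fderiv ℝ _ = _ from funext fun x => (hK1 x).fderiv]
    · rw [contDiff_one_iff_fderiv]
      refine ⟨fun x => (hK2 x).differentiableAt, ?_⟩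
      rwa [show fderiv ℝ _ = _ from funext fun x => (hK2 x).fderiv]

end Convolution

section Representation

variable {A : Set (ℝ × Space d)} {w : ℝ → ℝ} {T : ℝ} {t : ℝ} {x : Space d} {C : ℝ}

/-- A convolution evaluates f at x - z and the mean value formula at x + z; the reflection z ↦ -z
preserves both the measure and the kernel. -/
lemma integral_smul_levelKernel_eq {f : ℝ × Space d → ℝ} (hw0 : ∀ s ≤ 0, w s = 0)
    (t : ℝ) (x : Space d) :
    ∫ q, f q • levelKernel w 2 (fun z : Space d => ‖z‖ ^ 2) ((t, x) - q) =
      ∫ q in Ioi (0 : ℝ) ×ˢ univ, ‖q.2‖ ^ 2 / q.1 ^ 2 *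
        (w (heatLevel d q) * f (t - q.1, x + q.2)) := by
  have hmp : MeasurePreserving (fun q : ℝ × Space d => (q.1, -q.2)) := by
    rw [Measure.volume_eq_prod]
    exact (MeasurePreserving.id _).prod (Measure.measurePreserving_neg volume)
  have hemb : MeasurableEmbedding (fun q : ℝ × Space d => (q.1, -q.2)) :=
    ((Homeomorph.refl ℝ).prodCongr (Homeomorph.neg (Space d))).measurableEmbedding
  rw [← integral_sub_left_eq_self _ volume (t, x), ← hmp.integral_comp hemb,
    setIntegral_eq_integral_of_forall_compl_eq_zero]
  · refine integral_congr_ae (Eventually.of_forall fun q => ?_)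
    simp only [levelKernel, Prod.mk_sub_mk, sub_neg_eq_add, sub_add_cancel_left,
      norm_neg, heatLevel, smul_eq_mul]
    rw [inv_pow]
    ring_nf
  · intro q hq
    have hq1 : q.1 ≤ 0 := by
      by_contra hcon
      exact hq ⟨not_le.1 hcon, mem_univ _⟩
    rw [hw0 _ (heatLevel_nonpos hq1), zero_mul, mul_zero]

lemma integrableOn_levelWeight_of_bounded (hd : 1 ≤ d) (hw : Continuous w) (hw0 : ∀ s ≤ 0, w s = 0)
    (hwT : ∀ s, T ≤ s → w s = 0) {f : ℝ × Space d → ℝ} (hf : AEStronglyMeasurable f)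
    (hC : ∀ p, |f p| ≤ C) (t : ℝ) (x : Space d) :
    IntegrableOn (fun q => ‖q.2‖ ^ 2 / q.1 ^ 2 * (w (heatLevel d q) * f (t - q.1, x + q.2)))
      (Ioi (0 : ℝ) ×ˢ univ) := by
  have hd' : (0 : ℝ) < d := by exact_mod_cast hd
  have hmp : MeasurePreserving (fun q : ℝ × Space d => (t - q.1, x + q.2)) := by
    rw [Measure.volume_eq_prod]
    exact (Measure.measurePreserving_sub_left volume t).prod (measurePreserving_add_left volume x)
  have hK := integrable_levelKernel (b := 2) (a := 2) (C := 1) (p := fun z : Space d => ‖z‖ ^ 2)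
    hd hw hw0 hwT (by fun_prop) (fun z => by simp) (by push_cast; linarith)
  have := hK.bdd_smul C (hf.comp_quasiMeasurePreserving hmp.quasiMeasurePreserving)
    (Eventually.of_forall fun q => hC _)
  refine this.integrableOn.congr (Eventually.of_forall fun q => ?_)
  simp only [Pi.smul_apply', levelKernel, smul_eq_mul, Function.comp, inv_pow]
  ring

/-- At each level α < T the mean integral is 2π^(d/2) h(t,x), and this factor leaves the integral
over α. Extending h by zero changes nothing, as the heat spheres involved lie in A. -/
lemma integral_convolution_eq_of_meanValueProperty (hd : 1 ≤ d) (hA : MeasurableSet A)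
    (hC : ∀ p ∈ A, |h p| ≤ C) (hC0 : 0 ≤ C) (hm : AEStronglyMeasurable h (volume.restrict A))
    (hmv : MeanValueProperty h A) (hw : Continuous w) (hw0 : ∀ s ≤ 0, w s = 0)
    (hwT : ∀ s, T ≤ s → w s = 0) (htx : (t, x) ∈ A) (hT : Admissible A t x T) :
    ∫ q, A.indicator h q • levelKernel w 2 (fun z : Space d => ‖z‖ ^ 2) ((t, x) - q) =
      2 * Real.pi ^ ((d : ℝ) / 2) * (∫ α in Ioi (0 : ℝ), levelDensity d α * w α) * h (t, x) := by
  have hπ : 0 < Real.pi ^ ((d : ℝ) / 2) := Real.rpow_pos_of_pos Real.pi_pos _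
  rw [integral_smul_levelKernel_eq hw0, integral_heatLevel_mul_eq hd]
  · rw [mul_right_comm, mul_comm _ (∫ α in Ioi (0 : ℝ), levelDensity d α * w α),
      ← integral_mul_const]
    refine setIntegral_congr_fun measurableSet_Ioi fun α hα => ?_
    rcases le_or_gt T α with hle | hlt
    · simp [hwT α hle]
    · have hαA := hT.mono hα hlt.le
      have h1 := (hmv t x α htx hαA).2
      have h2 : ∫ p, meanIntegrand (A.indicator h) t x α p ∂(meanMeasure d) =
          ∫ p, meanIntegrand h t x α p ∂(meanMeasure d) := by
        refine integral_congr_ae ?_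
        filter_upwards [ae_meanMeasure d] with p hp
        rw [meanIntegrand_eq, meanIntegrand_eq, indicator_of_mem (hαA.mapsTo
          (heatSpherePoint_mem_heatCylinder hd (le_of_lt hα) le_rfl hp))]
      rw [h2, h1]
      field_simp
  · refine integrableOn_levelWeight_of_bounded hd hw hw0 hwT
      ((aestronglyMeasurable_indicator_iff hA).2 hm) (C := C) (fun p => ?_) t x
    by_cases hp : p ∈ A
    · rw [indicator_of_mem hp]; exact hC p hp
    · rw [indicator_of_notMem hp, abs_zero]; exact hC0

lemma exists_levelWeight (hd : 1 ≤ d) (hT : 0 < T) : ∃ w : ℝ → ℝ, ContDiff ℝ 2 w ∧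
    (∀ s ≤ 0, w s = 0) ∧ (∀ s, T ≤ s → w s = 0) ∧
    0 < ∫ α in Ioi (0 : ℝ), levelDensity d α * w α := by
  have hd' : (0 : ℝ) < d := by exact_mod_cast hd
  -- The bump lives in [T/4, 3T/4], away from α = 0 where the density may be singular and from α =
  -- T.
  set b : ContDiffBump (T / 2) := ⟨T / 8, T / 4, by linarith, by linarith⟩ with hb
  have hz : ∀ s, s ∉ Ioo (T / 4) (3 * T / 4) → b s = 0 := by
    intro s hs
    apply b.zero_of_le_dist
    change T / 4 ≤ dist s (T / 2)
    rw [Real.dist_eq]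
    by_contra hcon
    rw [not_le, abs_lt] at hcon
    exact hs ⟨by linarith [hcon.1], by linarith [hcon.2]⟩
  refine ⟨b, b.contDiff, fun s hs => hz s fun h => by linarith [h.1],
    fun s hs => hz s fun h => by linarith [h.2], ?_⟩
  have hle : T / 4 < 3 * T / 4 := by linarith
  rw [setIntegral_eq_of_subset_of_forall_sdiff_eq_zero measurableSet_Ioi
    (s := Ioc (T / 4) (3 * T / 4)) (fun s hs => lt_trans (by linarith) hs.1)
    (fun s hs => by rw [hz s fun h => hs.2 ⟨h.1, h.2.le⟩, mul_zero]),
    ← intervalIntegral.integral_of_le hle.le]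
  refine intervalIntegral.intervalIntegral_pos_of_pos_on ?_ (fun s hs => ?_) hle
  · refine ContinuousOn.intervalIntegrable fun s hs => ?_
    rw [uIcc_of_le hle.le] at hs
    have hs0 : s ≠ 0 := by linarith [hs.1]
    apply ContinuousAt.continuousWithinAt
    unfold levelDensity
    exact ContinuousAt.mul (ContinuousAt.div (by fun_prop) continuousAt_id hs0)
      b.continuous.continuousAt
  · have hs0 : 0 < s := lt_trans (by linarith) hs.1
    refine mul_pos (by unfold levelDensity; positivity) (b.pos_of_mem_ball ?_)
    rw [Metric.mem_ball, Real.dist_eq]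
    change |s - T / 2| < T / 4
    rw [abs_lt]
    constructor <;> linarith [hs.1, hs.2]

end Representation

theorem MeanValueProperty.isC12On {A : Set (ℝ × Space d)} (hd : 4 < d) (hA : IsOpen A)
    (hb : ∃ C : ℝ, ∀ p ∈ A, |h p| ≤ C) (hm : AEStronglyMeasurable h (volume.restrict A))
    (hmv : MeanValueProperty h A) : IsC12On h A := by
  have hd1 : 1 ≤ d := by omega
  obtain ⟨C₀, hC₀⟩ := hb
  set C := max C₀ 0
  have hC : ∀ p ∈ A, |h p| ≤ C := fun p hp => (hC₀ p hp).trans (le_max_left _ _)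
  have hC0 : 0 ≤ C := le_max_right _ _
  refine IsC12On.of_locally fun p₀ hp₀ => ?_
  -- A single T admissible at all points near p₀ lets one kernel represent h on a whole
  -- neighbourhood.
  obtain ⟨T, hT0, hT⟩ := exists_admissible (hA.mem_nhds hp₀)
  obtain ⟨w, hw, hw0, hwT, hpos⟩ := exists_levelWeight (d := d) hd1 hT0
  have hπ : 0 < Real.pi ^ ((d : ℝ) / 2) := Real.rpow_pos_of_pos Real.pi_pos _
  set c := 2 * Real.pi ^ ((d : ℝ) / 2) * ∫ α in Ioi (0 : ℝ), levelDensity d α * w α with hc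
  have hcpos : 0 < c := by positivity
  have hfm : AEStronglyMeasurable (A.indicator h) :=
    (aestronglyMeasurable_indicator_iff hA.measurableSet).2 hm
  have hfb : ∀ p, |(c⁻¹ • A.indicator h) p| ≤ c⁻¹ * C := fun p => by
    rw [Pi.smul_apply, smul_eq_mul, abs_mul, abs_of_pos (inv_pos.2 hcpos)]
    refine mul_le_mul_of_nonneg_left ?_ (inv_pos.2 hcpos).le
    by_cases hp : p ∈ A
    · rw [indicator_of_mem hp]; exact hC p hp
    · rw [indicator_of_notMem hp, abs_zero]; exact hC0
  refine ⟨_, isC12On_convolution hd hw hw0 hwT (hfm.const_smul c⁻¹) hfb, ?_⟩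
  filter_upwards [hT, hA.mem_nhds hp₀] with p hp hpA
  simp only [Pi.smul_apply, smul_assoc]
  rw [integral_smul, integral_convolution_eq_of_meanValueProperty hd1 hA.measurableSet hC hC0 hm
    hmv hw.continuous hw0 hwT hpA hp, ← hc, smul_eq_mul, inv_mul_cancel_left₀ hcpos.ne']

end HeatMeanValue

theorem theorem1 (d : ℕ) (hd : 1 ≤ d) (A : Set (ℝ × HeatMeanValue.Space d)) (hA : IsOpen A)
    (h : ℝ × HeatMeanValue.Space d → ℝ) :
    (HeatMeanValue.IsTemperature h A → HeatMeanValue.MeanValueProperty h A) ∧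
    (HeatMeanValue.IsC12On h A → HeatMeanValue.MeanValueProperty h A →
      HeatMeanValue.IsTemperature h A) ∧
    (4 < d → (∃ C : ℝ, ∀ p ∈ A, |h p| ≤ C) →
      AEStronglyMeasurable h (volume.restrict A) →
      (HeatMeanValue.IsTemperature h A ↔ HeatMeanValue.MeanValueProperty h A)) := by
  refine ⟨fun ht => ht.meanValueProperty hd,
    fun hh hmv => hh.isTemperature_of_meanValueProperty hd hA hmv, fun hd4 hb hm =>
    ⟨fun ht => ht.meanValueProperty hd, fun hmv => ?_⟩⟩
  have hh : HeatMeanValue.IsC12On h A :=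
    HeatMeanValue.MeanValueProperty.isC12On hd4 hA hb hm hmv
  exact hh.isTemperature_of_meanValueProperty hd hA hmv
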